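/- A polyhedral scene in $\mathbb R^3$ is a finite triangulated complex $K$ of vertices, edges and triangles (edges and triangles may be unbounded: rays, half-strips, wedges), given by its faces, i.e. pairwise disjoint relatively open simplices, every face of a face being again a face. Its complexity is the total number of its vertices, edges and triangles, and $|K|$ denotes the union of its faces. The surface of a (triangulated) terrain, i.e. a polyhedral surface met exactly once by every vertical line (over some planar region) and the (triangulated) boundary of a set of polyhedral obstacles are such scenes. Let $\mathcal S$ be the $4$-dimensional space of all lines in $\mathbb R^3$ with its usual topology. The global visibility map of a scene is the partition of $\mathcal S$ into cells, the cells being the connected components of the sets of lines that intersect the same set of faces of the scene. Its complexity is the number of its cells. Theorem. (Encoding.) Let $O$ be a closed set whose boundary is $|K|$, and call two points visible to each other if no point strictly between them lies in $O$. The map encodes all pairs of mutually visible points of $|K|$: if two lines $\ell_1,\ell_2$ belong to the same cell, $p_i,q_i\in\ell_i$ ($i=1,2$), $p_1,p_2$ lie on the same face and $q_1,q_2$ lie on the same face, then $p_1,q_1$ see each other if and only if $p_2,q_2$ do. The worst-case complexity of the global visibility map of scenes of complexity $n$ is $\Theta(n^4)$, both for terrains and for sets of obstacles in space. That is: (1)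 There is a constant $C>0$ such that the global visibility map of every scene of complexity $n\ge 1$ has at most $Cn^4$ cells. (2) There are $c>0$ and $n_0$ such that for every $n\ge n_0$ there is a terrain of complexity at most $n$, over a convex planar region with nonempty interior, whose global visibility map has at least $cn^4$ cells. (3) There are $c>0$ and $n_0$ such that for every $n\ge n_0$ there is a closed solid $O\subset\mathbb R^3$ (a set of obstacles, $O=\overline{\operatorname{int} O}$) whose boundary is a scene of complexity at most $n$ with a global visibility map of at least $cn^4$ cells. -/

import Mathlib

open Set

noncomputable section

namespace VisMap

/-- Euclidean three-space. -/
abbrev E3 : Type := EuclideanSpace ℝ (Fin 3)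

/-! ### Polyhedral scenes -/

/-- The open (relatively open) simplex with finite vertex set `s.1` and set `s.2` of vertices at
infinity, the latter given by direction vectors. If `s.2 = ∅` this is an ordinary open simplex
(point, open segment, open triangle); otherwise it is unbounded (ray, half-strip, wedge). -/
def openCell (s : Finset E3 × Finset E3) : Set E3 :=
  {x | ∃ a b : E3 → ℝ, (∀ v ∈ s.1, 0 < a v) ∧ (∑ v ∈ s.1, a v = 1) ∧ (∀ d ∈ s.2, 0 < b d) ∧
    x = ∑ v ∈ s.1, a v • v + ∑ d ∈ s.2, b d • d}

/-- The simplex is nondegenerate: the homogeneous coordinate vectors `(v, 1)` of its vertices and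
`(d, 0)` of its directions are linearly independent. -/
def Nondegenerate (s : Finset E3 × Finset E3) : Prop :=
  LinearIndependent ℝ
    (Sum.elim (fun v : s.1 => ((v : E3), (1 : ℝ))) (fun d : s.2 => ((d : E3), (0 : ℝ))))

/-- A finite triangulated polyhedral scene in space: a finite complex of vertices, edges and
triangles, in which edges and triangles may be unbounded. The faces are the open simplices
`openCell s` for `s ∈ cells`; they are pairwise disjoint, and every face of a face is a face.
Terrains (`IsTerrainOver`) and boundaries of obstacles (`IsObstacleBoundary`) are such scenes. -/
structure Scene where
  cells : Finset (Finset E3 × Finset E3)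
  vertex_nonempty : ∀ s ∈ cells, s.1.Nonempty
  card_le_three : ∀ s ∈ cells, s.1.card + s.2.card ≤ 3
  nondegenerate : ∀ s ∈ cells, Nondegenerate s
  face_mem : ∀ s ∈ cells, ∀ V D : Finset E3, V ⊆ s.1 → D ⊆ s.2 → V.Nonempty → (V, D) ∈ cells
  disjoint_cells : ∀ s ∈ cells, ∀ t ∈ cells, s ≠ t → Disjoint (openCell s) (openCell t)

/-- The underlying point set of the scene. -/
def Scene.support (K : Scene) : Set E3 := ⋃ s ∈ K.cells, openCell s

/-- The complexity of the scene: the total number of its vertices, edges and triangles. -/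
def Scene.complexity (K : Scene) : ℕ := K.cells.card

/-- The vertical projection. -/
def proj (p : E3) : ℝ × ℝ := (p 0, p 1)

/-- `K` is a terrain over the planar region `R`: each vertical line over a point of `R` meets the
surface in exactly one point, and the other vertical lines do not meet it. -/
def Scene.IsTerrainOver (K : Scene) (R : Set (ℝ × ℝ)) : Prop := BijOn proj K.support R

/-- `K` triangulates the boundary of the solid obstacles with union `O`
(the individual obstacles are the connected components of `O`). -/
def Scene.IsObstacleBoundary (K : Scene) (O : Set E3) : Prop :=
  closure (interior O) = O ∧ frontier O = K.support

/-- `p` and `q` see each other in the presence of the opaque set `O`: no point strictly between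
them lies in `O`. -/
def Visible (O : Set E3) (p q : E3) : Prop := Disjoint (openSegment ℝ p q) O

/-! ### The four-dimensional space of lines -/

/-- A line given by a point on it and a nonzero direction vector. -/
abbrev PointedLine : Type := {q : E3 × E3 // q.2 ≠ 0}

/-- The set of points of a line. -/
def lineSet (q : PointedLine) : Set E3 := range fun t : ℝ => q.1.1 + t • q.1.2

/-- The space of all (unoriented) lines in three-space, two pairs (point, direction) being
identified if they give the same line. -/
def LineSpace : Type := Quotient (Setoid.ker lineSet)

/-- The usual topology on the space of lines (the quotient topology). -/
instance : TopologicalSpace LineSpace :=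
  inferInstanceAs (TopologicalSpace (Quotient (Setoid.ker lineSet)))

/-- The set of points of a line. -/
def LineSpace.points (l : LineSpace) : Set E3 := Quotient.lift lineSet (fun _ _ h => h) l

/-! ### The global visibility map -/

/-- The combinatorial structure of a line: the set of faces (vertices, open edges, open triangles)
of the scene that it intersects. -/
def Scene.facesMet (K : Scene) (l : LineSpace) : Set (Finset E3 × Finset E3) :=
  {s | s ∈ K.cells ∧ (openCell s ∩ l.points).Nonempty}

/-- The global visibility map: the partition of the space of lines into cells, the cells being
the connected components of the sets of lines with the same combinatorial structure. -/
def Scene.visibilityMap (K : Scene) : Set (Set LineSpace) :=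
  {c | ∃ l : LineSpace, c = connectedComponentIn {m | K.facesMet m = K.facesMet l} l}

end VisMap

end

/-! Upper bound. In each of three affine charts of the space of lines, a line is a point `u` of
four-space. It meets a face exactly when a positive combination of two or three plane vectors
vanishes, and this depends only on the signs of the two equations of the line at the vertices and of
their 2×2 minors (`exists_pos_iff`). All these functions have the form constant + linear + multiple
of one fixed quadratic form `qf`. So a cell meeting the chart contains a component of a sign
condition on O(n) functions of this pencil, and it suffices to bound such components by O(n^4).

The count avoids general real algebraic geometry. Components are counted by the dimension of the
space `LCOn` of locally constant functions. Removing a two-sided hypersurface from a set raises this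
dimension by at most that of the hypersurface (`rank_LCOn_diff_le`). Any intersection of level sets
has dimension at most two: through three of its points it contains a whole plane conic, in which two
of the points can be joined (`exists_joinable`). General position is reached by perturbing levels,
because a function of the pencil has at most two critical values on an intersection of level sets
(`finite_critical_values`). Induction gives `rank_LCOn_stratum_le`, and a compactness argument
transfers the count from strict inequalities at generic levels to the original sign patterns
(`card_le_of_separated`).

Encoding. Whether a line meeting a face lies in its affine span can be read off from the faces met.
Hence along a cell the intersection points with the faces move continuously and never change order
with the two endpoints; visibility is locally constant and so constant on the connected cell
(`Scene.visible_iff_of_mem_cell`).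

Lower bound. The terrain z = min(0, N - |x|) + |y| has O(N) faces. A line is the intersection of a
plane z - y = f(x) with a plane z + y = g(x). On the side y > 0 only the first decides which
half-strips are crossed, on y < 0 only the second; each can be chosen to cross the concave profile
in N^2 combinatorially different ways, independently, which gives N^4 cells (`le_ncard_saddle`). The
region below the terrain serves as the obstacle. -/

noncomputable section

/-! ### Counting components by dimensions of spaces of locally constant functions. -/

namespace VisMap

open Topology Filter

/-! ### Locally constant functions on a subset -/

/-- Real functions vanishing off `Z` that are locally constant on `Z`. -/
def LCOn {E : Type} [TopologicalSpace E] (Z : Set E) : Submodule ℝ (E → ℝ) where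
  carrier := {g | (∀ x ∉ Z, g x = 0) ∧ ∀ x ∈ Z, ∀ᶠ y in 𝓝[Z] x, g y = g x}
  add_mem' := by
    rintro f g ⟨hf, hf'⟩ ⟨hg, hg'⟩
    refine ⟨fun x hx => by simp [hf x hx, hg x hx], fun x hx => ?_⟩
    filter_upwards [hf' x hx, hg' x hx] with y h1 h2
    simp [h1, h2]
  zero_mem' := ⟨fun _ _ => rfl, fun _ _ => Eventually.of_forall fun _ => rfl⟩
  smul_mem' := by
    rintro c f ⟨hf, hf'⟩
    refine ⟨fun x hx => by simp [hf x hx], fun x hx => ?_⟩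
    filter_upwards [hf' x hx] with y h1
    simp [h1]

section LCOn

variable {E : Type} [TopologicalSpace E] {Z : Set E}

theorem LCOn.eq_of_isPreconnected {g : E → ℝ} (hg : g ∈ LCOn Z) {C : Set E}
    (hC : IsPreconnected C) (hCZ : C ⊆ Z) {x y : E} (hx : x ∈ C) (hy : y ∈ C) : g x = g y := by
  refine hC.induction₂ (fun x y => g x = g y) ?_ ?_ ?_ hx hy
  · intro x hx
    filter_upwards [nhdsWithin_mono x hCZ (hg.2 x (hCZ hx))] with y hy
    exact hy.symm
  · intro x y z _ _ _ h1 h2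
    exact h1.trans h2
  · intro x y _ _ h
    exact h.symm

/-- If among any three points of `Z` two are joined within `Z`, then the locally constant
functions on `Z` form a space of dimension at most two. -/
theorem rank_LCOn_le_two [Nonempty E]
    (h : ∀ x ∈ Z, ∀ y ∈ Z, ∀ z ∈ Z,
      (∃ C ⊆ Z, IsPreconnected C ∧ x ∈ C ∧ y ∈ C) ∨ (∃ C ⊆ Z, IsPreconnected C ∧ y ∈ C ∧ z ∈ C) ∨
      (∃ C ⊆ Z, IsPreconnected C ∧ x ∈ C ∧ z ∈ C)) :
    Module.rank ℝ (LCOn Z) ≤ 2 := by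
  -- Either all of `Z` is joined to one point, or two unjoined points exist and every third point is
  -- joined to one of them. In both cases evaluation at two points is injective.
  obtain ⟨a, b, hab⟩ : ∃ a b : E, ∀ z ∈ Z, ∀ g ∈ LCOn Z, g a = 0 → g b = 0 → g z = 0 := by
    rcases Z.eq_empty_or_nonempty with rfl | ⟨x, hx⟩
    · exact ⟨Classical.arbitrary E, Classical.arbitrary E, fun z hz => absurd hz (notMem_empty z)⟩
    · by_cases hj : ∀ y ∈ Z, ∃ C ⊆ Z, IsPreconnected C ∧ x ∈ C ∧ y ∈ C
      · refine ⟨x, x, fun z hz g hg h1 _ => ?_⟩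
        obtain ⟨C, hCZ, hC, hxC, hzC⟩ := hj z hz
        rw [← h1, LCOn.eq_of_isPreconnected hg hC hCZ hzC hxC]
      · push Not at hj
        obtain ⟨y, hy, hxy⟩ := hj
        refine ⟨x, y, fun z hz g hg h1 h2 => ?_⟩
        rcases h x hx y hy z hz with ⟨C, hCZ, hC, hxC, hyC⟩ | ⟨C, hCZ, hC, hxC, hyC⟩ |
          ⟨C, hCZ, hC, hxC, hyC⟩
        · exact absurd hyC (hxy C hCZ hC hxC)
        · rw [← h2, LCOn.eq_of_isPreconnected hg hC hCZ hyC hxC]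
        · rw [← h1, LCOn.eq_of_isPreconnected hg hC hCZ hyC hxC]
  let T : LCOn Z →ₗ[ℝ] (Fin 2 → ℝ) :=
    { toFun := fun g => ![g.1 a, g.1 b]
      map_add' := by intro f g; ext i; fin_cases i <;> simp
      map_smul' := by intro c g; ext i; fin_cases i <;> simp }
  have hT : Function.Injective T := by
    rw [← LinearMap.ker_eq_bot, LinearMap.ker_eq_bot']
    intro g hg
    have h1 : g.1 a = 0 := congrFun hg 0
    have h2 : g.1 b = 0 := congrFun hg 1
    ext z
    by_cases hz : z ∈ Z
    · exact hab z hz g.1 g.2 h1 h2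
    · exact g.2.1 z hz
  refine (LinearMap.rank_le_of_injective T hT).trans ?_
  simp

/-- The values of a locally constant function on a side `A` of `S`, as a locally constant
function on `S`. -/
theorem exists_trace {A S Z' : Set E} (hA : A ⊆ Z')
    (hloc : ∀ p ∈ S, ∃ U, IsOpen U ∧ p ∈ U ∧ IsPreconnected (U ∩ A)) (hcl : S ⊆ closure A) :
    ∃ T : LCOn Z' →ₗ[ℝ] LCOn S, ∀ g, ∀ p ∈ S, ∀ᶠ y in 𝓝[A] p, g.1 y = (T g).1 p := by
  classical
  -- Near a point of `S` the side `A` is nonempty and connected, so `g` takes a single value there;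
  -- this is the trace.
  have key : ∀ g : LCOn Z', ∀ p : E, ∃ v : ℝ, p ∈ S →
      ∃ U, IsOpen U ∧ p ∈ U ∧ ∀ y ∈ U ∩ A, g.1 y = v := by
    intro g p
    by_cases hp : p ∈ S
    · obtain ⟨U, hU, hpU, hc⟩ := hloc p hp
      obtain ⟨y, hy⟩ := mem_closure_iff.mp (hcl hp) U hU hpU
      exact ⟨g.1 y, fun _ => ⟨U, hU, hpU, fun z hz =>
        LCOn.eq_of_isPreconnected g.2 hc (inter_subset_right.trans hA) hz hy⟩⟩
    · exact ⟨0, fun h => absurd h hp⟩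
  choose v hv using key
  have uniq : ∀ g : LCOn Z', ∀ p ∈ S, ∀ w : ℝ, (∀ᶠ y in 𝓝[A] p, g.1 y = w) → v g p = w := by
    intro g p hp w hw
    obtain ⟨U, hU, hpU, hUv⟩ := hv g p hp
    have hne : (𝓝[A] p).NeBot := mem_closure_iff_nhdsWithin_neBot.mp (hcl hp)
    obtain ⟨y, ⟨hy1, hyU⟩, hyA⟩ := ((hw.and (mem_nhdsWithin_of_mem_nhds (hU.mem_nhds hpU))).and
      self_mem_nhdsWithin).exists
    exact (hUv y ⟨hyU, hyA⟩).symm.trans hy1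
  have ev : ∀ g : LCOn Z', ∀ p ∈ S, ∀ᶠ y in 𝓝[A] p, g.1 y = v g p := by
    intro g p hp
    obtain ⟨U, hU, hpU, hUv⟩ := hv g p hp
    filter_upwards [mem_nhdsWithin_of_mem_nhds (hU.mem_nhds hpU), self_mem_nhdsWithin] with y h1 h2
    exact hUv y ⟨h1, h2⟩
  let t : LCOn Z' → E → ℝ := fun g p => if p ∈ S then v g p else 0
  have ht : ∀ g, t g ∈ LCOn S := by
    intro g
    refine ⟨fun x hx => if_neg hx, fun p hp => ?_⟩
    obtain ⟨U, hU, hpU, hUv⟩ := hv g p hp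
    filter_upwards [mem_nhdsWithin_of_mem_nhds (hU.mem_nhds hpU), self_mem_nhdsWithin] with y h1 h2
    simp only [t, if_pos h2, if_pos hp]
    apply uniq g y h2
    filter_upwards [mem_nhdsWithin_of_mem_nhds (hU.mem_nhds h1), self_mem_nhdsWithin] with z h3 h4
    exact hUv z ⟨h3, h4⟩
  refine ⟨{ toFun := fun g => ⟨t g, ht g⟩, map_add' := ?_, map_smul' := ?_ }, ?_⟩
  · intro f g
    ext p
    by_cases hp : p ∈ S
    · simp only [t, if_pos hp, Submodule.coe_add, Pi.add_apply]
      apply uniq _ p hp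
      filter_upwards [ev f p hp, ev g p hp] with y h1 h2
      simp [h1, h2]
    · simp [t, hp]
  · intro c g
    ext p
    by_cases hp : p ∈ S
    · simp only [t, if_pos hp, Submodule.coe_smul, Pi.smul_apply, RingHom.id_apply]
      apply uniq _ p hp
      filter_upwards [ev g p hp] with y h1
      simp [h1]
    · simp [t, hp]
  · intro g p hp
    simpa [t, hp] using ev g p hp

/-- Removing a two-sided hypersurface: the number of components grows at most by the number of
components of the hypersurface. -/
theorem rank_LCOn_diff_le {Ap An S : Set E} (hZ : Z = Ap ∪ An ∪ S)
    (hopen : ∀ x ∈ Ap ∪ An, ∀ᶠ y in 𝓝[Z] x, y ∈ Ap ∪ An) (hdisj : Disjoint (Ap ∪ An) S)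
    (hlocp : ∀ p ∈ S, ∃ U, IsOpen U ∧ p ∈ U ∧ IsPreconnected (U ∩ Ap)) (hclp : S ⊆ closure Ap)
    (hlocn : ∀ p ∈ S, ∃ U, IsOpen U ∧ p ∈ U ∧ IsPreconnected (U ∩ An)) (hcln : S ⊆ closure An) :
    Module.rank ℝ (LCOn (Ap ∪ An)) ≤ Module.rank ℝ (LCOn Z) + Module.rank ℝ (LCOn S) := by
  classical
  obtain ⟨Tp, hTp⟩ := exists_trace (Z' := Ap ∪ An) subset_union_left hlocp hclp
  obtain ⟨Tn, hTn⟩ := exists_trace (Z' := Ap ∪ An) subset_union_right hlocn hcln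
  -- The jump across `S`. A function without jump extends over `S` by its common trace, so the
  -- kernel embeds in `LCOn Z` while the range lies in `LCOn S`.
  let J := Tp - Tn
  rw [← LinearMap.rank_range_add_rank_ker J, add_comm]
  refine add_le_add ?_ (Submodule.rank_le _)
  have hG : ∀ g : LinearMap.ker J, g.1.1 + (Tp g.1).1 ∈ LCOn Z := by
    rintro ⟨g, hg⟩
    have hJ : Tp g = Tn g := sub_eq_zero.mp (by simpa [J] using hg)
    have hgS : ∀ x ∈ S, g.1 x = 0 := fun x hx => g.2.1 x (fun h => hdisj.le_bot ⟨h, hx⟩)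
    have hTA : ∀ x ∈ Ap ∪ An, (Tp g).1 x = 0 :=
      fun x hx => (Tp g).2.1 x (fun h => hdisj.le_bot ⟨hx, h⟩)
    refine ⟨fun x hx => ?_, fun x hx => ?_⟩
    · rw [hZ] at hx
      simp only [mem_union, not_or] at hx
      simp only [Pi.add_apply]
      rw [g.2.1 x (by simp [hx]), (Tp g).2.1 x hx.2, add_zero]
    · by_cases hxA : x ∈ Ap ∪ An
      · have h1 := hopen x hxA
        have h2 := g.2.2 x hxA
        have h3 : ∀ᶠ y in 𝓝[Z] x, y ∈ Ap ∪ An → g.1 y = g.1 x := by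
          rw [eventually_nhdsWithin_iff] at h2 ⊢
          filter_upwards [h2] with y hy _ using hy
        filter_upwards [h1, h3] with y h4 h5
        simp only [Pi.add_apply]
        rw [hTA y h4, hTA x hxA, h5 h4]
      · have hxS : x ∈ S := by
          rw [hZ] at hx
          exact hx.resolve_left hxA
        have hp := hTp g x hxS
        have hn := hTn g x hxS
        rw [← hJ] at hn
        have hs := (Tp g).2.2 x hxS
        rw [eventually_nhdsWithin_iff] at hp hn hs ⊢
        filter_upwards [hp, hn, hs] with y h1 h2 h3 hy
        simp only [Pi.add_apply]
        rw [hgS x hxS, zero_add]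
        rw [hZ] at hy
        rcases hy with (hy | hy) | hy
        · rw [hTA y (Or.inl hy), add_zero, h1 hy]
        · rw [hTA y (Or.inr hy), add_zero, h2 hy]
        · rw [hgS y hy, zero_add, h3 hy]
  let G : LinearMap.ker J →ₗ[ℝ] LCOn Z :=
    { toFun := fun g => ⟨g.1.1 + (Tp g.1).1, hG g⟩
      map_add' := by intro f g; ext x; simp; ring
      map_smul' := by intro c g; ext x; simp }
  refine LinearMap.rank_le_of_injective G fun f g hfg => ?_
  ext x
  by_cases hx : x ∈ Ap ∪ An
  · have h1 : f.1.1 x + (Tp f.1).1 x = g.1.1 x + (Tp g.1).1 x :=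
      congrFun (congrArg Subtype.val hfg) x
    have h2 : x ∉ S := fun h => hdisj.le_bot ⟨hx, h⟩
    rwa [(Tp f.1).2.1 x h2, (Tp g.1).2.1 x h2, add_zero, add_zero] at h1
  · exact (f.1.2.1 x hx).trans (g.1.2.1 x hx).symm

/-- Finitely many points of `Z` that are pairwise separated by relatively clopen subsets of `Z`
are at most as many as the dimension of the space of locally constant functions. -/
theorem card_le_rank_LCOn {A : Finset E} (hA : ∀ x ∈ A, x ∈ Z)
    (hsep : ∀ x ∈ A, ∀ y ∈ A, x ≠ y → ∃ g ∈ LCOn Z, g x = 1 ∧ g y = 0) :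
    (A.card : Cardinal) ≤ Module.rank ℝ (LCOn Z) := by
  classical
  choose! g hg hg1 hg0 using hsep
  -- Products of separating functions, as in Lagrange interpolation: `e x` is one at `x` and zero at
  -- the other points of `A`, whence linear independence.
  let e : E → E → ℝ := fun x z => if z ∈ Z then ∏ y ∈ A.erase x, g x y z else 0
  have he : ∀ x ∈ A, e x ∈ LCOn Z := by
    intro x hx
    refine ⟨fun z hz => if_neg hz, fun z hz => ?_⟩
    have : ∀ᶠ w in 𝓝[Z] z, ∀ y ∈ A.erase x, g x y w = g x y z := by
      rw [eventually_all_finset]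
      intro y hy
      exact (hg x hx y (Finset.mem_of_mem_erase hy) (Finset.ne_of_mem_erase hy).symm).2 z hz
    filter_upwards [this, self_mem_nhdsWithin] with w hw hwZ
    simp only [e, if_pos hwZ, if_pos hz]
    exact Finset.prod_congr rfl hw
  have hee : ∀ x ∈ A, e x x = 1 := by
    intro x hx
    simp only [e, if_pos (hA x hx)]
    exact Finset.prod_eq_one fun y hy =>
      hg1 x hx y (Finset.mem_of_mem_erase hy) (Finset.ne_of_mem_erase hy).symm
  have he0 : ∀ x ∈ A, ∀ y ∈ A, x ≠ y → e x y = 0 := by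
    intro x hx y hy hxy
    simp only [e, if_pos (hA y hy)]
    exact Finset.prod_eq_zero (Finset.mem_erase.mpr ⟨hxy.symm, hy⟩) (hg0 x hx y hy hxy)
  have hli : LinearIndependent ℝ (fun x : A => (⟨e x, he x x.2⟩ : LCOn Z)) := by
    rw [Fintype.linearIndependent_iff]
    intro c hc x
    have h1 := congrFun (congrArg Subtype.val hc) (x : E)
    simp only [Submodule.coe_sum, Submodule.coe_smul, Finset.sum_apply, Pi.smul_apply,
      smul_eq_mul, ZeroMemClass.coe_zero, Pi.zero_apply] at h1
    rw [Finset.sum_eq_single x] at h1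
    · rwa [hee x x.2, mul_one] at h1
    · intro y _ hyx
      rw [he0 y y.2 x x.2 (fun h => hyx (Subtype.ext h)), mul_zero]
    · simp
  have := hli.cardinal_le_rank
  simpa using this

end LCOn

end VisMap

end

/-! ### Level sets of the pencil and general position. -/

noncomputable section

namespace VisMap

open Topology Filter

/-! ### A pencil of quadratic functions -/

/-- The quadratic form `u₀u₃ - u₁u₂`. -/
def qf (u : Fin 4 → ℝ) : ℝ := u 0 * u 3 - u 1 * u 2

/-- The function `κ + L u + l * qf u` for `θ = (κ, L, l)`. -/
def ev (θ : ℝ × (Fin 4 → ℝ) × ℝ) (u : Fin 4 → ℝ) : ℝ :=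
  θ.1 + (θ.2.1 0 * u 0 + θ.2.1 1 * u 1 + θ.2.1 2 * u 2 + θ.2.1 3 * u 3) + θ.2.2 * qf u

/-- The gradient of `ev θ`. -/
def grad (θ : ℝ × (Fin 4 → ℝ) × ℝ) (u : Fin 4 → ℝ) : Fin 4 → ℝ :=
  ![θ.2.1 0 + θ.2.2 * u 3, θ.2.1 1 - θ.2.2 * u 2, θ.2.1 2 - θ.2.2 * u 1, θ.2.1 3 + θ.2.2 * u 0]

/-- The second-order term is a multiple of the same form for every member of the pencil. The bounds
on critical values and on components both rest on this. -/
theorem ev_eq_taylor (θ : ℝ × (Fin 4 → ℝ) × ℝ) (x y : Fin 4 → ℝ) :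
    ev θ y = ev θ x + grad θ x ⬝ᵥ (y - x) + θ.2.2 * qf (y - x) := by
  simp [ev, grad, qf, dotProduct, Fin.sum_univ_four]
  ring

theorem hasStrictFDerivAt_ev (θ : ℝ × (Fin 4 → ℝ) × ℝ) (x : Fin 4 → ℝ) :
    HasStrictFDerivAt (ev θ) (∑ i, grad θ x i •
      ContinuousLinearMap.proj (R := ℝ) (φ := fun _ : Fin 4 => ℝ) i) x := by
  have h := fun i : Fin 4 => (ContinuousLinearMap.proj (R := ℝ) (φ := fun _ : Fin 4 => ℝ) i).hasStrictFDerivAt (x := x)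
  have := ((((((h 0).const_mul (θ.2.1 0)).add ((h 1).const_mul (θ.2.1 1))).add
    ((h 2).const_mul (θ.2.1 2))).add ((h 3).const_mul (θ.2.1 3))).const_add θ.1).add
    ((((h 0).mul (h 3)).sub ((h 1).mul (h 2))).const_mul θ.2.2)
  refine HasStrictFDerivAt.congr_fderiv this ?_
  ext v
  simp [grad, Fin.sum_univ_four]
  ring

theorem continuous_ev (θ : ℝ × (Fin 4 → ℝ) × ℝ) : Continuous (ev θ) := by
  unfold ev qf
  fun_prop

theorem ev_neg (θ : ℝ × (Fin 4 → ℝ) × ℝ) (u : Fin 4 → ℝ) : ev (-θ) u = -ev θ u := by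
  simp [ev]
  ring

/-- A map with surjective derivative at `p` is a product projection near `p`. -/
theorem exists_nhds_isPreconnected_preimage {E G : Type} [NormedAddCommGroup E] [NormedSpace ℝ E]
    [CompleteSpace E] [NormedAddCommGroup G] [NormedSpace ℝ G] [FiniteDimensional ℝ G]
    {F : E → G} {F' : E →L[ℝ] G} {p : E} (hF : HasStrictFDerivAt F F' p)
    (hsurj : F'.range = ⊤) {W : Set E} (hW : W ∈ 𝓝 p) :
    ∃ U, IsOpen U ∧ p ∈ U ∧ U ⊆ W ∧ ∀ Θ : Set G, Convex ℝ Θ →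
      IsPreconnected (U ∩ F ⁻¹' Θ) ∧ (F p ∈ closure Θ → (U ∩ F ⁻¹' Θ).Nonempty) := by
  -- The implicit function theorem straightens `F` to a projection. On a product of balls, preimages
  -- of convex sets then become convex; one `U` serves all `Θ`.
  let Φ := hF.implicitToOpenPartialHomeomorph F F' hsurj
  have hp : p ∈ Φ.source := hF.mem_implicitToOpenPartialHomeomorph_source hsurj
  have hΦp : Φ p = (F p, 0) := hF.implicitToOpenPartialHomeomorph_self hsurj
  have hfst : ∀ x, (Φ x).1 = F x := fun x => rfl
  have hN : Φ.target ∩ Φ.symm ⁻¹' W ∈ 𝓝 (Φ p) := by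
    refine inter_mem (Φ.open_target.mem_nhds (Φ.map_source hp)) ?_
    apply (Φ.continuousAt_symm (Φ.map_source hp)).preimage_mem_nhds
    rwa [Φ.left_inv hp]
  obtain ⟨ε, hε, hball⟩ := Metric.mem_nhds_iff.mp hN
  rw [hΦp, ← ball_prod_same] at hball
  refine ⟨Φ.source ∩ Φ ⁻¹' (Metric.ball (F p) ε ×ˢ Metric.ball 0 ε),
    Φ.isOpen_inter_preimage (Metric.isOpen_ball.prod Metric.isOpen_ball),
    ⟨hp, by simp [hΦp, hε]⟩, ?_, ?_⟩
  · rintro x ⟨hx, hx2⟩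
    have := (hball hx2).2
    rwa [mem_preimage, Φ.left_inv hx] at this
  · intro Θ hΘ
    have heq : (Φ.source ∩ Φ ⁻¹' (Metric.ball (F p) ε ×ˢ Metric.ball 0 ε)) ∩ F ⁻¹' Θ =
        Φ.symm '' ((Metric.ball (F p) ε ∩ Θ) ×ˢ Metric.ball 0 ε) := by
      ext x
      constructor
      · rintro ⟨⟨h1, h2⟩, h3⟩
        exact ⟨Φ x, ⟨⟨h2.1, h3⟩, h2.2⟩, Φ.left_inv h1⟩
      · rintro ⟨y, ⟨⟨h1, h2⟩, h3⟩, rfl⟩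
        have hy : y ∈ Φ.target := (hball ⟨h1, h3⟩).1
        refine ⟨⟨Φ.map_target hy, ?_⟩, ?_⟩
        · rw [mem_preimage, Φ.right_inv hy]
          exact ⟨h1, h3⟩
        · rw [mem_preimage, ← hfst, Φ.right_inv hy]
          exact h2
    rw [heq]
    constructor
    · refine IsPreconnected.image ?_ _ (Φ.continuousOn_symm.mono fun y hy =>
        (hball ⟨hy.1.1, hy.2⟩).1)
      exact (((convex_ball _ _).inter hΘ).prod (convex_ball _ _)).isPreconnected
    · intro hcl
      obtain ⟨y, hy⟩ := mem_closure_iff.mp hcl _ Metric.isOpen_ball (Metric.mem_ball_self hε)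
      exact ⟨_, (y, 0), ⟨hy, Metric.mem_ball_self hε⟩, rfl⟩

section GeneralPosition

variable {ι : Type}

/-- The level sets `ev (θ i) = c i`, `i ∈ s`, are in general position. -/
def GenPos (θ : ι → ℝ × (Fin 4 → ℝ) × ℝ) (c : ι → ℝ) (s : Finset ι) : Prop :=
  ∀ J ⊆ s, ∀ u, (∀ j ∈ J, ev (θ j) u = c j) → LinearIndepOn ℝ (fun i => grad (θ i) u) (J : Set ι)

variable {θ : ι → ℝ × (Fin 4 → ℝ) × ℝ} {c : ι → ℝ} {s : Finset ι}

/-- There are at most two critical values on an intersection of level sets. -/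
theorem finite_critical_values (θ : ι → ℝ × (Fin 4 → ℝ) × ℝ) (c : ι → ℝ) (J : Finset ι) (i : ι) :
    {v | ∃ u, (∀ j ∈ J, ev (θ j) u = c j) ∧
      grad (θ i) u ∈ Submodule.span ℝ ((fun j => grad (θ j) u) '' (J : Set ι)) ∧
      ev (θ i) u = v}.Finite := by
  set S := {v | ∃ u, (∀ j ∈ J, ev (θ j) u = c j) ∧
      grad (θ i) u ∈ Submodule.span ℝ ((fun j => grad (θ j) u) '' (J : Set ι)) ∧
      ev (θ i) u = v}
  -- Lagrange multipliers: subtracting the multiples `μ j` of the constraints removes the gradient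
  -- at `u`, so on the intersection of the level sets the function differs from its critical value
  -- by a multiple of `qf (y - u)`.
  have key : ∀ v ∈ S, ∃ (u : Fin 4 → ℝ) (M : ℝ), (∀ j ∈ J, ev (θ j) u = c j) ∧ ev (θ i) u = v ∧
      ∀ y, (∀ j ∈ J, ev (θ j) y = c j) → ev (θ i) y - v = M * qf (y - u) := by
    rintro v ⟨u, hu, hsp, rfl⟩
    rw [Submodule.mem_span_image_finset_iff_exists_fun] at hsp
    obtain ⟨μ, hμ⟩ := hsp
    refine ⟨u, (θ i).2.2 - ∑ j : J, μ j * (θ j).2.2, hu, rfl, fun y hy => ?_⟩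
    have h1 : ∀ j : J, μ j * (grad (θ j) u ⬝ᵥ (y - u)) = - (μ j * (θ j).2.2) * qf (y - u) := by
      intro j
      have := ev_eq_taylor (θ j) u y
      rw [hu j j.2, hy j j.2] at this
      linear_combination (-μ j) * this
    have h2 : grad (θ i) u ⬝ᵥ (y - u) = ∑ j : J, μ j * (grad (θ j) u ⬝ᵥ (y - u)) := by
      rw [← hμ, sum_dotProduct]
      simp only [smul_dotProduct, smul_eq_mul]
    rw [Finset.sum_congr rfl fun j _ => h1 j, ← Finset.sum_mul, Finset.sum_neg_distrib] at h2
    rw [ev_eq_taylor (θ i) u y, h2]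
    ring
  choose! u M hu hv hM using key
  -- Comparing the expansions at two critical points with different values forces opposite
  -- multiples. Three distinct values would make a multiple equal to its own negative, hence zero,
  -- and then two values would coincide.
  have neg : ∀ v ∈ S, ∀ w ∈ S, v ≠ w → M v = - M w := by
    intro v hv' w hw' hvw
    have h1 := hM v hv' (u w) (hu w hw')
    have h2 := hM w hw' (u v) (hu v hv')
    rw [hv w hw'] at h1
    rw [hv v hv'] at h2
    have h3 : qf (u v - u w) = qf (u w - u v) := by simp [qf]; ring
    rw [h3] at h2
    have h4 : (M v + M w) * qf (u w - u v) = 0 := by linear_combination - h1 - h2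
    rcases mul_eq_zero.mp h4 with h5 | h5
    · linarith
    · rw [h5, mul_zero] at h1
      exact absurd (sub_eq_zero.mp h1).symm hvw
  by_cases hsub : ∃ v ∈ S, ∃ w ∈ S, v ≠ w
  · obtain ⟨v, hv', w, hw', hvw⟩ := hsub
    refine (Set.toFinite {v, w}).subset fun z hz => ?_
    by_contra hcon
    simp only [mem_insert_iff, mem_singleton_iff, not_or] at hcon
    have h1 := neg v hv' w hw' hvw
    have h2 := neg z hz v hv' hcon.1
    have h3 := neg z hz w hw' hcon.2
    have h4 : M v = 0 := by linarith
    have h5 := hM v hv' (u w) (hu w hw')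
    rw [hv w hw', h4, zero_mul] at h5
    exact hvw (sub_eq_zero.mp h5).symm
  · push Not at hsub
    exact Set.Subsingleton.finite fun v hv w hw => hsub v hv w hw

variable [DecidableEq ι]

/-- The new level only has to avoid the finitely many critical values of the new function on the
intersections indexed by subsets of `s`. -/
theorem GenPos.exists_insert (h : GenPos θ c s) {i : ι} {l r : ℝ} (hlr : l < r) :
    ∃ v ∈ Ioo l r, GenPos θ (Function.update c i v) (insert i s) := by
  let bad : Set ℝ := ⋃ J ∈ s.powerset, {v | ∃ u, (∀ j ∈ J, ev (θ j) u = c j) ∧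
      grad (θ i) u ∈ Submodule.span ℝ ((fun j => grad (θ j) u) '' (J : Set ι)) ∧
      ev (θ i) u = v}
  have hbad : bad.Finite :=
    s.powerset.finite_toSet.biUnion fun J _ => finite_critical_values θ c J i
  obtain ⟨v, hv, hvb⟩ := (Ioo_infinite hlr).exists_notMem_finite hbad
  refine ⟨v, hv, fun J hJ u hu => ?_⟩
  have hne : ∀ j ∈ J.erase i, j ≠ i := fun j hj => Finset.ne_of_mem_erase hj
  have hJs : J.erase i ⊆ s := fun j hj =>
    (Finset.mem_insert.mp (hJ (Finset.mem_of_mem_erase hj))).resolve_left (hne j hj)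
  have hu' : ∀ j ∈ J.erase i, ev (θ j) u = c j := fun j hj => by
    simpa [hne j hj] using hu j (Finset.mem_of_mem_erase hj)
  have hind := h _ hJs u hu'
  by_cases hiJ : i ∈ J
  · rw [← Finset.insert_erase hiJ, Finset.coe_insert, linearIndepOn_insert (by simp)]
    refine ⟨hind, fun hsp => hvb ?_⟩
    simp only [bad, mem_iUnion]
    exact ⟨J.erase i, Finset.mem_powerset.mpr hJs, u, hu', hsp, by simpa using hu i hiJ⟩
  · rwa [Finset.erase_eq_of_notMem hiJ] at hind

/-- The levels on `s` stay unchanged: the perturbation below is made in two rounds, the second with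
a tolerance that depends on the levels of the first. -/
theorem GenPos.exists_union (h : GenPos θ c s) {t : Finset ι} (hst : Disjoint s t)
    {l r : ι → ℝ} (hlr : ∀ i ∈ t, l i < r i) :
    ∃ c' : ι → ℝ, (∀ i ∈ s, c' i = c i) ∧ (∀ i ∈ t, c' i ∈ Ioo (l i) (r i)) ∧
      GenPos θ c' (s ∪ t) := by
  induction t using Finset.induction_on with
  | empty => exact ⟨c, fun _ _ => rfl, by simp, by simpa using h⟩
  | insert i t hit ih =>
    rw [Finset.disjoint_insert_right] at hst
    obtain ⟨c', h1, h2, h3⟩ := ih hst.2 fun j hj => hlr j (Finset.mem_insert_of_mem hj)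
    obtain ⟨v, hv, hg⟩ := h3.exists_insert (i := i)
      (hlr i (Finset.mem_insert_self i t))
    refine ⟨Function.update c' i v, fun j hj => ?_, fun j hj => ?_, ?_⟩
    · rw [Function.update_of_ne (by rintro rfl; exact hst.1 hj), h1 j hj]
    · by_cases hji : j = i
      · subst hji
        simpa using hv
      · rw [Function.update_of_ne hji]
        exact h2 j ((Finset.mem_insert.mp hj).resolve_left hji)
    · rwa [Finset.union_insert]

/-- The intersection of the level sets in `J` minus those in `I`. -/
def stratum (θ : ι → ℝ × (Fin 4 → ℝ) × ℝ) (c : ι → ℝ) (J I : Finset ι) : Set (Fin 4 → ℝ) :=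
  {u | (∀ j ∈ J, ev (θ j) u = c j) ∧ ∀ i ∈ I, ev (θ i) u ≠ c i}

/-- A nonzero functional vanishing on the range would be a linear relation between the gradients. -/
theorem range_eq_top_of_linearIndepOn {K : Finset ι} {u : Fin 4 → ℝ}
    (h : LinearIndepOn ℝ (fun i => grad (θ i) u) (K : Set ι)) :
    (ContinuousLinearMap.pi (fun k : K => ∑ i, grad (θ k) u i •
      ContinuousLinearMap.proj (R := ℝ) (φ := fun _ : Fin 4 => ℝ) i)).range = ⊤ := by
  by_contra hne
  obtain ⟨φ, hφ, hle⟩ := Submodule.exists_le_ker_of_lt_top _ (lt_top_iff_ne_top.mpr hne)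
  apply hφ
  have h0 : ∀ x : Fin 4 → ℝ, ∑ k : K, φ (Pi.single k 1) * (grad (θ k) u ⬝ᵥ x) = 0 := by
    intro x
    have := hle (LinearMap.mem_range_self _ x)
    rw [LinearMap.mem_ker, LinearMap.pi_apply_eq_sum_univ φ] at this
    rw [← this]
    refine Finset.sum_congr rfl fun k _ => ?_
    have : (fun j => if k = j then 1 else 0) = (Pi.single k 1 : K → ℝ) := by
      ext j
      simp [Pi.single_apply, eq_comm]
    rw [this]
    simp [dotProduct, mul_comm]
  have hli := Fintype.linearIndependent_iff.mp h (fun k => φ (Pi.single k 1)) (by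
    ext i
    have := h0 (Pi.single i 1)
    simpa using this)
  ext k
  simpa using hli k

/-- The strata on the two sides of a level set in general position. -/
theorem stratum_side {m : ι} {J I : Finset ι} (hg : GenPos θ c (insert m J)) (hm : m ∉ J)
    {p : Fin 4 → ℝ} (hp : p ∈ stratum θ c (insert m J) I) {σ : ℝ} (hσ : σ ≠ 0)
    {A : Set (Fin 4 → ℝ)} (hA : A = {u | u ∈ stratum θ c J I ∧ 0 < σ * (ev (θ m) u - c m)}) :
    (∃ U, IsOpen U ∧ p ∈ U ∧ IsPreconnected (U ∩ A)) ∧ p ∈ closure A := by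
  set K := insert m J
  have hind := hg K (Finset.Subset.refl _) p hp.1
  let F : (Fin 4 → ℝ) → (K → ℝ) := fun u k => ev (θ k) u - c k
  have hF : HasStrictFDerivAt F (ContinuousLinearMap.pi (fun k : K => ∑ i, grad (θ k) p i •
      ContinuousLinearMap.proj (R := ℝ) (φ := fun _ : Fin 4 => ℝ) i)) p := by
    rw [hasStrictFDerivAt_pi]
    exact fun k => (hasStrictFDerivAt_ev (θ k) p).sub_const _
  have hFp : F p = 0 := by
    ext k
    simp [F, hp.1 k k.2]
  let W : Set (Fin 4 → ℝ) := {u | ∀ i ∈ I, ev (θ i) u ≠ c i}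
  have hWo : IsOpen W := by
    have : W = ⋂ i ∈ I, {u | ev (θ i) u ≠ c i} := by ext; simp [W]
    rw [this]
    exact isOpen_biInter_finset fun i _ => isOpen_ne_fun (continuous_ev _) continuous_const
  let mK : K := ⟨m, Finset.mem_insert_self m J⟩
  -- After straightening, a side of the level set of `m` inside the intersection over `J` is an open
  -- half-line, which is convex and has the origin in its closure.
  let Θ : Set (K → ℝ) := {v | (∀ k : K, (k : ι) ≠ m → v k = 0) ∧ 0 < σ * v mK}
  have hΘ : Convex ℝ Θ := by
    rintro v ⟨h1, h2⟩ w ⟨h3, h4⟩ a b ha hb hab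
    refine ⟨fun k hk => by simp [h1 k hk, h3 k hk], ?_⟩
    simp only [Pi.add_apply, Pi.smul_apply, smul_eq_mul]
    have : σ * (a * v mK + b * w mK) = a * (σ * v mK) + b * (σ * w mK) := by ring
    rw [this]
    rcases ha.eq_or_lt with rfl | ha
    · have : b = 1 := by linarith
      subst this
      linarith
    · have := mul_nonneg hb h4.le
      have := mul_pos ha h2
      linarith
  have hΘcl : F p ∈ closure Θ := by
    rw [hFp]
    have ht : Tendsto (fun t : ℝ => t • (Pi.single mK σ : K → ℝ)) (𝓝[>] 0) (𝓝 0) := by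
      have : Continuous (fun t : ℝ => t • (Pi.single mK σ : K → ℝ)) := by fun_prop
      have h := this.tendsto 0
      simp only [zero_smul] at h
      exact h.mono_left nhdsWithin_le_nhds
    refine mem_closure_of_tendsto ht ?_
    filter_upwards [self_mem_nhdsWithin] with t ht
    refine ⟨fun k hk => ?_, ?_⟩
    · have : k ≠ mK := fun h => hk (by rw [h])
      simp [this]
    · have : 0 < σ * σ := mul_self_pos.mpr hσ
      have ht' : 0 < t := ht
      simp only [Pi.smul_apply, Pi.single_eq_same, smul_eq_mul]
      nlinarith [mul_pos ht' this]
  have hAΘ : A = W ∩ F ⁻¹' Θ := by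
    rw [hA]
    ext u
    constructor
    · rintro ⟨⟨h1, h2⟩, h3⟩
      refine ⟨h2, fun k hk => ?_, h3⟩
      exact sub_eq_zero.mpr (h1 k ((Finset.mem_insert.mp k.2).resolve_left hk))
    · rintro ⟨h1, h2, h3⟩
      refine ⟨⟨fun j hj => ?_, h1⟩, h3⟩
      exact sub_eq_zero.mp (h2 ⟨j, Finset.mem_insert_of_mem hj⟩ (fun h => hm (h ▸ hj)))
  have hrange := range_eq_top_of_linearIndepOn hind
  constructor
  · obtain ⟨U, hU, hpU, hUW, hpre⟩ :=
      exists_nhds_isPreconnected_preimage hF hrange (hWo.mem_nhds hp.2)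
    refine ⟨U, hU, hpU, ?_⟩
    rw [hAΘ, ← inter_assoc, inter_eq_left.mpr hUW]
    exact (hpre Θ hΘ).1
  · rw [mem_closure_iff]
    intro V hV hpV
    obtain ⟨U, hU, hpU, hUW, hpre⟩ :=
      exists_nhds_isPreconnected_preimage hF hrange ((hWo.inter hV).mem_nhds ⟨hp.2, hpV⟩)
    obtain ⟨x, hxU, hxΘ⟩ := (hpre Θ hΘ).2 hΘcl
    refine ⟨x, (hUW hxU).2, ?_⟩
    rw [hAΘ]
    exact ⟨(hUW hxU).1, hxΘ⟩

end GeneralPosition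

end VisMap

end

/-! ### At most two components for intersections of level sets, and the count of strata. -/

noncomputable section

namespace VisMap

open Topology Filter

/-! ### Intersections of level sets have at most two components -/

/-- If `x`, `y`, `z` lie on a level set, the points with vanishing last bracket lie on it too. The
bracket does not involve `θ`, so this conic through the three points lies in every intersection of
level sets containing them. -/
theorem ev_barycentric (θ : ℝ × (Fin 4 → ℝ) × ℝ) (x y z : Fin 4 → ℝ) {r s t : ℝ}
    (h : r + s + t = 1) : ev θ (r • x + s • y + t • z) = r * ev θ x + s * ev θ y + t * ev θ z -
      θ.2.2 * (qf (y - z) * (s * t) + qf (x - z) * (r * t) + qf (x - y) * (r * s)) := by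
  obtain rfl : r = 1 - s - t := by linarith
  simp [ev, qf]
  ring

/-- Either the conic contains the line `yz`, or it is parametrized by projection from its point `x`;
the nonvanishing condition says that the arc from `z` to `y` over the segment has no point at
infinity. -/
theorem exists_isPreconnected_of_forall_ne_zero {Z : Set (Fin 4 → ℝ)} {x y z : Fin 4 → ℝ}
    (hZ : ∀ r s t : ℝ, r + s + t = 1 →
      qf (y - z) * (s * t) + qf (x - z) * (r * t) + qf (x - y) * (r * s) = 0 →
      r • x + s • y + t • z ∈ Z)
    (h : qf (y - z) = 0 ∨ ∀ u ∈ Icc (0 : ℝ) 1,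
      qf (x - y) * u + qf (x - z) * (1 - u) - qf (y - z) * (u * (1 - u)) ≠ 0) :
    ∃ C ⊆ Z, IsPreconnected C ∧ y ∈ C ∧ z ∈ C := by
  rcases h with h | h
  · refine ⟨segment ℝ y z, ?_, (convex_segment y z).isPreconnected, left_mem_segment ℝ y z,
      right_mem_segment ℝ y z⟩
    rintro w ⟨a, b, _, _, hab, rfl⟩
    have := hZ 0 a b (by linarith) (by rw [h]; ring)
    simpa using this
  · set A := qf (y - z)
    set B := qf (x - z)
    set C := qf (x - y)
    let w : ℝ → ℝ := fun u => C * u + B * (1 - u)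
    let D : ℝ → ℝ := fun u => C * u + B * (1 - u) - A * (u * (1 - u))
    -- The coordinates at `y` and `z` are in the ratio u : (1 - u), and the conic equation then
    -- determines the one at `x` up to normalization. The endpoint values are `z` at 0 and `y` at 1.
    let γ : ℝ → Fin 4 → ℝ := fun u =>
      (-(A * (u * (1 - u))) / D u) • x + (u * w u / D u) • y + ((1 - u) * w u / D u) • z
    have hcont : ContinuousOn γ (Icc 0 1) := by
      have hD : ContinuousOn D (Icc 0 1) := by fun_prop
      have hw : ContinuousOn w (Icc 0 1) := by fun_prop
      refine ((ContinuousOn.smul (ContinuousOn.div ?_ hD h) continuousOn_const).add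
        (ContinuousOn.smul (ContinuousOn.div ?_ hD h) continuousOn_const)).add
        (ContinuousOn.smul (ContinuousOn.div ?_ hD h) continuousOn_const)
      all_goals fun_prop
    have hB : B ≠ 0 := by simpa using h 0 (by simp)
    have hC : C ≠ 0 := by simpa using h 1 (by simp)
    refine ⟨γ '' Icc 0 1, ?_, isPreconnected_Icc.image γ hcont, ⟨1, by simp, ?_⟩, ⟨0, by simp, ?_⟩⟩
    · rintro _ ⟨u, hu, rfl⟩
      have hDu : D u ≠ 0 := h u hu
      apply hZ
      · field_simp
        simp only [D, w]
        ring
      · field_simp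
        simp only [w]
        ring
    · simp [γ, w, D, hC]
    · simp [γ, w, D, hB]

/-- The weighted mean of `C` and `B` is positive and at least `A`, while `u * (1 - u)` is between
zero and a quarter on the interval. -/
theorem ne_zero_of_le {A B C : ℝ} (hB : 0 < B) (hC : 0 < C) (hAB : A ≤ B) (hAC : A ≤ C) :
    ∀ u ∈ Icc (0 : ℝ) 1, C * u + B * (1 - u) - A * (u * (1 - u)) ≠ 0 := by
  rintro u ⟨h0, h1⟩
  apply ne_of_gt
  have h2 : 0 ≤ u * (1 - u) := mul_nonneg h0 (by linarith)
  rcases le_or_gt A 0 with hA | hA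
  · have h3 : 0 ≤ -A * (u * (1 - u)) := mul_nonneg (by linarith) h2
    have h4 : 0 < C * u + B * (1 - u) := by
      rcases h0.eq_or_lt with rfl | h0
      · simpa using hB
      · have := mul_pos hC h0
        have := mul_nonneg hB.le (sub_nonneg.mpr h1)
        linarith
    linarith
  · have h3 := mul_nonneg (sub_nonneg.mpr hAC) h0
    have h4 := mul_nonneg (sub_nonneg.mpr hAB) (sub_nonneg.mpr h1)
    have h5 : 0 < A * (1 - u * (1 - u)) := mul_pos hA (by nlinarith)
    nlinarith

theorem ne_zero_of_ge {A B C : ℝ} (hB : B < 0) (hC : C < 0) (hAB : B ≤ A) (hAC : C ≤ A) :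
    ∀ u ∈ Icc (0 : ℝ) 1, C * u + B * (1 - u) - A * (u * (1 - u)) ≠ 0 := by
  intro u hu h
  refine ne_zero_of_le (A := -A) (neg_pos.mpr hB) (neg_pos.mpr hC) (neg_le_neg hAB)
    (neg_le_neg hAC) u hu ?_
  linear_combination -h

/-- Among nonzero numbers, the role of `A` in `ne_zero_of_le` or `ne_zero_of_ge` goes to the one
whose sign differs from the other two, or to the one of least absolute value if all signs agree.
Geometrically, the pair with this value of `qf` lies on one arc of the conic. -/
theorem exists_joinable (A B C : ℝ) :
    (A = 0 ∨ ∀ u ∈ Icc (0 : ℝ) 1, C * u + B * (1 - u) - A * (u * (1 - u)) ≠ 0) ∨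
    (B = 0 ∨ ∀ u ∈ Icc (0 : ℝ) 1, C * u + A * (1 - u) - B * (u * (1 - u)) ≠ 0) ∨
    (C = 0 ∨ ∀ u ∈ Icc (0 : ℝ) 1, B * u + A * (1 - u) - C * (u * (1 - u)) ≠ 0) := by
  rcases lt_trichotomy A 0 with hA | hA | hA
  · rcases lt_trichotomy B 0 with hB | hB | hB
    · rcases le_total A C with h1 | h1
      · rcases le_total B C with h2 | h2
        · exact Or.inr (Or.inr (Or.inr (ne_zero_of_ge hA hB h1 h2)))
        · exact Or.inr (Or.inl (Or.inr (ne_zero_of_ge hA (by linarith) (by linarith) h2)))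
      · rcases le_total A B with h2 | h2
        · exact Or.inr (Or.inl (Or.inr (ne_zero_of_ge hA (by linarith) h2 (by linarith))))
        · exact Or.inl (Or.inr (ne_zero_of_ge hB (by linarith) h2 h1))
    · exact Or.inr (Or.inl (Or.inl hB))
    · rcases lt_trichotomy C 0 with hC | hC | hC
      · exact Or.inr (Or.inl (Or.inr (ne_zero_of_ge hA hC (by linarith) (by linarith))))
      · exact Or.inr (Or.inr (Or.inl hC))
      · exact Or.inl (Or.inr (ne_zero_of_le hB hC (by linarith) (by linarith)))
  · exact Or.inl (Or.inl hA)
  · rcases lt_trichotomy B 0 with hB | hB | hB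
    · rcases lt_trichotomy C 0 with hC | hC | hC
      · exact Or.inl (Or.inr (ne_zero_of_ge hB hC (by linarith) (by linarith)))
      · exact Or.inr (Or.inr (Or.inl hC))
      · exact Or.inr (Or.inl (Or.inr (ne_zero_of_le hA hC (by linarith) (by linarith))))
    · exact Or.inr (Or.inl (Or.inl hB))
    · rcases le_total C A with h1 | h1
      · rcases le_total C B with h2 | h2
        · exact Or.inr (Or.inr (Or.inr (ne_zero_of_le hA hB h1 h2)))
        · exact Or.inr (Or.inl (Or.inr (ne_zero_of_le hA (by linarith) (by linarith) h2)))
      · rcases le_total A B with h2 | h2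
        · exact Or.inl (Or.inr (ne_zero_of_le hB (by linarith) h2 h1))
        · exact Or.inr (Or.inl (Or.inr (ne_zero_of_le hA (by linarith) h2 (by linarith))))

section Strata

variable {ι : Type} {θ : ι → ℝ × (Fin 4 → ℝ) × ℝ} {c : ι → ℝ}

theorem rank_LCOn_stratum_empty_le_two (J : Finset ι) :
    Module.rank ℝ (LCOn (stratum θ c J ∅)) ≤ 2 := by
  apply rank_LCOn_le_two
  intro x hx y hy z hz
  have hsymm : ∀ a b : Fin 4 → ℝ, qf (a - b) = qf (b - a) := fun a b => by simp [qf]; ring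
  have hZ : ∀ a ∈ stratum θ c J ∅, ∀ b ∈ stratum θ c J ∅, ∀ d ∈ stratum θ c J ∅, ∀ r s t : ℝ,
      r + s + t = 1 → qf (b - d) * (s * t) + qf (a - d) * (r * t) + qf (a - b) * (r * s) = 0 →
      r • a + s • b + t • d ∈ stratum θ c J ∅ := by
    intro a ha b hb d hd r s t hrst h0
    refine ⟨fun j hj => ?_, by simp⟩
    rw [ev_barycentric _ _ _ _ hrst, h0, ha.1 j hj, hb.1 j hj, hd.1 j hj]
    linear_combination c j * hrst
  rcases exists_joinable (qf (y - z)) (qf (x - z)) (qf (x - y)) with h | h | h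
  · exact Or.inr (Or.inl (exists_isPreconnected_of_forall_ne_zero (hZ x hx y hy z hz) h))
  · refine Or.inr (Or.inr (exists_isPreconnected_of_forall_ne_zero (hZ y hy x hx z hz) ?_))
    rwa [hsymm y x]
  · refine Or.inl (exists_isPreconnected_of_forall_ne_zero (hZ z hz x hx y hy) ?_)
    rwa [hsymm z x, hsymm z y]

theorem rank_LCOn_empty {E : Type} [TopologicalSpace E] : Module.rank ℝ (LCOn (∅ : Set E)) = 0 := by
  have : Subsingleton (LCOn (∅ : Set E)) := ⟨fun f g => by
    ext x
    rw [f.2.1 x (notMem_empty x), g.2.1 x (notMem_empty x)]⟩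
  exact rank_subsingleton' ℝ _

variable [DecidableEq ι]

/-- The number of components of a stratum in general position. -/
theorem rank_LCOn_stratum_le (I : Finset ι) : ∀ J : Finset ι, Disjoint J I →
    GenPos θ c (J ∪ I) → J.card ≤ 4 →
    Module.rank ℝ (LCOn (stratum θ c J I)) ≤ ((2 * (I.card + 1) ^ (4 - J.card) : ℕ) : Cardinal) := by
  induction I using Finset.induction_on with
  | empty =>
    intro J _ _ _
    simpa using rank_LCOn_stratum_empty_le_two J
  | insert m I hmI ih =>
    intro J hdisj hg hJ
    rw [Finset.disjoint_insert_right] at hdisj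
    have hmono : ∀ {s}, s ⊆ J ∪ insert m I → GenPos θ c s :=
      fun hs K hK => hg K (hK.trans hs)
    have hZ := ih J hdisj.2 (hmono (Finset.union_subset_union_right (Finset.subset_insert m I))) hJ
    -- Adding `m` to `J` lowers the exponent by one. If `J` already has four elements the stratum is
    -- empty, since five gradients in four-space are dependent.
    have hS : Module.rank ℝ (LCOn (stratum θ c (insert m J) I)) ≤
        (((if J.card = 4 then 0 else 2 * (I.card + 1) ^ (3 - J.card)) : ℕ) : Cardinal) := by
      split_ifs with h4
      · have : stratum θ c (insert m J) I = ∅ := by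
          rw [eq_empty_iff_forall_notMem]
          intro u hu
          have hind := hg (insert m J) (by
            intro j hj
            rcases Finset.mem_insert.mp hj with rfl | hj
            · simp
            · simp [hj]) u hu.1
          have := hind.fintype_card_le_finrank
          simp [hdisj.1, h4] at this
        rw [this, rank_LCOn_empty]
        simp
      · have := ih (insert m J) (by rw [Finset.disjoint_insert_left]; exact ⟨hmI, hdisj.2⟩)
          (by rwa [Finset.insert_union, ← Finset.union_insert])
          (by rw [Finset.card_insert_of_notMem hdisj.1]; omega)
        rw [Finset.card_insert_of_notMem hdisj.1] at this
        rwa [show 3 - J.card = 4 - (J.card + 1) by omega]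
    let Ap := {u | u ∈ stratum θ c J I ∧ 0 < (1 : ℝ) * (ev (θ m) u - c m)}
    let An := {u | u ∈ stratum θ c J I ∧ 0 < (-1 : ℝ) * (ev (θ m) u - c m)}
    have hgK : GenPos θ c (insert m J) := hmono (by
      intro j hj
      rcases Finset.mem_insert.mp hj with rfl | hj
      · simp
      · simp [hj])
    have hp := fun p hp => stratum_side (I := I) hgK hdisj.1 (p := p) hp one_ne_zero (A := Ap) rfl
    have hn := fun p hp => stratum_side (I := I) hgK hdisj.1 (p := p) hp
      (neg_ne_zero.mpr one_ne_zero) (A := An) rfl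
    have hmem : ∀ u, u ∈ Ap ∪ An ↔ u ∈ stratum θ c J I ∧ ev (θ m) u ≠ c m := by
      intro u
      constructor
      · rintro (⟨h1, h2⟩ | ⟨h1, h2⟩)
        · exact ⟨h1, fun h => by rw [h] at h2; simp at h2⟩
        · exact ⟨h1, fun h => by rw [h] at h2; simp at h2⟩
      · rintro ⟨h1, h2⟩
        rcases lt_or_gt_of_ne h2 with h2 | h2
        · exact Or.inr ⟨h1, by linarith⟩
        · exact Or.inl ⟨h1, by linarith⟩
    have hcut : stratum θ c J (insert m I) = Ap ∪ An := by
      ext u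
      rw [hmem]
      simp only [stratum, mem_ofPred_eq, Finset.forall_mem_insert]
      tauto
    have hSmem : ∀ u, u ∈ stratum θ c (insert m J) I ↔ u ∈ stratum θ c J I ∧ ev (θ m) u = c m := by
      intro u
      simp only [stratum, mem_ofPred_eq, Finset.forall_mem_insert]
      tauto
    have hmain := rank_LCOn_diff_le (Z := stratum θ c J I) (Ap := Ap) (An := An)
      (S := stratum θ c (insert m J) I)
      (by
        ext u
        rw [mem_union, hmem, hSmem]
        tauto)
      (by
        intro x hx
        have h1 : ∀ᶠ y in 𝓝 x, ev (θ m) y ≠ c m :=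
          (continuous_ev (θ m)).continuousAt.eventually_ne ((hmem x).mp hx).2
        rw [eventually_nhdsWithin_iff]
        filter_upwards [h1] with y h2 h3
        exact (hmem y).mpr ⟨h3, h2⟩)
      (by
        rw [disjoint_left]
        intro u h1 h2
        exact ((hmem u).mp h1).2 ((hSmem u).mp h2).2)
      (fun p h => (hp p h).1) (fun p h => (hp p h).2)
      (fun p h => (hn p h).1) (fun p h => (hn p h).2)
    rw [hcut]
    refine hmain.trans ((add_le_add hZ hS).trans ?_)
    rw [← Nat.cast_add, Nat.cast_le, Finset.card_insert_of_notMem hmI]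
    split_ifs with h4
    · simp [h4]
    · obtain ⟨k, hk⟩ : ∃ k, 4 - J.card = k + 1 := ⟨3 - J.card, by omega⟩
      rw [show 3 - J.card = k by omega, hk]
      -- With n = `I.card` the recursion closes by (n+1)^(k+1) + (n+1)^k = (n+2)(n+1)^k ≤
      -- (n+2)^(k+1).
      have h5 : (I.card + 1) ^ k ≤ (I.card + 1 + 1) ^ k := Nat.pow_le_pow_left (by omega) k
      rw [pow_succ, pow_succ]
      nlinarith [Nat.zero_le I.card, Nat.mul_le_mul_left (I.card + 1) h5]

end Strata

end VisMap

end

/-! ### From generic levels to arbitrary positivity patterns. -/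

noncomputable section

namespace VisMap

open Topology Filter

/-! ### The number of components of sign conditions -/

/-- If `x` and `y` lie in different components of `P`, they are still separated in a slightly
relaxed compact subset of `P`. -/
theorem eventually_separated {E κ : Type} [TopologicalSpace E] [T2Space E] [Finite κ]
    {Q P : Set E} (hQ : IsCompact Q) {g : κ → E → ℝ} (hg : ∀ i, Continuous (g i))
    (hP : ∀ v ∈ Q, (∀ i, g i v ≤ 0) → v ∈ P) {x y : E} (hx : x ∈ Q) (hy : y ∈ Q)
    (hxg : ∀ i, g i x ≤ 0) (hyg : ∀ i, g i y ≤ 0) (hxy : y ∉ connectedComponentIn P x) :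
    ∀ᶠ δ in 𝓝[>] (0 : ℝ), ∃ U V, IsOpen U ∧ IsOpen V ∧ Disjoint U V ∧ x ∈ U ∧ y ∈ V ∧
      ∀ v ∈ Q, (∀ i, g i v ≤ δ) → v ∈ U ∪ V := by
  classical
  have := Fintype.ofFinite κ
  let K : Set E := Q ∩ ⋂ i, {v | g i v ≤ 0}
  have hK : IsCompact K :=
    hQ.inter_right (isClosed_iInter fun i => isClosed_le (hg i) continuous_const)
  have : CompactSpace K := isCompact_iff_compactSpace.mp hK
  let x' : K := ⟨x, hx, mem_iInter.mpr hxg⟩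
  let y' : K := ⟨y, hy, mem_iInter.mpr hyg⟩
  have hnot : y' ∉ connectedComponent x' := by
    intro h
    apply hxy
    have hpre : IsPreconnected (Subtype.val '' connectedComponent x') :=
      isPreconnected_connectedComponent.image _ continuous_subtype_val.continuousOn
    refine hpre.subset_connectedComponentIn ⟨x', mem_connectedComponent, rfl⟩ ?_ ⟨y', h, rfl⟩
    rintro _ ⟨v, _, rfl⟩
    have hv : (v : E) ∈ Q ∧ ∀ i, g i v ≤ 0 := ⟨v.2.1, fun i => mem_iInter.mp v.2.2 i⟩
    exact hP v hv.1 hv.2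
  -- In a compact Hausdorff space components are intersections of clopen sets, so `x` and `y` are
  -- separated by a clopen set, and this separation thickens to disjoint open sets of the ambient
  -- space.
  rw [connectedComponent_eq_iInter_isClopen, mem_iInter] at hnot
  push Not at hnot
  obtain ⟨⟨S, hS, hxS⟩, hyS⟩ := hnot
  have hc1 : IsCompact (Subtype.val '' S) := hS.isClosed.isCompact.image continuous_subtype_val
  have hc2 : IsCompact (Subtype.val '' Sᶜ) :=
    hS.compl.isClosed.isCompact.image continuous_subtype_val
  have hdis : Disjoint (Subtype.val '' S) (Subtype.val '' Sᶜ) :=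
    (disjoint_image_iff Subtype.val_injective).mpr disjoint_compl_right
  obtain ⟨U, V, hU, hV, hSU, hSV, hUV⟩ := SeparatedNhds.of_isCompact_isCompact hc1 hc2 hdis
  -- The total violation of the inequalities. It is bounded below by some `a > 0` on the compact
  -- rest of `Q`, so a relaxation with total below `a` cannot reach that rest.
  let m : E → ℝ := fun v => ∑ i, max (g i v) 0
  have hm : Continuous m := continuous_finsetSum _ fun i _ => (hg i).max continuous_const
  have hC : IsCompact (Q \ (U ∪ V)) := hQ.diff (hU.union hV)
  have hpos : ∀ v ∈ Q \ (U ∪ V), 0 < m v := by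
    rintro v ⟨hvQ, hv⟩
    have : ∃ i, 0 < g i v := by
      by_contra hcon
      push Not at hcon
      apply hv
      let v' : K := ⟨v, hvQ, mem_iInter.mpr hcon⟩
      by_cases h : v' ∈ S
      · exact Or.inl (hSU ⟨v', h, rfl⟩)
      · exact Or.inr (hSV ⟨v', h, rfl⟩)
    obtain ⟨i, hi⟩ := this
    exact Finset.sum_pos' (fun j _ => le_max_right _ _) ⟨i, Finset.mem_univ i, lt_max_of_lt_left hi⟩
  obtain ⟨a, ha, hma⟩ := hC.exists_forall_le' hm.continuousOn hpos
  have hlim : ∀ᶠ δ in 𝓝[>] (0 : ℝ), (Fintype.card κ : ℝ) * δ < a := by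
    have hc : Continuous fun δ : ℝ => (Fintype.card κ : ℝ) * δ := by fun_prop
    have := (hc.tendsto 0).eventually_lt_const (show (Fintype.card κ : ℝ) * 0 < a by simpa)
    exact this.filter_mono nhdsWithin_le_nhds
  filter_upwards [hlim, self_mem_nhdsWithin] with δ hδ hδ0
  refine ⟨U, V, hU, hV, hUV, hSU ⟨x', hxS, rfl⟩, hSV ⟨y', hyS, rfl⟩, fun v hvQ hv => ?_⟩
  by_contra hcon
  have h1 := hma v ⟨hvQ, hcon⟩
  have h2 : m v ≤ ∑ i : κ, δ := Finset.sum_le_sum fun i _ => max_le (hv i) (le_of_lt hδ0)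
  simp at h2
  linarith

theorem indicator_mem_LCOn {E : Type} [TopologicalSpace E] {Y W : Set E}
    (h : ∀ v ∈ Y, ∀ᶠ w in 𝓝[Y] v, (w ∈ W ↔ v ∈ W)) : (Y ∩ W).indicator 1 ∈ LCOn Y := by
  classical
  refine ⟨fun v hv => indicator_of_notMem (fun h => hv h.1) _, fun v hv => ?_⟩
  filter_upwards [h v hv, self_mem_nhdsWithin] with w hw hwY
  simp [indicator_apply, hw, hwY, hv]

/-- The set of points with the same positivity pattern as `u`. -/
def patternSet {ι : Type} (θ : ι → ℝ × (Fin 4 → ℝ) × ℝ) (u : Fin 4 → ℝ) : Set (Fin 4 → ℝ) :=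
  {v | ∀ i, 0 < ev (θ i) v ↔ 0 < ev (θ i) u}

/-- The coefficients of the coordinate functions and their negatives. -/
def boxCoef (k : Fin 4 × Bool) : ℝ × (Fin 4 → ℝ) × ℝ :=
  (0, Pi.single k.1 (if k.2 then 1 else -1), 0)

theorem ev_boxCoef (k : Fin 4 × Bool) (u : Fin 4 → ℝ) :
    ev (boxCoef k) u = if k.2 then u k.1 else - u k.1 := by
  obtain ⟨k, b⟩ := k
  fin_cases k <;> cases b <;> simp [ev, boxCoef]

/-- Finitely many points in different components of positivity patterns of `m` functions of the
pencil number `O(m ^ 4)`. -/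
theorem card_le_of_separated {ι : Type} [Fintype ι] (θ : ι → ℝ × (Fin 4 → ℝ) × ℝ)
    (A : Finset (Fin 4 → ℝ))
    (hA : ∀ x ∈ A, ∀ y ∈ A, x ≠ y → y ∉ connectedComponentIn (patternSet θ x) x) :
    A.card ≤ 2 * (2 * Fintype.card ι + 9) ^ 4 := by
  classical
  obtain ⟨R, hR⟩ : ∃ R : ℝ, ∀ x ∈ A, ∀ k, ev (boxCoef k) x < R := by
    have : ∀ᶠ R in (atTop : Filter ℝ), ∀ x ∈ A, ∀ k, ev (boxCoef k) x < R := by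
      rw [eventually_all_finset]
      intro x _
      rw [eventually_all]
      exact fun k => eventually_gt_atTop _
    exact this.exists
  -- Below every positive value attained at the given points, so that "positive" may be replaced by
  -- "at least a level in (0, ε)" there.
  obtain ⟨ε, hε0, hε⟩ : ∃ ε : ℝ, 0 < ε ∧ ∀ x ∈ A, ∀ i, 0 < ev (θ i) x → ε < ev (θ i) x := by
    have : ∀ᶠ ε in 𝓝[>] (0 : ℝ), ∀ x ∈ A, ∀ i, 0 < ev (θ i) x → ε < ev (θ i) x := by
      rw [eventually_all_finset]
      intro x _
      rw [eventually_all]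
      intro i
      by_cases h : 0 < ev (θ i) x
      · exact ((eventually_lt_nhds h).filter_mono nhdsWithin_le_nhds).mono fun _ h _ => h
      · exact Eventually.of_forall fun _ h' => absurd h' h
    obtain ⟨ε, h1, h2⟩ := (this.and self_mem_nhdsWithin).exists
    exact ⟨ε, h2, h1⟩
  -- Eight functions bound a box. Each given function appears twice: the first copy carries the
  -- threshold for the positive conditions, the second the smaller relaxation of the nonpositive
  -- ones.
  let θ' : (Fin 4 × Bool) ⊕ ι ⊕ ι → ℝ × (Fin 4 → ℝ) × ℝ := Sum.elim boxCoef (Sum.elim θ θ)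
  let t₁ : Finset ((Fin 4 × Bool) ⊕ ι ⊕ ι) := Finset.univ.disjSum (Finset.univ.disjSum ∅)
  let t₂ : Finset ((Fin 4 × Bool) ⊕ ι ⊕ ι) :=
    (∅ : Finset (Fin 4 × Bool)).disjSum ((∅ : Finset ι).disjSum Finset.univ)
  have ht : t₁ ∪ t₂ = Finset.univ := by
    ext i
    rcases i with k | i | i <;> simp [t₁, t₂]
  have ht' : Disjoint t₁ t₂ := by
    rw [Finset.disjoint_left]
    intro i
    rcases i with k | i | i <;> simp [t₁, t₂]
  have hg0 : GenPos θ' 0 ∅ := by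
    intro J hJ u _
    rw [Finset.subset_empty.mp hJ]
    simp
  obtain ⟨c₁, -, hc₁, hg₁⟩ := hg0.exists_union (t := t₁) (Finset.disjoint_empty_left _)
    (l := Sum.elim (fun _ => R) (Sum.elim (fun _ => 0) fun _ => 0))
    (r := Sum.elim (fun _ => R + 1) (Sum.elim (fun _ => ε) fun _ => ε)) (by
      intro i _
      rcases i with k | i | i <;> simp [hε0])
  rw [Finset.empty_union] at hg₁
  have hbox₁ : ∀ k, R < c₁ (Sum.inl k) := fun k => (hc₁ (Sum.inl k) (by simp [t₁])).1
  have heps₁ : ∀ i, 0 < c₁ (Sum.inr (Sum.inl i)) ∧ c₁ (Sum.inr (Sum.inl i)) < ε :=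
    fun i => hc₁ (Sum.inr (Sum.inl i)) (by simp [t₁])
  let Q : (Fin 4 → ℝ) → Set (Fin 4 → ℝ) := fun x =>
    {v | (∀ k, ev (boxCoef k) v ≤ c₁ (Sum.inl k)) ∧
      ∀ i, 0 < ev (θ i) x → c₁ (Sum.inr (Sum.inl i)) ≤ ev (θ i) v}
  have hQ : ∀ x, IsCompact (Q x) := by
    intro x
    have hcl : IsClosed (Q x) := by
      have : Q x = (⋂ k, {v | ev (boxCoef k) v ≤ c₁ (Sum.inl k)}) ∩
          ⋂ i, ⋂ (_ : 0 < ev (θ i) x), {v | c₁ (Sum.inr (Sum.inl i)) ≤ ev (θ i) v} := by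
        ext v
        simp [Q]
      rw [this]
      exact (isClosed_iInter fun k => isClosed_le (continuous_ev _) continuous_const).inter
        (isClosed_iInter fun i => isClosed_iInter fun _ =>
          isClosed_le continuous_const (continuous_ev _))
    refine (isCompact_Icc (a := fun k : Fin 4 => - c₁ (Sum.inl (k, false)))
      (b := fun k : Fin 4 => c₁ (Sum.inl (k, true)))).of_isClosed_subset hcl ?_
    rintro v ⟨hv, _⟩
    constructor
    · intro k
      have := hv (k, false)
      rw [ev_boxCoef] at this
      simp only [Bool.false_eq_true, if_false] at this
      linarith
    · intro k
      have := hv (k, true)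
      rw [ev_boxCoef] at this
      simpa using this
  have hAQ : ∀ x ∈ A, ∀ y ∈ A, y ∈ patternSet θ x → y ∈ Q x := by
    intro x _ y hy hyx
    exact ⟨fun k => ((hR y hy k).trans (hbox₁ k)).le, fun i hi =>
      ((heps₁ i).2.trans (hε y hy i ((hyx i).mpr hi))).le⟩
  -- The compact sets `Q x` depend on the first levels, so the tolerance for the nonpositive
  -- conditions is available only after those are fixed.
  obtain ⟨δ, hδ0, hδε, hδ⟩ : ∃ δ : ℝ, 0 < δ ∧ δ < ε ∧ ∀ x ∈ A, ∀ y ∈ A, x ≠ y →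
      y ∈ patternSet θ x →
      ∃ U V, IsOpen U ∧ IsOpen V ∧ Disjoint U V ∧ x ∈ U ∧ y ∈ V ∧
      ∀ v ∈ Q x, (∀ i : {i // ¬ 0 < ev (θ i) x}, ev (θ i) v ≤ δ) → v ∈ U ∪ V := by
    have : ∀ᶠ δ in 𝓝[>] (0 : ℝ), ∀ x ∈ A, ∀ y ∈ A, x ≠ y → y ∈ patternSet θ x →
        ∃ U V, IsOpen U ∧ IsOpen V ∧ Disjoint U V ∧ x ∈ U ∧ y ∈ V ∧
        ∀ v ∈ Q x, (∀ i : {i // ¬ 0 < ev (θ i) x}, ev (θ i) v ≤ δ) → v ∈ U ∪ V := by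
      rw [eventually_all_finset]
      intro x hx
      rw [eventually_all_finset]
      intro y hy
      rw [eventually_imp_distrib_left]
      intro hxy
      rw [eventually_imp_distrib_left]
      intro hpat
      refine eventually_separated (P := patternSet θ x) (hQ x)
        (g := fun (i : {i // ¬ 0 < ev (θ i) x}) => ev (θ i)) (fun i => continuous_ev _) ?_
        (hAQ x hx x hx fun _ => Iff.rfl) (hAQ x hx y hy hpat) (fun i => not_lt.mp i.2)
        (fun i => not_lt.mp fun h => i.2 ((hpat i).mp h)) (hA x hx y hy hxy)
      rintro v ⟨_, hv⟩ hv' i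
      by_cases hi : 0 < ev (θ i) x
      · exact ⟨fun _ => hi, fun _ => (heps₁ i).1.trans_le (hv i hi)⟩
      · exact ⟨fun h => absurd h (not_lt.mpr (hv' ⟨i, hi⟩)), fun h => absurd h hi⟩
    obtain ⟨δ, ⟨h1, h2⟩, h3⟩ := ((this.and self_mem_nhdsWithin).and
      ((eventually_lt_nhds hε0).filter_mono nhdsWithin_le_nhds)).exists
    exact ⟨δ, h2, h3, h1⟩
  obtain ⟨c, hcc₁, hc₂, hg⟩ := hg₁.exists_union ht' (l := fun _ => 0) (r := fun _ => δ)
    (fun _ _ => hδ0)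
  rw [ht] at hg
  have hbox : ∀ k, c (Sum.inl k) = c₁ (Sum.inl k) := fun k => hcc₁ _ (by simp [t₁])
  have heps : ∀ i, c (Sum.inr (Sum.inl i)) = c₁ (Sum.inr (Sum.inl i)) :=
    fun i => hcc₁ _ (by simp [t₁])
  have hdel : ∀ i, 0 < c (Sum.inr (Sum.inr i)) ∧ c (Sum.inr (Sum.inr i)) < δ :=
    fun i => hc₂ (Sum.inr (Sum.inr i)) (by simp [t₂])
  set Y := stratum θ' c ∅ Finset.univ
  have hYr := rank_LCOn_stratum_le (θ := θ') (c := c) Finset.univ ∅ (Finset.disjoint_empty_left _)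
    (by rwa [Finset.empty_union]) (by simp)
  have hAY : ∀ x ∈ A, x ∈ Y := by
    intro x hx
    refine ⟨by simp, fun i _ => ?_⟩
    rcases i with k | i | i
    · rw [hbox]
      exact ((hR x hx k).trans (hbox₁ k)).ne
    · rw [heps]
      change ev (θ i) x ≠ _
      by_cases h : 0 < ev (θ i) x
      · exact ((heps₁ i).2.trans (hε x hx i h)).ne'
      · exact ((not_lt.mp h).trans_lt (heps₁ i).1).ne
    · change ev (θ i) x ≠ _
      by_cases h : 0 < ev (θ i) x
      · exact (((hdel i).2.trans hδε).trans (hε x hx i h)).ne'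
      · exact ((not_lt.mp h).trans_lt (hdel i).1).ne
  have hYloc : ∀ v ∈ Y, ∀ᶠ w in 𝓝 v, ∀ i, (ev (θ' i) w < c i ↔ ev (θ' i) v < c i) := by
    intro v hv
    rw [eventually_all]
    intro i
    rcases lt_or_gt_of_ne (hv.2 i (Finset.mem_univ i)) with h | h
    · filter_upwards [(continuous_ev (θ' i)).continuousAt.eventually_lt_const h] with w hw
      exact iff_of_true hw h
    · filter_upwards [(continuous_ev (θ' i)).continuousAt.eventually_const_lt h] with w hw
      exact iff_of_false hw.le.not_gt h.le.not_gt
  -- The perturbed version of the pattern of `x`. On `Y` no function attains its level, so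
  -- membership in `D x` is locally constant.
  let D : (Fin 4 → ℝ) → Set (Fin 4 → ℝ) := fun x => {v | (∀ k, ev (boxCoef k) v < c (Sum.inl k)) ∧
      (∀ i, 0 < ev (θ i) x → ¬ ev (θ i) v < c (Sum.inr (Sum.inl i))) ∧
      ∀ i, ¬ 0 < ev (θ i) x → ev (θ i) v < c (Sum.inr (Sum.inr i))}
  have hDloc : ∀ x, ∀ v ∈ Y, ∀ᶠ w in 𝓝 v, (w ∈ D x ↔ v ∈ D x) := by
    intro x v hv
    filter_upwards [hYloc v hv] with w hw
    have h1 := fun k => hw (Sum.inl k)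
    have h2 := fun i => hw (Sum.inr (Sum.inl i))
    have h3 := fun i => hw (Sum.inr (Sum.inr i))
    simp only [θ', Sum.elim_inl, Sum.elim_inr] at h1 h2 h3
    simp only [D, mem_ofPred_eq, h1, h2, h3]
  have hDQ : ∀ x, ∀ v ∈ D x, v ∈ Q x ∧ ∀ i : {i // ¬ 0 < ev (θ i) x}, ev (θ i) v ≤ δ := by
    rintro x v ⟨h1, h2, h3⟩
    refine ⟨⟨fun k => hbox k ▸ (h1 k).le, fun i hi => heps i ▸ not_lt.mp (h2 i hi)⟩, fun i => ?_⟩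
    exact ((h3 i i.2).trans (hdel i).2).le
  have hxD : ∀ x ∈ A, x ∈ D x := by
    intro x hx
    refine ⟨fun k => ?_, fun i hi => ?_, fun i hi => ?_⟩
    · rw [hbox]
      exact (hR x hx k).trans (hbox₁ k)
    · rw [heps]
      exact ((heps₁ i).2.trans (hε x hx i hi)).le.not_gt
    · exact (not_lt.mp hi).trans_lt (hdel i).1
  have hyD : ∀ x ∈ A, ∀ y ∈ A, y ∈ D x → y ∈ patternSet θ x := by
    rintro x hx y hy ⟨_, h2, h3⟩ i
    constructor
    · intro h
      by_contra hi
      exact (h3 i hi).not_gt (((hdel i).2.trans hδε).trans (hε y hy i h))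
    · intro h
      by_contra hi
      apply h2 i h
      rw [heps]
      exact (not_lt.mp hi).trans_lt (heps₁ i).1
  -- If `y` lies outside `D x`, that set itself separates. Otherwise both points have the same
  -- pattern and the open sets from the compactness argument split `D x`.
  have hcard := card_le_rank_LCOn hAY (by
    intro x hx y hy hxy
    obtain ⟨U, V, hU, hV, hUV, hxU, hyV, hcov⟩ : ∃ U V, IsOpen U ∧ IsOpen V ∧ Disjoint U V ∧
        x ∈ U ∧ (y ∈ D x → y ∈ V) ∧ ∀ v ∈ D x, v ∈ U ∪ V := by
      by_cases hyDx : y ∈ D x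
      · obtain ⟨U, V, hU, hV, hUV, hxU, hyV, hcov⟩ := hδ x hx y hy hxy (hyD x hx y hy hyDx)
        exact ⟨U, V, hU, hV, hUV, hxU, fun _ => hyV, fun v hv =>
          hcov v (hDQ x v hv).1 (hDQ x v hv).2⟩
      · exact ⟨univ, ∅, isOpen_univ, isOpen_empty, disjoint_empty _, mem_univ x,
          fun h => absurd h hyDx, fun _ _ => Or.inl (mem_univ _)⟩
    refine ⟨(Y ∩ (D x ∩ U)).indicator 1, indicator_mem_LCOn fun v hv => ?_, ?_, ?_⟩
    · refine Eventually.filter_mono nhdsWithin_le_nhds ?_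
      by_cases hvU : v ∈ U
      · filter_upwards [hDloc x v hv, hU.mem_nhds hvU] with w h1 h2
        simp [h1, h2, hvU]
      · by_cases hvD : v ∈ D x
        · have hvV := (hcov v hvD).resolve_left hvU
          filter_upwards [hV.mem_nhds hvV] with w h2
          have : w ∉ U := fun h => hUV.le_bot ⟨h, h2⟩
          simp [this, hvU]
        · filter_upwards [hDloc x v hv] with w h1
          simp [h1, hvD]
    · exact indicator_of_mem (s := Y ∩ (D x ∩ U)) ⟨hAY x hx, hxD x hx, hxU⟩ _
    · exact indicator_of_notMem (fun h => hUV.le_bot ⟨h.2.2, hyV h.2.1⟩) _)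
  have hfin := hcard.trans hYr
  rw [Nat.cast_le] at hfin
  refine hfin.trans (le_of_eq ?_)
  simp
  ring

end VisMap

end

/-! ### Faces met by a line as sign conditions, and the upper bound. -/

noncomputable section

namespace VisMap

open Topology Filter

/-! ### Faces in homogeneous coordinates -/

/-- The homogeneous coordinate vectors of the vertices and directions of a simplex. -/
def hom (s : Finset E3 × Finset E3) : s.1 ⊕ s.2 → E3 × ℝ :=
  Sum.elim (fun v : s.1 => ((v : E3), (1 : ℝ))) (fun d : s.2 => ((d : E3), (0 : ℝ)))

/-- Homogeneous coordinates treat vertices and directions alike: the normalization of the vertex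
weights becomes the last coordinate. -/
theorem mem_openCell_iff {s : Finset E3 × Finset E3} {x : E3} :
    x ∈ openCell s ↔ ∃ κ : s.1 ⊕ s.2 → ℝ, (∀ i, 0 < κ i) ∧ ∑ i, κ i • hom s i = (x, 1) := by
  classical
  constructor
  · rintro ⟨a, b, ha, hsum, hb, rfl⟩
    refine ⟨Sum.elim (fun v => a v) (fun d => b d), ?_, ?_⟩
    · rintro (i | i)
      · exact ha i i.2
      · exact hb i i.2
    · rw [Fintype.sum_sum_type]
      ext1
      · simp only [Sum.elim_inl, Sum.elim_inr, hom, Prod.fst_add, Prod.fst_sum, Prod.smul_fst]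
        rw [Finset.sum_coe_sort s.1 (fun v => a v • v), Finset.sum_coe_sort s.2 (fun v => b v • v)]
      · simp only [Sum.elim_inl, Sum.elim_inr, hom, Prod.snd_add, Prod.snd_sum, Prod.smul_snd,
          smul_eq_mul, mul_one, mul_zero, Finset.sum_const_zero, add_zero]
        rw [Finset.sum_coe_sort s.1 (fun v => a v), hsum]
  · rintro ⟨κ, hκ, hsum⟩
    rw [Fintype.sum_sum_type] at hsum
    have h1 := congrArg Prod.fst hsum
    have h2 := congrArg Prod.snd hsum
    simp only [hom, Sum.elim_inl, Sum.elim_inr, Prod.fst_add, Prod.fst_sum, Prod.smul_fst,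
      Prod.snd_add, Prod.snd_sum, Prod.smul_snd, smul_eq_mul, mul_one, mul_zero,
      Finset.sum_const_zero, add_zero] at h1 h2
    refine ⟨fun v => if h : v ∈ s.1 then κ (Sum.inl ⟨v, h⟩) else 0,
      fun v => if h : v ∈ s.2 then κ (Sum.inr ⟨v, h⟩) else 0, ?_, ?_, ?_, ?_⟩
    · intro v hv
      simp [hv, hκ]
    · rw [← h2, ← Finset.sum_coe_sort s.1]
      simp
    · intro v hv
      simp [hv, hκ]
    · rw [← h1, ← Finset.sum_coe_sort s.1, ← Finset.sum_coe_sort s.2]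
      simp

/-! ### Positive dependence of plane vectors -/

/-- Not all nonzero entries have the same sign. -/
def Balanced (x : Fin 3 → ℝ) : Prop := (∀ a, x a = 0) ∨ ((∃ a, 0 < x a) ∧ ∃ a, x a < 0)

theorem Balanced.exists_pos {x : Fin 3 → ℝ} (h : Balanced x) :
    ∃ κ : Fin 3 → ℝ, (∀ a, 0 < κ a) ∧ ∑ a, κ a * x a = 0 := by
  rcases h with h | ⟨⟨a, ha⟩, ⟨b, hb⟩⟩
  · exact ⟨fun _ => 1, fun _ => one_pos, by simp [h]⟩
  · rcases le_total 0 (∑ c, x c) with hS | hS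
    -- Start from weights one and increase the weight of a negative entry just enough to cancel the
    -- nonnegative sum; the other case is symmetric.
    · refine ⟨fun c => 1 + (Pi.single b ((∑ c, x c) / (- x b)) : Fin 3 → ℝ) c, fun c => ?_, ?_⟩
      · have : 0 ≤ (∑ c, x c) / (- x b) := div_nonneg hS (by linarith)
        by_cases hc : c = b
        · subst hc
          simp only [Pi.single_eq_same]
          linarith
        · simp [Pi.single_eq_of_ne hc]
      · simp only [add_mul, one_mul, Finset.sum_add_distrib, Pi.single_apply, ite_mul, zero_mul,
          Finset.sum_ite_eq', Finset.mem_univ, if_true]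
        have := hb.ne
        field_simp
        ring
    · refine ⟨fun c => 1 + (Pi.single a ((-∑ c, x c) / x a) : Fin 3 → ℝ) c, fun c => ?_, ?_⟩
      · have : 0 ≤ (-∑ c, x c) / x a := div_nonneg (by linarith) ha.le
        by_cases hc : c = a
        · subst hc
          simp only [Pi.single_eq_same]
          linarith
        · simp [Pi.single_eq_of_ne hc]
      · simp only [add_mul, one_mul, Finset.sum_add_distrib, Pi.single_apply, ite_mul, zero_mul,
          Finset.sum_ite_eq', Finset.mem_univ, if_true]
        field_simp
        ring

theorem balanced_of_pos {x κ : Fin 3 → ℝ} (hκ : ∀ a, 0 < κ a) (h : ∑ a, κ a * x a = 0) :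
    Balanced x := by
  by_cases hp : ∃ a, 0 < x a
  · by_cases hn : ∃ a, x a < 0
    · exact Or.inr ⟨hp, hn⟩
    · push Not at hn
      obtain ⟨a, ha⟩ := hp
      have := (Finset.sum_eq_zero_iff_of_nonneg fun b _ => mul_nonneg (hκ b).le (hn b)).mp h a
        (Finset.mem_univ a)
      exact absurd this (mul_pos (hκ a) ha).ne'
  · push Not at hp
    left
    intro a
    have := (Finset.sum_eq_zero_iff_of_nonpos
      fun b _ => mul_nonpos_of_nonneg_of_nonpos (hκ b).le (hp b)).mp h a (Finset.mem_univ a)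
    exact (mul_eq_zero.mp this).resolve_left (hκ a).ne'

/-- The minor complementary to `a` of the matrix with rows `x`, `y`. -/
def minor (x y : Fin 3 → ℝ) (a : Fin 3) : ℝ := x (a + 1) * y (a + 2) - x (a + 2) * y (a + 1)

/-- If some minor is nonzero, the vector of minors spans the kernel of the 2×3 matrix, so a positive
solution exists iff the minors share a strict sign. If all minors vanish the rows are proportional,
and a positive solution for a nonzero row solves both. -/
theorem exists_pos_iff (x y : Fin 3 → ℝ) :
    (∃ κ : Fin 3 → ℝ, (∀ a, 0 < κ a) ∧ ∑ a, κ a * x a = 0 ∧ ∑ a, κ a * y a = 0) ↔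
      (∀ a, 0 < minor x y a) ∨ (∀ a, minor x y a < 0) ∨
        ((∀ a, minor x y a = 0) ∧ Balanced x ∧ Balanced y) := by
  constructor
  · rintro ⟨κ, hκ, hx, hy⟩
    have hbx := balanced_of_pos hκ hx
    have hby := balanced_of_pos hκ hy
    simp only [Fin.sum_univ_three] at hx hy
    have h01 : minor x y 1 = κ 1 / κ 0 * minor x y 0 := by
      have := (hκ 0).ne'
      field_simp
      simp [minor]
      linear_combination x 2 * hy - y 2 * hx
    have h02 : minor x y 2 = κ 2 / κ 0 * minor x y 0 := by
      have := (hκ 0).ne'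
      field_simp
      simp [minor]
      linear_combination y 1 * hx - x 1 * hy
    have p1 : 0 < κ 1 / κ 0 := div_pos (hκ 1) (hκ 0)
    have p2 : 0 < κ 2 / κ 0 := div_pos (hκ 2) (hκ 0)
    rcases lt_trichotomy (minor x y 0) 0 with h | h | h
    · refine Or.inr (Or.inl fun a => ?_)
      fin_cases a
      · exact h
      · change minor x y 1 < 0
        rw [h01]
        exact mul_neg_of_pos_of_neg p1 h
      · change minor x y 2 < 0
        rw [h02]
        exact mul_neg_of_pos_of_neg p2 h
    · refine Or.inr (Or.inr ⟨fun a => ?_, hbx, hby⟩)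
      fin_cases a
      · exact h
      · change minor x y 1 = 0
        rw [h01, h, mul_zero]
      · change minor x y 2 = 0
        rw [h02, h, mul_zero]
    · refine Or.inl fun a => ?_
      fin_cases a
      · exact h
      · change 0 < minor x y 1
        rw [h01]
        exact mul_pos p1 h
      · change 0 < minor x y 2
        rw [h02]
        exact mul_pos p2 h
  · rintro (h | h | ⟨h, hbx, hby⟩)
    · refine ⟨minor x y, h, ?_, ?_⟩ <;> simp [Fin.sum_univ_three, minor] <;> ring
    · refine ⟨fun a => - minor x y a, fun a => neg_pos.mpr (h a), ?_, ?_⟩ <;>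
        simp [Fin.sum_univ_three, minor] <;> ring
    · have hd : ∀ a b, x b * y a = x a * y b := by
        have h0 := h 0
        have h1 := h 1
        have h2 := h 2
        simp [minor] at h0 h1 h2
        intro a b
        fin_cases a <;> fin_cases b <;> simp <;> linarith
      by_cases hx : ∀ a, x a = 0
      · obtain ⟨κ, hκ, hs⟩ := hby.exists_pos
        exact ⟨κ, hκ, by simp [hx], hs⟩
      · push Not at hx
        obtain ⟨b, hb⟩ := hx
        obtain ⟨κ, hκ, hs⟩ := hbx.exists_pos
        refine ⟨κ, hκ, hs, ?_⟩
        have : x b * ∑ a, κ a * y a = y b * ∑ a, κ a * x a := by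
          rw [Finset.mul_sum, Finset.mul_sum]
          refine Finset.sum_congr rfl fun a _ => ?_
          linear_combination κ a * hd a b
        rw [hs, mul_zero] at this
        exact (mul_eq_zero.mp this).resolve_left hb

/-- Positive linear relations are insensitive to repeating vectors. -/
theorem exists_pos_comp_iff {ι : Type} [Fintype ι] {g : Fin 3 → ι} (hg : Function.Surjective g)
    {M : Type} [AddCommGroup M] [Module ℝ M] (F : ι → M) :
    (∃ κ : ι → ℝ, (∀ i, 0 < κ i) ∧ ∑ i, κ i • F i = 0) ↔
      ∃ κ : Fin 3 → ℝ, (∀ a, 0 < κ a) ∧ ∑ a, κ a • F (g a) = 0 := by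
  classical
  have hfib : ∀ κ : Fin 3 → ℝ, ∑ a, κ a • F (g a) = ∑ i, (∑ a with g a = i, κ a) • F i := by
    intro κ
    rw [← Finset.sum_fiberwise_of_maps_to (s := Finset.univ) (t := Finset.univ) (g := g)
      (fun _ _ => Finset.mem_univ _)]
    refine Finset.sum_congr rfl fun i _ => ?_
    rw [Finset.sum_smul]
    refine Finset.sum_congr rfl fun a ha => ?_
    rw [(Finset.mem_filter.mp ha).2]
  have hne : ∀ i, (Finset.univ.filter fun a => g a = i).Nonempty := fun i => by
    obtain ⟨a, ha⟩ := hg i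
    exact ⟨a, by simp [ha]⟩
  constructor
  · rintro ⟨κ, hκ, hs⟩
    -- Each weight is divided evenly among the repetitions of its vector.
    refine ⟨fun a => κ (g a) / (Finset.univ.filter fun b => g b = g a).card, fun a => ?_, ?_⟩
    · exact div_pos (hκ _) (Nat.cast_pos.mpr (hne _).card_pos)
    · rw [hfib, ← hs]
      refine Finset.sum_congr rfl fun i _ => ?_
      congr 1
      have : ∀ a ∈ Finset.univ.filter (fun a => g a = i),
          κ (g a) / ((Finset.univ.filter fun b => g b = g a).card : ℝ) =
          κ i / ((Finset.univ.filter fun b => g b = i).card : ℝ) := by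
        intro a ha
        rw [(Finset.mem_filter.mp ha).2]
      rw [Finset.sum_congr rfl this, Finset.sum_const, nsmul_eq_mul]
      have : ((Finset.univ.filter fun b => g b = i).card : ℝ) ≠ 0 :=
        Nat.cast_ne_zero.mpr (hne i).card_pos.ne'
      field_simp
  · rintro ⟨κ, hκ, hs⟩
    refine ⟨fun i => ∑ a with g a = i, κ a, fun i => ?_, ?_⟩
    · exact Finset.sum_pos (fun a _ => hκ a) (hne i)
    · rw [← hfib, hs]

/-! ### Charts of the space of lines -/

/-- The line with direction having `i`-th coordinate one, through a point with `i`-th coordinate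
zero. -/
def chart (i : Fin 3) (u : Fin 4 → ℝ) : PointedLine :=
  ⟨(WithLp.toLp 2 fun l => if l = i then 0 else if l = i + 1 then u 1 else u 3,
    WithLp.toLp 2 fun l => if l = i then 1 else if l = i + 1 then u 0 else u 2), by
    intro h
    have := congrFun (congrArg (WithLp.ofLp) h) i
    simp at this⟩

theorem continuous_chart (i : Fin 3) : Continuous (chart i) := by
  refine Continuous.subtype_mk (Continuous.prodMk ?_ ?_) _
  · refine (PiLp.continuous_toLp 2 _).comp (continuous_pi fun l => ?_)
    split_ifs <;> fun_prop
  · refine (PiLp.continuous_toLp 2 _).comp (continuous_pi fun l => ?_)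
    split_ifs <;> fun_prop

/-- The line in the chart, as a point of the space of lines. -/
def chartLine (i : Fin 3) (u : Fin 4 → ℝ) : LineSpace := Quotient.mk _ (chart i u)

theorem continuous_chartLine (i : Fin 3) : Continuous (chartLine i) :=
  continuous_quotient_mk'.comp (continuous_chart i)

/-- The first of the two equations of the lines in the chart, in homogeneous coordinates. -/
def eqX (i : Fin 3) (u : Fin 4 → ℝ) (p : E3 × ℝ) : ℝ :=
  p.1 (i + 1) - u 0 * p.1 i - u 1 * p.2

/-- The second of the two equations of the lines in the chart, in homogeneous coordinates. -/
def eqY (i : Fin 3) (u : Fin 4 → ℝ) (p : E3 × ℝ) : ℝ :=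
  p.1 (i + 2) - u 2 * p.1 i - u 3 * p.2

theorem Fin3.ne (i : Fin 3) : i + 1 ≠ i ∧ i + 2 ≠ i ∧ i + 2 ≠ i + 1 := by
  fin_cases i <;> decide

theorem Fin3.ext {f g : Fin 3 → ℝ} (i : Fin 3) (h0 : f i = g i) (h1 : f (i + 1) = g (i + 1))
    (h2 : f (i + 2) = g (i + 2)) : f = g := by
  ext l
  have : l = i ∨ l = i + 1 ∨ l = i + 2 := by fin_cases i <;> fin_cases l <;> decide
  rcases this with rfl | rfl | rfl <;> assumption

theorem mem_lineSet_chart_iff {i : Fin 3} {u : Fin 4 → ℝ} {x : E3} :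
    x ∈ lineSet (chart i u) ↔ eqX i u (x, 1) = 0 ∧ eqY i u (x, 1) = 0 := by
  obtain ⟨n1, n2, n3⟩ := Fin3.ne i
  constructor
  · rintro ⟨t, rfl⟩
    constructor
    · simp [eqX, chart, n1]
      ring
    · simp [eqY, chart, n2, n3]
      ring
  · rintro ⟨h1, h2⟩
    refine ⟨x i, ?_⟩
    simp only [eqX, eqY] at h1 h2
    ext l
    refine congrFun (Fin3.ext (f := fun l => ((chart i u).1.1 + x i • (chart i u).1.2) l)
      (g := fun l => x l) i ?_ ?_ ?_) l
    · simp [chart]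
    · simp [chart, n1]
      linarith
    · simp [chart, n2, n3]
      linarith

/-- The chart is chosen by a nonzero coordinate of the direction, which is scaled to one. -/
theorem exists_chartLine_eq (l : LineSpace) : ∃ i u, chartLine i u = l := by
  obtain ⟨⟨⟨p, d⟩, hd⟩, rfl⟩ := Quotient.exists_rep l
  obtain ⟨i, hi⟩ : ∃ i, d i ≠ 0 := by
    by_contra hcon
    push Not at hcon
    exact hd (by ext i; simpa using hcon i)
  obtain ⟨n1, n2, n3⟩ := Fin3.ne i
  refine ⟨i, ![d (i + 1) / d i, p (i + 1) - p i / d i * d (i + 1), d (i + 2) / d i,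
    p (i + 2) - p i / d i * d (i + 2)], Quotient.sound ?_⟩
  change lineSet _ = lineSet _
  ext x
  rw [mem_lineSet_chart_iff]
  simp only [eqX, eqY]
  constructor
  · rintro ⟨h1, h2⟩
    simp at h1 h2
    refine ⟨(x i - p i) / d i, ?_⟩
    ext l
    refine congrFun (Fin3.ext (f := fun l => (p + ((x i - p i) / d i) • d) l)
      (g := fun l => x l) i ?_ ?_ ?_) l
    · simp
      field_simp
      ring
    · simp
      field_simp
      field_simp at h1
      linarith
    · simp
      field_simp
      field_simp at h2
      linarith
  · rintro ⟨t, rfl⟩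
    constructor
    · simp
      field_simp
      ring
    · simp
      field_simp
      ring

theorem eqX_sum {ι : Type} [Fintype ι] (i : Fin 3) (u : Fin 4 → ℝ) (κ : ι → ℝ) (F : ι → E3 × ℝ) :
    eqX i u (∑ a, κ a • F a) = ∑ a, κ a * eqX i u (F a) := by
  simp only [eqX, Prod.fst_sum, Prod.snd_sum, Prod.smul_fst, Prod.smul_snd, WithLp.ofLp_sum,
    Finset.sum_apply, PiLp.smul_apply, smul_eq_mul, Finset.mul_sum, ← Finset.sum_sub_distrib]
  exact Finset.sum_congr rfl fun a _ => by ring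

theorem eqY_sum {ι : Type} [Fintype ι] (i : Fin 3) (u : Fin 4 → ℝ) (κ : ι → ℝ) (F : ι → E3 × ℝ) :
    eqY i u (∑ a, κ a • F a) = ∑ a, κ a * eqY i u (F a) := by
  simp only [eqY, Prod.fst_sum, Prod.snd_sum, Prod.smul_fst, Prod.smul_snd, WithLp.ofLp_sum,
    Finset.sum_apply, PiLp.smul_apply, smul_eq_mul, Finset.mul_sum, ← Finset.sum_sub_distrib]
  exact Finset.sum_congr rfl fun a _ => by ring

/-- The two equations are linear in homogeneous coordinates, so a point of the face on the line is a
positive relation between the equation values at the vertices and directions. -/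
theorem openCell_inter_lineSet_nonempty_iff {s : Finset E3 × Finset E3} (hs : s.1.Nonempty)
    (i : Fin 3) (u : Fin 4 → ℝ) :
    (openCell s ∩ lineSet (chart i u)).Nonempty ↔
      ∃ κ : s.1 ⊕ s.2 → ℝ, (∀ a, 0 < κ a) ∧
        ∑ a, κ a • (eqX i u (hom s a), eqY i u (hom s a)) = 0 := by
  constructor
  · rintro ⟨x, hx, hxl⟩
    obtain ⟨κ, hκ, hsum⟩ := mem_openCell_iff.mp hx
    rw [mem_lineSet_chart_iff, ← hsum, eqX_sum, eqY_sum] at hxl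
    refine ⟨κ, hκ, ?_⟩
    ext1
    · simpa [Prod.fst_sum] using hxl.1
    · simpa [Prod.snd_sum] using hxl.2
  · rintro ⟨κ, hκ, hsum⟩
    have h1 := congrArg Prod.fst hsum
    have h2 := congrArg Prod.snd hsum
    simp only [Prod.fst_sum, Prod.snd_sum, Prod.smul_fst, Prod.smul_snd, smul_eq_mul,
      Prod.fst_zero, Prod.snd_zero] at h1 h2
    -- A simplex has at least one vertex, so the last coordinate is positive and can be scaled to
    -- one.
    have hW : 0 < (∑ a, κ a • hom s a).2 := by
      rw [Fintype.sum_sum_type]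
      simp only [hom, Sum.elim_inl, Sum.elim_inr, Prod.snd_add, Prod.snd_sum, Prod.smul_snd,
        smul_eq_mul, mul_one, mul_zero, Finset.sum_const_zero, add_zero]
      have : Nonempty s.1 := hs.to_subtype
      exact Finset.sum_pos (fun a _ => hκ _) Finset.univ_nonempty
    set w := (∑ a, κ a • hom s a).2
    have heq : ∑ a, (w⁻¹ * κ a) • hom s a = (w⁻¹ • (∑ a, κ a • hom s a).1, 1) := by
      simp only [mul_smul]
      rw [← Finset.smul_sum]
      ext1
      · simp
      · exact inv_mul_cancel₀ hW.ne'
    refine ⟨w⁻¹ • (∑ a, κ a • hom s a).1, mem_openCell_iff.mpr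
      ⟨fun a => w⁻¹ * κ a, fun a => mul_pos (inv_pos.mpr hW) (hκ a), heq⟩, ?_⟩
    rw [mem_lineSet_chart_iff, ← heq, eqX_sum, eqY_sum]
    simp only [mul_assoc]
    rw [← Finset.mul_sum, ← Finset.mul_sum, h1, h2]
    simp

/-! ### The faces met by a line are given by signs of functions of the pencil -/

/-- The coefficients of `eqX` as a function of the line. -/
def coefX (i : Fin 3) (p : E3 × ℝ) : ℝ × (Fin 4 → ℝ) × ℝ :=
  (p.1 (i + 1), ![-p.1 i, -p.2, 0, 0], 0)

/-- The coefficients of `eqY` as a function of the line. -/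
def coefY (i : Fin 3) (p : E3 × ℝ) : ℝ × (Fin 4 → ℝ) × ℝ :=
  (p.1 (i + 2), ![0, 0, -p.1 i, -p.2], 0)

/-- The coefficients of the minor of `eqX`, `eqY` as a function of the line. -/
def coefM (i : Fin 3) (p q : E3 × ℝ) : ℝ × (Fin 4 → ℝ) × ℝ :=
  (p.1 (i + 1) * q.1 (i + 2) - q.1 (i + 1) * p.1 (i + 2),
    ![q.1 i * p.1 (i + 2) - p.1 i * q.1 (i + 2), q.2 * p.1 (i + 2) - p.2 * q.1 (i + 2),
      q.1 (i + 1) * p.1 i - p.1 (i + 1) * q.1 i, q.1 (i + 1) * p.2 - p.1 (i + 1) * q.2],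
    p.1 i * q.2 - q.1 i * p.2)

theorem ev_coefX (i : Fin 3) (p : E3 × ℝ) (u : Fin 4 → ℝ) : ev (coefX i p) u = eqX i u p := by
  simp [ev, coefX, eqX]
  ring

theorem ev_coefY (i : Fin 3) (p : E3 × ℝ) (u : Fin 4 → ℝ) : ev (coefY i p) u = eqY i u p := by
  simp [ev, coefY, eqY]
  ring

/-- The minor of two points is quadratic in the line, but its quadratic part is always a multiple of
u₀u₃ - u₁u₂; this places all the functions in one pencil. -/
theorem ev_coefM (i : Fin 3) (p q : E3 × ℝ) (u : Fin 4 → ℝ) :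
    ev (coefM i p q) u = eqX i u p * eqY i u q - eqX i u q * eqY i u p := by
  simp [ev, coefM, eqX, eqY, qf]
  ring

/-- Vertices and edges are padded by repetition, so that every face is handled by the criterion for
three vectors. -/
theorem exists_surjective_fin_three {s : Finset E3 × Finset E3} (hs : s.1.Nonempty)
    (h3 : s.1.card + s.2.card ≤ 3) : ∃ g : Fin 3 → s.1 ⊕ s.2, Function.Surjective g := by
  have : Nonempty (s.1 ⊕ s.2) := ⟨Sum.inl ⟨hs.choose, hs.choose_spec⟩⟩
  obtain ⟨e⟩ := Function.Embedding.nonempty_of_card_le (α := s.1 ⊕ s.2) (β := Fin 3)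
    (by simpa using h3)
  exact ⟨Function.invFun e, Function.invFun_surjective e.injective⟩

/-- The functions of the pencil whose signs determine the faces met by a line. -/
def Scene.coef (K : Scene) (i : Fin 3) (g : ∀ s : K.cells, Fin 3 → s.1.1 ⊕ s.1.2) :
    K.cells × Fin 3 × Fin 3 × Bool → ℝ × (Fin 4 → ℝ) × ℝ := fun k =>
  (if k.2.2.2 then (1 : ℝ) else -1) • (![coefX i (hom k.1.1 (g k.1 k.2.1)),
    coefY i (hom k.1.1 (g k.1 k.2.1)),
    coefM i (hom k.1.1 (g k.1 (k.2.1 + 1))) (hom k.1.1 (g k.1 (k.2.1 + 2)))] k.2.2.1)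

theorem facesMet_eq_of_mem_patternSet (K : Scene) (i : Fin 3)
    {g : ∀ s : K.cells, Fin 3 → s.1.1 ⊕ s.1.2} (hg : ∀ s, Function.Surjective (g s))
    {u v : Fin 4 → ℝ} (huv : v ∈ patternSet (K.coef i g) u) :
    K.facesMet (chartLine i v) = K.facesMet (chartLine i u) := by
  ext s
  refine and_congr_right fun hs => ?_
  change (openCell s ∩ lineSet (chart i v)).Nonempty ↔ (openCell s ∩ lineSet (chart i u)).Nonempty
  have hne := K.vertex_nonempty s hs
  rw [openCell_inter_lineSet_nonempty_iff hne, openCell_inter_lineSet_nonempty_iff hne,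
    exists_pos_comp_iff (hg ⟨s, hs⟩), exists_pos_comp_iff (hg ⟨s, hs⟩)]
  set G := g ⟨s, hs⟩
  have hkey : ∀ w : Fin 4 → ℝ, (∃ κ : Fin 3 → ℝ, (∀ a, 0 < κ a) ∧
      ∑ a, κ a • (eqX i w (hom s (G a)), eqY i w (hom s (G a))) = 0) ↔
      ∃ κ : Fin 3 → ℝ, (∀ a, 0 < κ a) ∧ ∑ a, κ a * eqX i w (hom s (G a)) = 0 ∧
        ∑ a, κ a * eqY i w (hom s (G a)) = 0 := by
    intro w
    refine exists_congr fun κ => and_congr_right fun _ => ?_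
    rw [Prod.ext_iff]
    simp [Prod.fst_sum, Prod.snd_sum]
  rw [hkey, hkey, exists_pos_iff, exists_pos_iff]
  have hneg : ∀ (θ : ℝ × (Fin 4 → ℝ) × ℝ) w, ev ((-1 : ℝ) • θ) w = - ev θ w := by
    intro θ w
    rw [neg_one_smul, ev_neg]
  have hX : ∀ a, (0 < eqX i v (hom s (G a)) ↔ 0 < eqX i u (hom s (G a))) ∧
      (eqX i v (hom s (G a)) < 0 ↔ eqX i u (hom s (G a)) < 0) := by
    intro a
    have h1 := huv (⟨s, hs⟩, a, 0, true)
    have h2 := huv (⟨s, hs⟩, a, 0, false)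
    simp [Scene.coef, ev_neg, ev_coefX] at h1 h2
    exact ⟨h1, h2⟩
  have hY : ∀ a, (0 < eqY i v (hom s (G a)) ↔ 0 < eqY i u (hom s (G a))) ∧
      (eqY i v (hom s (G a)) < 0 ↔ eqY i u (hom s (G a)) < 0) := by
    intro a
    have h1 := huv (⟨s, hs⟩, a, 1, true)
    have h2 := huv (⟨s, hs⟩, a, 1, false)
    simp [Scene.coef, ev_neg, ev_coefY] at h1 h2
    exact ⟨h1, h2⟩
  let m : (Fin 4 → ℝ) → Fin 3 → ℝ := fun w =>
    minor (fun a => eqX i w (hom s (G a))) (fun a => eqY i w (hom s (G a)))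
  have hM : ∀ a, (0 < m v a ↔ 0 < m u a) ∧ (m v a < 0 ↔ m u a < 0) := by
    intro a
    have h1 := huv (⟨s, hs⟩, a, 2, true)
    have h2 := huv (⟨s, hs⟩, a, 2, false)
    simp only [Scene.coef, hneg, if_true, one_smul, Bool.false_eq_true, if_false] at h1 h2
    simp only [Matrix.cons_val, ev_coefM, neg_pos] at h1 h2
    exact ⟨h1, h2⟩
  have hzero : ∀ {p q : ℝ}, (0 < p ↔ 0 < q) ∧ (p < 0 ↔ q < 0) → (p = 0 ↔ q = 0) := by
    rintro p q ⟨h1, h2⟩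
    constructor
    · rintro rfl
      exact le_antisymm (not_lt.mp fun h => lt_irrefl _ (h1.mpr h))
        (not_lt.mp fun h => lt_irrefl _ (h2.mpr h))
    · rintro rfl
      exact le_antisymm (not_lt.mp fun h => lt_irrefl _ (h1.mp h))
        (not_lt.mp fun h => lt_irrefl _ (h2.mp h))
  change ((∀ a, 0 < m v a) ∨ (∀ a, m v a < 0) ∨ ((∀ a, m v a = 0) ∧ _)) ↔
    ((∀ a, 0 < m u a) ∨ (∀ a, m u a < 0) ∨ ((∀ a, m u a = 0) ∧ _))
  simp only [Balanced, (hM _).1, (hM _).2, hzero (hM _), (hX _).1, (hX _).2, hzero (hX _),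
    (hY _).1, (hY _).2, hzero (hY _)]

/-! ### The upper bound -/

theorem Scene.eq_connectedComponentIn_of_mem {K : Scene} {c : Set LineSpace}
    (hc : c ∈ K.visibilityMap) {l : LineSpace} (hl : l ∈ c) :
    c = connectedComponentIn {m | K.facesMet m = K.facesMet l} l := by
  obtain ⟨l₀, rfl⟩ := hc
  have h : l ∈ {m | K.facesMet m = K.facesMet l₀} := connectedComponentIn_subset _ _ hl
  have h : K.facesMet l = K.facesMet l₀ := h
  rw [h]
  exact connectedComponentIn_eq hl

/-- Representatives of distinct cells lie in distinct components of the patterns, because the chart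
maps such a component to a connected set of lines meeting the same faces. Each face gives 18
functions (three indices, three kinds, two signs), and each function counts twice in the bound,
whence 36. -/
theorem Scene.card_le_of_chart (K : Scene) (i : Fin 3) (T : Finset (Set LineSpace))
    (hT : ∀ c ∈ T, c ∈ K.visibilityMap ∧ ∃ u, chartLine i u ∈ c) :
    T.card ≤ 2 * (36 * K.complexity + 9) ^ 4 := by
  classical
  have hsur : ∀ s : K.cells, ∃ g : Fin 3 → s.1.1 ⊕ s.1.2, Function.Surjective g :=
    fun s => exists_surjective_fin_three (K.vertex_nonempty s s.2) (K.card_le_three s s.2)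
  choose g hg using hsur
  have hT' : ∀ c ∈ T, ∃ u, chartLine i u ∈ c := fun c hc => (hT c hc).2
  choose! r hr using hT'
  have hinj : Set.InjOn r T := by
    intro c hc c' hc' h
    rw [Scene.eq_connectedComponentIn_of_mem (hT c hc).1 (hr c hc),
      Scene.eq_connectedComponentIn_of_mem (hT c' hc').1 (hr c' hc'), h]
  have := card_le_of_separated (K.coef i g) (T.image r) (by
    intro x hx y hy hxy hcon
    obtain ⟨c, hc, rfl⟩ := Finset.mem_image.mp hx
    obtain ⟨c', hc', rfl⟩ := Finset.mem_image.mp hy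
    apply hxy
    congr 1
    have h1 := Scene.eq_connectedComponentIn_of_mem (hT c hc).1 (hr c hc)
    have hself : r c ∈ patternSet (K.coef i g) (r c) := fun _ => Iff.rfl
    have hsub : chartLine i '' connectedComponentIn (patternSet (K.coef i g) (r c)) (r c) ⊆ c := by
      refine Subset.trans ?_ h1.superset
      refine (isPreconnected_connectedComponentIn.image _
        (continuous_chartLine i).continuousOn).subset_connectedComponentIn
        ⟨r c, mem_connectedComponentIn hself, rfl⟩ ?_
      rintro _ ⟨v, hv, rfl⟩
      exact facesMet_eq_of_mem_patternSet K i hg (connectedComponentIn_subset _ _ hv)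
    rw [Scene.eq_connectedComponentIn_of_mem (hT c hc).1 (hsub ⟨r c', hcon, rfl⟩),
      ← Scene.eq_connectedComponentIn_of_mem (hT c' hc').1 (hr c' hc')])
  rw [Finset.card_image_of_injOn hinj] at this
  refine this.trans (le_of_eq ?_)
  simp [Scene.complexity]
  ring

theorem Scene.finite_and_ncard_le (K : Scene) :
    K.visibilityMap.Finite ∧ K.visibilityMap.ncard ≤ 6 * (36 * K.complexity + 9) ^ 4 := by
  classical
  have hbound : ∀ T : Finset (Set LineSpace), (T : Set (Set LineSpace)) ⊆ K.visibilityMap →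
      T.card ≤ 6 * (36 * K.complexity + 9) ^ 4 := by
    intro T hT
    have hcov : T ⊆ Finset.univ.biUnion fun i : Fin 3 =>
        T.filter fun c => ∃ u, chartLine i u ∈ c := by
      intro c hc
      obtain ⟨l, hl⟩ := hT hc
      obtain ⟨i, u, hiu⟩ := exists_chartLine_eq l
      rw [Finset.mem_biUnion]
      refine ⟨i, Finset.mem_univ i, Finset.mem_filter.mpr ⟨hc, u, ?_⟩⟩
      rw [hl, hiu]
      exact mem_connectedComponentIn rfl
    refine (Finset.card_le_card hcov).trans (Finset.card_biUnion_le.trans ?_)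
    have : ∀ i ∈ (Finset.univ : Finset (Fin 3)), (T.filter fun c => ∃ u, chartLine i u ∈ c).card ≤
        2 * (36 * K.complexity + 9) ^ 4 := by
      intro i _
      refine K.card_le_of_chart i _ fun c hc => ?_
      rw [Finset.mem_filter] at hc
      exact ⟨hT hc.1, hc.2⟩
    refine (Finset.sum_le_sum this).trans (le_of_eq ?_)
    simp
    ring
  -- The bound holds for every finite set of cells, which excludes infinitely many.
  have hfin : K.visibilityMap.Finite := by
    by_contra hinf
    obtain ⟨T, hT, hcard⟩ := Set.Infinite.exists_subset_card_eq hinf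
      (6 * (36 * K.complexity + 9) ^ 4 + 1)
    have := hbound T hT
    omega
  refine ⟨hfin, ?_⟩
  rw [Set.ncard_eq_toFinset_card _ hfin]
  exact hbound _ (by simp)

end VisMap

end

/-! ### Encoding: visibility is constant on cells. -/

noncomputable section

namespace VisMap

open Topology Filter

/-! ### Local behaviour of faces along a line -/

theorem convex_openCell (s : Finset E3 × Finset E3) : Convex ℝ (openCell s) := by
  rw [convex_iff_forall_pos]
  intro x hx y hy a b ha hb hab
  rw [mem_openCell_iff] at hx hy ⊢
  obtain ⟨κ, hκ, hx⟩ := hx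
  obtain ⟨μ, hμ, hy⟩ := hy
  refine ⟨fun i => a * κ i + b * μ i,
    fun i => add_pos (mul_pos ha (hκ i)) (mul_pos hb (hμ i)), ?_⟩
  simp only [add_smul, mul_smul, Finset.sum_add_distrib]
  rw [← Finset.smul_sum, ← Finset.smul_sum, hx, hy]
  ext1 <;> simp [hab]

/-- The span of the homogeneous coordinate vectors of a simplex. -/
def homSpan (s : Finset E3 × Finset E3) : Submodule ℝ (E3 × ℝ) := Submodule.span ℝ (range (hom s))

theorem mem_homSpan_iff {s : Finset E3 × Finset E3} {z : E3 × ℝ} :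
    z ∈ homSpan s ↔ ∃ κ : s.1 ⊕ s.2 → ℝ, ∑ i, κ i • hom s i = z :=
  Submodule.mem_span_range_iff_exists_fun ℝ

theorem mem_homSpan_of_mem_openCell {s : Finset E3 × Finset E3} {x : E3} (hx : x ∈ openCell s) :
    (x, (1 : ℝ)) ∈ homSpan s := by
  obtain ⟨κ, -, h⟩ := mem_openCell_iff.mp hx
  exact mem_homSpan_iff.mpr ⟨κ, h⟩

theorem homSpan_mono {s t : Finset E3 × Finset E3} (h1 : t.1 ⊆ s.1) (h2 : t.2 ⊆ s.2) :
    homSpan t ≤ homSpan s := by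
  apply Submodule.span_mono
  rintro _ ⟨i | i, rfl⟩
  · exact ⟨Sum.inl ⟨i, h1 i.2⟩, rfl⟩
  · exact ⟨Sum.inr ⟨i, h2 i.2⟩, rfl⟩

theorem exists_coordinates {s : Finset E3 × Finset E3} (hs : Nondegenerate s) :
    ∃ ψ : E3 × ℝ →ₗ[ℝ] (s.1 ⊕ s.2 → ℝ), ∀ κ, ψ (∑ i, κ i • hom s i) = κ := by
  have hinj : Function.Injective (Fintype.linearCombination ℝ (hom s)) :=
    LinearIndependent.fintypeLinearCombination_injective hs
  obtain ⟨ψ, hψ⟩ := LinearMap.exists_leftInverse_of_injective _ (LinearMap.ker_eq_bot.mpr hinj)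
  refine ⟨ψ, fun κ => ?_⟩
  have := LinearMap.congr_fun hψ κ
  simpa [Fintype.linearCombination_apply] using this

/-- A face is relatively open. -/
theorem eventually_mem_openCell {s : Finset E3 × Finset E3} (hs : Nondegenerate s) {p : E3}
    (hp : p ∈ openCell s) : ∀ᶠ z in 𝓝 p, (z, (1 : ℝ)) ∈ homSpan s → z ∈ openCell s := by
  obtain ⟨ψ, hψ⟩ := exists_coordinates hs
  obtain ⟨κ, hκ, hsum⟩ := mem_openCell_iff.mp hp
  have hc : Continuous fun z : E3 => ψ (z, 1) :=
    (LinearMap.continuous_of_finiteDimensional ψ).comp (by fun_prop)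
  have hpos : ∀ᶠ z in 𝓝 p, ∀ i, 0 < ψ (z, 1) i := by
    rw [eventually_all]
    intro i
    have : Continuous fun z : E3 => ψ (z, 1) i := (continuous_apply i).comp hc
    refine this.continuousAt.eventually_const_lt ?_
    change 0 < ψ (p, 1) i
    rw [← hsum, hψ]
    exact hκ i
  filter_upwards [hpos] with z hz hzs
  obtain ⟨μ, hμ⟩ := mem_homSpan_iff.mp hzs
  rw [← hμ, hψ] at hz
  exact mem_openCell_iff.mpr ⟨μ, hz, hμ⟩

/-- A point with nonnegative coordinates lies on a face of the simplex. -/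
theorem exists_face_of_nonneg {s : Finset E3 × Finset E3} {x : E3} {κ : s.1 ⊕ s.2 → ℝ}
    (hκ : ∀ i, 0 ≤ κ i) (h : ∑ i, κ i • hom s i = (x, 1)) {j : s.1 ⊕ s.2} (hj : κ j = 0) :
    ∃ V D : Finset E3, V ⊆ s.1 ∧ D ⊆ s.2 ∧ V.Nonempty ∧ (V, D) ≠ s ∧ x ∈ openCell (V, D) := by
  classical
  rw [Fintype.sum_sum_type] at h
  have h1 := congrArg Prod.fst h
  have h2 := congrArg Prod.snd h
  simp only [hom, Sum.elim_inl, Sum.elim_inr, Prod.fst_add, Prod.fst_sum, Prod.smul_fst,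
    Prod.snd_add, Prod.snd_sum, Prod.smul_snd, smul_eq_mul, mul_one, mul_zero,
    Finset.sum_const_zero, add_zero] at h1 h2
  let a : E3 → ℝ := fun v => if h : v ∈ s.1 then κ (Sum.inl ⟨v, h⟩) else 0
  let b : E3 → ℝ := fun v => if h : v ∈ s.2 then κ (Sum.inr ⟨v, h⟩) else 0
  have ha0 : ∀ v, 0 ≤ a v := fun v => by
    simp only [a]
    split_ifs
    exacts [hκ _, le_rfl]
  have hb0 : ∀ v, 0 ≤ b v := fun v => by
    simp only [b]
    split_ifs
    exacts [hκ _, le_rfl]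
  have hsum : ∑ v ∈ s.1 with 0 < a v, a v = 1 := by
    rw [Finset.sum_filter_of_ne fun v _ hv => (ha0 v).lt_of_ne' hv, ← Finset.sum_coe_sort s.1, ← h2]
    simp [a]
  refine ⟨s.1.filter fun v => 0 < a v, s.2.filter fun v => 0 < b v, Finset.filter_subset _ _,
    Finset.filter_subset _ _, ?_, ?_, a, b, ?_, hsum, ?_, ?_⟩
  · rw [Finset.nonempty_iff_ne_empty]
    intro h0
    rw [h0] at hsum
    simp at hsum
  · intro heq
    rcases j with j | j
    · have hmem : (j : E3) ∈ s.1.filter fun v => 0 < a v := by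
        exact Finset.subset_of_eq (congrArg Prod.fst heq).symm j.2
      have := (Finset.mem_filter.mp hmem).2
      simp [a, hj] at this
    · have hmem : (j : E3) ∈ s.2.filter fun v => 0 < b v := by
        exact Finset.subset_of_eq (congrArg Prod.snd heq).symm j.2
      have := (Finset.mem_filter.mp hmem).2
      simp [b, hj] at this
  · exact fun v hv => (Finset.mem_filter.mp hv).2
  · exact fun v hv => (Finset.mem_filter.mp hv).2
  · rw [Finset.sum_filter_of_ne fun v _ hv => (ha0 v).lt_of_ne' fun h0 => hv (by simp [h0]),
      Finset.sum_filter_of_ne fun v _ hv => (hb0 v).lt_of_ne' fun h0 => hv (by simp [h0]), ← h1,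
      ← Finset.sum_coe_sort s.1, ← Finset.sum_coe_sort s.2]
    simp [a, b]

/-- The point with parameter `t` on a line. -/
def pt (q : PointedLine) (t : ℝ) : E3 := q.1.1 + t • q.1.2

theorem continuous_pt_left (t : ℝ) : Continuous fun q : PointedLine => pt q t := by
  unfold pt
  fun_prop

theorem continuous_pt (q : PointedLine) : Continuous (pt q) := by
  unfold pt
  fun_prop

/-- The line is parallel to the affine span of the simplex. -/
def IsParallelTo (q : PointedLine) (s : Finset E3 × Finset E3) : Prop :=
  (q.1.2, (0 : ℝ)) ∈ homSpan s

theorem pt_sub_pt (q : PointedLine) (a b : ℝ) :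
    ((pt q a, (1 : ℝ)) - (pt q b, 1) : E3 × ℝ) = (a - b) • (q.1.2, 0) := by
  ext1
  · simp only [pt, Prod.fst_sub, Prod.smul_fst]
    module
  · simp

theorem isParallelTo_of_mem {q : PointedLine} {s : Finset E3 × Finset E3} {a b : ℝ} (hab : a ≠ b)
    (ha : (pt q a, (1 : ℝ)) ∈ homSpan s) (hb : (pt q b, (1 : ℝ)) ∈ homSpan s) :
    IsParallelTo q s := by
  have := (homSpan s).sub_mem ha hb
  rw [pt_sub_pt] at this
  exact ((homSpan s).smul_mem_iff (sub_ne_zero.mpr hab)).mp this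

theorem IsParallelTo.mem {q : PointedLine} {s : Finset E3 × Finset E3} (h : IsParallelTo q s)
    {a : ℝ} (b : ℝ) (ha : (pt q a, (1 : ℝ)) ∈ homSpan s) : (pt q b, (1 : ℝ)) ∈ homSpan s := by
  have := (homSpan s).add_mem ha ((homSpan s).smul_mem (b - a) h)
  rwa [← pt_sub_pt, add_sub_cancel] at this

theorem IsParallelTo.eventually {q : PointedLine} {s : Finset E3 × Finset E3}
    (hs : Nondegenerate s) (h : IsParallelTo q s) {a : ℝ} (ha : pt q a ∈ openCell s) :
    ∀ᶠ b in 𝓝 a, pt q b ∈ openCell s := by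
  filter_upwards [(continuous_pt q).continuousAt.eventually (eventually_mem_openCell hs ha)]
    with b hb
  exact hb (h.mem b (mem_homSpan_of_mem_openCell ha))

/-- A line meeting a face is parallel to it if and only if it meets a proper face of it. -/
theorem Scene.isParallelTo_iff (K : Scene) {s : Finset E3 × Finset E3} (hs : s ∈ K.cells)
    {q : PointedLine} {a : ℝ} (ha : pt q a ∈ openCell s) :
    IsParallelTo q s ↔ ∃ t ∈ K.cells, t.1 ⊆ s.1 ∧ t.2 ⊆ s.2 ∧ t ≠ s ∧
      (openCell t ∩ lineSet q).Nonempty := by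
  constructor
  · intro h
    obtain ⟨κ, hκ, hκs⟩ := mem_openCell_iff.mp ha
    obtain ⟨δ, hδ⟩ := mem_homSpan_iff.mp h
    have hδ0 : ∃ i, δ i ≠ 0 := by
      by_contra hcon
      push Not at hcon
      simp only [hcon, zero_smul, Finset.sum_const_zero] at hδ
      exact q.2 (congrArg Prod.fst hδ).symm
    -- An orientation of the line along which some coordinate decreases. The point is then moved
    -- until the first coordinate vanishes, which happens on a proper face.
    obtain ⟨ε, i₀, hi₀⟩ : ∃ (ε : ℝ) (i : s.1 ⊕ s.2), ε * δ i < 0 := by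
      obtain ⟨i, hi⟩ := hδ0
      rcases lt_or_gt_of_ne hi with h | h
      · exact ⟨1, i, by linarith⟩
      · exact ⟨-1, i, by linarith⟩
    obtain ⟨j, hj, hmin⟩ := Finset.exists_min_image (Finset.univ.filter fun i => ε * δ i < 0)
      (fun i => κ i / -(ε * δ i)) ⟨i₀, by simp [hi₀]⟩
    have hj' : ε * δ j < 0 := (Finset.mem_filter.mp hj).2
    set τ := κ j / -(ε * δ j)
    have hτ : 0 ≤ τ := div_nonneg (hκ j).le (by linarith)
    have hnn : ∀ i, 0 ≤ κ i + τ * (ε * δ i) := by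
      intro i
      by_cases hi : ε * δ i < 0
      · have := hmin i (Finset.mem_filter.mpr ⟨Finset.mem_univ i, hi⟩)
        have h2 := (le_div_iff₀ (by linarith)).mp this
        linarith
      · exact add_nonneg (hκ i).le (mul_nonneg hτ (not_lt.mp hi))
    have hzero : κ j + τ * (ε * δ j) = 0 := by
      have : ε * δ j ≠ 0 := hj'.ne
      simp only [τ]
      rw [div_neg, neg_mul, div_mul_cancel₀ _ this]
      ring
    have hsum : ∑ i, (κ i + τ * (ε * δ i)) • hom s i = (pt q (a + τ * ε), 1) := by
      simp only [add_smul, Finset.sum_add_distrib, hκs, ← mul_assoc, mul_smul (τ * ε)]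
      rw [← Finset.smul_sum, hδ]
      ext1
      · simp only [pt, Prod.fst_add, Prod.smul_fst]
        module
      · simp
    obtain ⟨V, D, hV, hD, hne, hVD, hmem⟩ := exists_face_of_nonneg hnn hsum hzero
    exact ⟨(V, D), K.face_mem s hs V D hV hD hne, hV, hD, hVD, _, hmem, a + τ * ε, rfl⟩
  · rintro ⟨t, ht, h1, h2, hts, _, hx, b, rfl⟩
    refine isParallelTo_of_mem (a := a) (b := b) ?_ (mem_homSpan_of_mem_openCell ha)
      (homSpan_mono h1 h2 (mem_homSpan_of_mem_openCell hx))
    rintro rfl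
    exact (K.disjoint_cells t ht s hs hts).le_bot ⟨hx, ha⟩

/-- The line in the space of lines. -/
def toLine (q : PointedLine) : LineSpace := Quotient.mk _ q

theorem Scene.mem_facesMet_iff {K : Scene} {q : PointedLine} {s : Finset E3 × Finset E3}
    (hs : s ∈ K.cells) : s ∈ K.facesMet (toLine q) ↔ ∃ a, pt q a ∈ openCell s := by
  constructor
  · rintro ⟨_, _, hx, a, rfl⟩
    exact ⟨a, hx⟩
  · rintro ⟨a, ha⟩
    exact ⟨hs, _, ha, a, rfl⟩

/-- By `Scene.isParallelTo_iff`, parallelism to a face that is met is visible in the set of faces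
met. -/
theorem Scene.isParallelTo_congr {K : Scene} {q q' : PointedLine}
    (h : K.facesMet (toLine q) = K.facesMet (toLine q')) {s : Finset E3 × Finset E3}
    (hs : s ∈ K.cells) {a : ℝ} (ha : pt q a ∈ openCell s) :
    IsParallelTo q s ↔ IsParallelTo q' s := by
  have hs' : s ∈ K.facesMet (toLine q') := h ▸ (Scene.mem_facesMet_iff hs).mpr ⟨a, ha⟩
  obtain ⟨a', ha'⟩ := (Scene.mem_facesMet_iff hs).mp hs'
  rw [K.isParallelTo_iff hs ha, K.isParallelTo_iff hs ha']
  refine exists_congr fun t => and_congr_right fun ht => ?_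
  have : (openCell t ∩ lineSet q).Nonempty ↔ (openCell t ∩ lineSet q').Nonempty := by
    have h1 : (t ∈ K.facesMet (toLine q)) ↔ (t ∈ K.facesMet (toLine q')) := by rw [h]
    simp only [Scene.facesMet, mem_ofPred_eq, ht, true_and] at h1
    exact h1
  rw [this]

/-- When a line moves with its set of faces fixed, the faces do not jump. -/
theorem Scene.eventually_exists_mem {K : Scene} {q₀ : PointedLine} {s : Finset E3 × Finset E3}
    (hs : s ∈ K.cells) {t₀ : ℝ} (h₀ : pt q₀ t₀ ∈ openCell s) {ε : ℝ} (hε : 0 < ε) :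
    ∀ᶠ q in 𝓝 q₀, K.facesMet (toLine q) = K.facesMet (toLine q₀) →
      ∃ t, |t - t₀| < ε ∧ pt q t ∈ openCell s := by
  by_cases hpar : IsParallelTo q₀ s
  · filter_upwards [(continuous_pt_left t₀).continuousAt.eventually
      (eventually_mem_openCell (K.nondegenerate s hs) h₀)] with q hq hF
    have hsq : s ∈ K.facesMet (toLine q) := hF ▸ (Scene.mem_facesMet_iff hs).mpr ⟨t₀, h₀⟩
    obtain ⟨a, ha⟩ := (Scene.mem_facesMet_iff hs).mp hsq
    have hparq : IsParallelTo q s := (Scene.isParallelTo_congr hF hs ha).mpr hpar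
    exact ⟨t₀, by simpa using hε, hq (hparq.mem t₀ (mem_homSpan_of_mem_openCell ha))⟩
  -- A functional vanishing on the span but not on the direction gives the parameter of the
  -- intersection as a quotient, continuous in the line.
  · obtain ⟨φ, hφ, hker⟩ := Submodule.exists_le_ker_of_notMem hpar
    have hφc : Continuous φ := LinearMap.continuous_of_finiteDimensional φ
    have hzero : ∀ (q : PointedLine) (t : ℝ), pt q t ∈ openCell s →
        φ (q.1.1, 1) + t * φ (q.1.2, 0) = 0 := by
      intro q t ht
      have h1 : φ (pt q t, 1) = 0 := hker (mem_homSpan_of_mem_openCell ht)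
      have h2 : (pt q t, (1 : ℝ)) = (q.1.1, (1 : ℝ)) + t • (q.1.2, (0 : ℝ)) := by
        ext1
        · rfl
        · simp
      rwa [h2, map_add, map_smul, smul_eq_mul] at h1
    have hden : Continuous fun q : PointedLine => φ (q.1.2, 0) := hφc.comp (by fun_prop)
    have hnum : Continuous fun q : PointedLine => φ (q.1.1, 1) := hφc.comp (by fun_prop)
    have hcont : ContinuousAt (fun q : PointedLine => -φ (q.1.1, 1) / φ (q.1.2, 0)) q₀ :=
      hnum.neg.continuousAt.div hden.continuousAt hφ
    have hval : ∀ (q : PointedLine) (t : ℝ), φ (q.1.2, 0) ≠ 0 → pt q t ∈ openCell s →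
        -φ (q.1.1, 1) / φ (q.1.2, 0) = t := by
      intro q t hne ht
      rw [div_eq_iff hne]
      linear_combination -(hzero q t ht)
    have hnear : ∀ᶠ q in 𝓝 q₀, |-φ (q.1.1, 1) / φ (q.1.2, 0) - t₀| < ε := by
      have := hcont.eventually (Metric.ball_mem_nhds _ hε)
      filter_upwards [this] with q hq
      rwa [hval q₀ t₀ hφ h₀, Real.dist_eq] at hq
    filter_upwards [hnear, hden.continuousAt.eventually_ne hφ] with q h1 h2 hF
    have hsq : s ∈ K.facesMet (toLine q) := hF ▸ (Scene.mem_facesMet_iff hs).mpr ⟨t₀, h₀⟩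
    obtain ⟨a, ha⟩ := (Scene.mem_facesMet_iff hs).mp hsq
    rw [hval q a h2 ha] at h1
    exact ⟨a, h1, ha⟩

/-! ### Visibility is constant on the cells -/

theorem visible_comm {O : Set E3} {p q : E3} : Visible O p q ↔ Visible O q p := by
  rw [Visible, Visible, openSegment_symm]

theorem visible_pt_iff {O : Set E3} {q : PointedLine} {a b : ℝ} (hab : a < b) :
    Visible O (pt q a) (pt q b) ↔ ∀ t ∈ Ioo a b, pt q t ∉ O := by
  have himg : openSegment ℝ (pt q a) (pt q b) = pt q '' Ioo a b := by
    rw [← openSegment_eq_Ioo hab]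
    ext x
    constructor
    · rintro ⟨α, β, hα, hβ, h, rfl⟩
      refine ⟨α • a + β • b, ⟨α, β, hα, hβ, h, rfl⟩, ?_⟩
      obtain rfl : α = 1 - β := by linarith
      simp only [pt, smul_eq_mul]
      module
    · rintro ⟨_, ⟨α, β, hα, hβ, h, rfl⟩, rfl⟩
      refine ⟨α, β, hα, hβ, h, ?_⟩
      obtain rfl : α = 1 - β := by linarith
      simp only [pt, smul_eq_mul]
      module
  rw [Visible, himg, disjoint_left, forall_mem_image]

section Encoding

variable {K : Scene} {O : Set E3} {s t : Finset E3 × Finset E3}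

theorem Scene.openCell_subset (hO : IsClosed O) (hfr : frontier O = K.support) (hs : s ∈ K.cells) :
    openCell s ⊆ O := by
  refine Subset.trans ?_ hO.frontier_subset
  rw [hfr]
  exact subset_biUnion_of_mem (u := openCell) hs

theorem not_visible_of_mem_openCell (hs : openCell s ⊆ O) {p q : E3}
    (hp : p ∈ openCell s) (hq : q ∈ openCell s) : ¬ Visible O p q := by
  intro h
  have hm : (2⁻¹ : ℝ) • p + (2⁻¹ : ℝ) • q ∈ openSegment ℝ p q :=
    ⟨2⁻¹, 2⁻¹, by norm_num, by norm_num, by norm_num, rfl⟩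
  exact h.le_bot ⟨hm, hs ((convex_openCell s).openSegment_subset hp hq hm)⟩

/-- A face that contains a piece of the line around the point blocks the view itself. -/
theorem IsParallelTo.not_visible {q : PointedLine} (hpar : IsParallelTo q s)
    (hnd : Nondegenerate s) (hs : openCell s ⊆ O) {a b : ℝ} (hab : a ≠ b)
    (ha : pt q a ∈ openCell s) : ¬ Visible O (pt q a) (pt q b) := by
  have hev := hpar.eventually hnd ha
  rcases lt_or_gt_of_ne hab with h | h
  · rw [visible_pt_iff h]
    intro hvis
    obtain ⟨t, ht1, ht2⟩ := ((hev.filter_mono nhdsWithin_le_nhds).and (Ioo_mem_nhdsGT h)).exists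
    exact hvis t ht2 (hs ht1)
  · rw [visible_comm, visible_pt_iff h]
    intro hvis
    obtain ⟨t, ht1, ht2⟩ := ((hev.filter_mono nhdsWithin_le_nhds).and (Ioo_mem_nhdsLT h)).exists
    exact hvis t ht2 (hs ht1)

/-- Both endpoints are unique on their faces and move continuously. A free segment stays free
because no face can enter it without passing an endpoint; a blocked one stays blocked because the
blocking point is interior to `O` or lies on a face that persists. -/
theorem Scene.eventually_visible_iff (hO : IsClosed O) (hfr : frontier O = K.support)
    (hs : s ∈ K.cells) (ht : t ∈ K.cells) {q₀ : PointedLine} (hsp : ¬ IsParallelTo q₀ s)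
    (htp : ¬ IsParallelTo q₀ t) {a₀ b₀ : ℝ} (hab : a₀ < b₀) (ha₀ : pt q₀ a₀ ∈ openCell s)
    (hb₀ : pt q₀ b₀ ∈ openCell t) :
    ∀ᶠ q in 𝓝 q₀, K.facesMet (toLine q) = K.facesMet (toLine q₀) → ∀ a b,
      pt q a ∈ openCell s → pt q b ∈ openCell t →
      (Visible O (pt q₀ a₀) (pt q₀ b₀) ↔ Visible O (pt q a) (pt q b)) := by
  have huniq : ∀ {r : Finset E3 × Finset E3}, r ∈ K.cells → ¬ IsParallelTo q₀ r →
      ∀ {q : PointedLine}, K.facesMet (toLine q) = K.facesMet (toLine q₀) → ∀ {a b : ℝ},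
      pt q a ∈ openCell r → pt q b ∈ openCell r → a = b := by
    intro r hr hrp q hF a b ha hb
    by_contra hne
    exact hrp ((Scene.isParallelTo_congr hF hr ha).mp (isParallelTo_of_mem hne
      (mem_homSpan_of_mem_openCell ha) (mem_homSpan_of_mem_openCell hb)))
  have hclose : ∀ {ε : ℝ}, 0 < ε → ∀ᶠ q in 𝓝 q₀, K.facesMet (toLine q) = K.facesMet (toLine q₀) →
      ∀ a b, pt q a ∈ openCell s → pt q b ∈ openCell t → |a - a₀| < ε ∧ |b - b₀| < ε := by
    intro ε hε
    filter_upwards [Scene.eventually_exists_mem hs ha₀ hε, Scene.eventually_exists_mem ht hb₀ hε]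
      with q h1 h2 hF a b ha hb
    obtain ⟨a', ha', hsa'⟩ := h1 hF
    obtain ⟨b', hb', hsb'⟩ := h2 hF
    rw [huniq hs hsp hF ha hsa', huniq ht htp hF hb hsb']
    exact ⟨ha', hb'⟩
  have hgap : 0 < (b₀ - a₀) / 2 := by linarith
  by_cases hvis : Visible O (pt q₀ a₀) (pt q₀ b₀)
  · have hvis' := (visible_pt_iff hab).mp hvis
    have hfaces : ∀ᶠ q in 𝓝 q₀, ∀ r ∈ K.cells, K.facesMet (toLine q) = K.facesMet (toLine q₀) →
        ∀ a b, pt q a ∈ openCell s → pt q b ∈ openCell t → ∀ τ ∈ Ioo a b, pt q τ ∉ openCell r := by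
      rw [eventually_all_finset]
      intro r hr
      by_cases hrs : r = s
      · subst hrs
        refine Eventually.of_forall fun q hF a b ha _ τ hτ hτr => ?_
        exact hτ.1.ne (huniq hr hsp hF ha hτr)
      by_cases hrt : r = t
      · subst hrt
        refine Eventually.of_forall fun q hF a b _ hb τ hτ hτr => ?_
        exact hτ.2.ne (huniq hr htp hF hτr hb)
      by_cases hrF : r ∈ K.facesMet (toLine q₀)
      · obtain ⟨τ₀, hτ₀⟩ := (Scene.mem_facesMet_iff hr).mp hrF
        have hτa : τ₀ ≠ a₀ := by
          rintro rfl
          exact (K.disjoint_cells r hr s hs hrs).le_bot ⟨hτ₀, ha₀⟩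
        have hτb : τ₀ ≠ b₀ := by
          rintro rfl
          exact (K.disjoint_cells r hr t ht hrt).le_bot ⟨hτ₀, hb₀⟩
        have hout : τ₀ < a₀ ∨ b₀ < τ₀ := by
          by_contra hcon
          push Not at hcon
          exact hvis' τ₀ ⟨lt_of_le_of_ne hcon.1 hτa.symm, lt_of_le_of_ne hcon.2 hτb⟩
            (Scene.openCell_subset hO hfr hr hτ₀)
        have hε : 0 < min (|τ₀ - a₀| / 2) (|τ₀ - b₀| / 2) :=
          lt_min (half_pos (abs_pos.mpr (sub_ne_zero.mpr hτa)))
            (half_pos (abs_pos.mpr (sub_ne_zero.mpr hτb)))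
        filter_upwards [hclose hε, Scene.eventually_exists_mem hr hτ₀ hε]
          with q h1 h2 hF a b ha hb τ hτ hτr
        obtain ⟨σ, hσ, hσr⟩ := h2 hF
        obtain ⟨h3, h4⟩ := h1 hF a b ha hb
        -- The face still has a point `σ` beyond an endpoint. If it also met the segment, convexity
        -- would put that endpoint on it, against the disjointness of faces.
        have hmid : ∀ {c : ℝ}, c ∈ uIcc σ τ → pt q c ∈ openCell r := by
          intro c hc
          have hconv : Convex ℝ (pt q ⁻¹' openCell r) := by
            intro x hx y hy α β hα hβ hαβ
            have := convex_openCell r hx hy hα hβ hαβ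
            obtain rfl : α = 1 - β := by linarith
            rw [mem_preimage]
            convert this using 1
            simp only [pt, smul_eq_mul]
            module
          exact hconv.ordConnected.uIcc_subset hσr hτr hc
        rw [abs_lt] at hσ h3 h4
        rcases hout with hout | hout
        · have h5 := min_le_left (|τ₀ - a₀| / 2) (|τ₀ - b₀| / 2)
          rw [abs_of_neg (by linarith : τ₀ - a₀ < 0)] at *
          have hc : pt q a ∈ openCell r := hmid (by
            rw [uIcc_of_le (by linarith [hτ.1])]
            exact ⟨by linarith, hτ.1.le⟩)
          exact (K.disjoint_cells r hr s hs hrs).le_bot ⟨hc, ha⟩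
        · have h5 := min_le_right (|τ₀ - a₀| / 2) (|τ₀ - b₀| / 2)
          rw [abs_of_pos (by linarith : 0 < τ₀ - b₀)] at *
          have hc : pt q b ∈ openCell r := hmid (by
            rw [uIcc_of_ge (by linarith [hτ.2])]
            exact ⟨hτ.2.le, by linarith⟩)
          exact (K.disjoint_cells r hr t ht hrt).le_bot ⟨hc, hb⟩
      · refine Eventually.of_forall fun q hF a b _ _ τ _ hτr => hrF ?_
        rw [← hF]
        exact (Scene.mem_facesMet_iff hr).mpr ⟨τ, hτr⟩
    have hmO : pt q₀ ((a₀ + b₀) / 2) ∈ Oᶜ := hvis' _ ⟨by linarith, by linarith⟩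
    filter_upwards [hfaces, hclose hgap,
      (continuous_pt_left ((a₀ + b₀) / 2)).continuousAt.eventually
        (hO.isOpen_compl.mem_nhds hmO)] with q h1 h2 h3 hF a b ha hb
    obtain ⟨h4, h5⟩ := h2 hF a b ha hb
    rw [abs_lt] at h4 h5
    have hablt : a < b := by linarith
    refine iff_of_true hvis ((visible_pt_iff hablt).mpr ?_)
    -- The segment avoids the frontier of `O` and its parameter `(a₀ + b₀) / 2` is outside `O`, so
    -- by connectedness the whole segment is outside.
    have hpre : IsPreconnected (pt q '' Ioo a b) :=
      isPreconnected_Ioo.image _ (continuous_pt q).continuousOn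
    have hsub : pt q '' Ioo a b ⊆ interior O ∪ Oᶜ := by
      rintro _ ⟨τ, hτ, rfl⟩
      by_contra hcon
      rw [mem_union, not_or, mem_compl_iff, not_not] at hcon
      have : pt q τ ∈ frontier O := ⟨subset_closure hcon.2, hcon.1⟩
      rw [hfr] at this
      simp only [Scene.support, mem_iUnion] at this
      obtain ⟨r, hr, hτr⟩ := this
      exact h1 r hr hF a b ha hb τ hτ hτr
    have := hpre.subset_right_of_subset_union isOpen_interior hO.isOpen_compl
      (disjoint_compl_right.mono_left interior_subset) hsub
      ⟨_, ⟨(a₀ + b₀) / 2, ⟨by linarith, by linarith⟩, rfl⟩, h3⟩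
    exact fun τ hτ => this ⟨τ, hτ, rfl⟩
  · have hnvis := hvis
    rw [visible_pt_iff hab] at hnvis
    push Not at hnvis
    obtain ⟨τ₀, hτ₀, hτO⟩ := hnvis
    have hε : 0 < min ((τ₀ - a₀) / 2) ((b₀ - τ₀) / 2) :=
      lt_min (by linarith [hτ₀.1]) (by linarith [hτ₀.2])
    have hstay : ∀ᶠ q in 𝓝 q₀, K.facesMet (toLine q) = K.facesMet (toLine q₀) →
        ∃ τ, |τ - τ₀| < min ((τ₀ - a₀) / 2) ((b₀ - τ₀) / 2) ∧ pt q τ ∈ O := by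
      by_cases hint : pt q₀ τ₀ ∈ interior O
      · filter_upwards [(continuous_pt_left τ₀).continuousAt.eventually
          (isOpen_interior.mem_nhds hint)] with q hq _
        exact ⟨τ₀, by simpa using hε, interior_subset hq⟩
      · have : pt q₀ τ₀ ∈ frontier O := ⟨subset_closure hτO, hint⟩
        rw [hfr] at this
        simp only [Scene.support, mem_iUnion] at this
        obtain ⟨r, hr, hτr⟩ := this
        filter_upwards [Scene.eventually_exists_mem hr hτr hε] with q hq hF
        obtain ⟨τ, h1, h2⟩ := hq hF
        exact ⟨τ, h1, Scene.openCell_subset hO hfr hr h2⟩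
    filter_upwards [hstay, hclose hε] with q h1 h2 hF a b ha hb
    obtain ⟨τ, hτ, hτO⟩ := h1 hF
    obtain ⟨h4, h5⟩ := h2 hF a b ha hb
    rw [abs_lt] at hτ h4 h5
    have h6 := min_le_left ((τ₀ - a₀) / 2) ((b₀ - τ₀) / 2)
    have h7 := min_le_right ((τ₀ - a₀) / 2) ((b₀ - τ₀) / 2)
    have h8 : a < τ := by linarith
    have h9 : τ < b := by linarith
    refine iff_of_false hvis ?_
    rw [visible_pt_iff (h8.trans h9)]
    exact fun h => h τ ⟨h8, h9⟩ hτO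

theorem lineSet_eq_iff {q q' : PointedLine} (h : lineSet q = lineSet q') :
    ∃ a b : ℝ, b ≠ 0 ∧ q'.1 = (q.1.1 + a • q.1.2, b • q.1.2) := by
  have h0 : q'.1.1 ∈ lineSet q := by
    rw [h]
    exact ⟨0, by simp⟩
  have h1 : q'.1.1 + q'.1.2 ∈ lineSet q := by
    rw [h]
    exact ⟨1, by simp⟩
  obtain ⟨a, ha⟩ := h0
  obtain ⟨c, hc⟩ := h1
  simp only at ha hc
  have hd : q'.1.2 = (c - a) • q.1.2 := by
    rw [← ha] at hc
    have : q'.1.2 = (q.1.1 + c • q.1.2) - (q.1.1 + a • q.1.2) := by rw [hc]; abel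
    rw [this]
    module
  refine ⟨a, c - a, fun h0 => q'.2 ?_, Prod.ext ha.symm hd⟩
  rw [hd, h0, zero_smul]

/-- The saturation of an open set is the union of its preimages under all changes of base point and
scalings of the direction. Openness carries neighborhoods of pointed lines to the quotient. -/
theorem isOpenMap_toLine : IsOpenMap toLine := by
  intro U hU
  change IsOpen (Quotient.mk _ ⁻¹' (toLine '' U))
  let f : ℝ → {b : ℝ // b ≠ 0} → PointedLine → PointedLine := fun a b q =>
    ⟨(q.1.1 + a • q.1.2, b.1 • q.1.2), smul_ne_zero b.2 q.2⟩
  have hf : ∀ a b, Continuous (f a b) := fun a b => by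
    refine Continuous.subtype_mk ?_ _
    fun_prop
  have heq : (Quotient.mk _ ⁻¹' (toLine '' U) : Set PointedLine) = ⋃ a, ⋃ b, f a b ⁻¹' U := by
    ext q
    simp only [mem_preimage, mem_iUnion]
    constructor
    · rintro ⟨q', hq', h⟩
      have h' : lineSet q' = lineSet q := Quotient.exact h
      obtain ⟨a, b, hb, hab⟩ := lineSet_eq_iff h'.symm
      refine ⟨a, ⟨b, hb⟩, ?_⟩
      have : f a ⟨b, hb⟩ q = q' := Subtype.ext hab.symm
      rwa [this]
    · rintro ⟨a, b, h⟩
      refine ⟨f a b q, h, Quotient.sound ?_⟩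
      change lineSet _ = lineSet _
      ext x
      constructor
      · rintro ⟨t, rfl⟩
        refine ⟨a + t * b.1, ?_⟩
        simp only [f]
        module
      · rintro ⟨t, rfl⟩
        refine ⟨(t - a) / b.1, ?_⟩
        simp only [f]
        rw [smul_smul, div_mul_cancel₀ _ b.2]
        module
  rw [heq]
  exact isOpen_iUnion fun a => isOpen_iUnion fun b => hU.preimage (hf a b)

theorem Scene.visible_iff_of_mem_cell (hO : IsClosed O) (hfr : frontier O = K.support)
    {c : Set LineSpace} (hc : c ∈ K.visibilityMap) {l₁ l₂ : LineSpace} (hl₁ : l₁ ∈ c)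
    (hl₂ : l₂ ∈ c) (hs : s ∈ K.cells) (ht : t ∈ K.cells) {p₁ q₁ p₂ q₂ : E3}
    (hp₁ : p₁ ∈ openCell s ∩ l₁.points) (hq₁ : q₁ ∈ openCell t ∩ l₁.points)
    (hp₂ : p₂ ∈ openCell s ∩ l₂.points) (hq₂ : q₂ ∈ openCell t ∩ l₂.points) :
    Visible O p₁ q₁ ↔ Visible O p₂ q₂ := by
  have hsO : openCell s ⊆ O := Scene.openCell_subset hO hfr hs
  have htO : openCell t ⊆ O := Scene.openCell_subset hO hfr ht
  by_cases hst : s = t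
  · subst hst
    exact iff_of_false (not_visible_of_mem_openCell hsO hp₁.1 hq₁.1)
      (not_visible_of_mem_openCell hsO hp₂.1 hq₂.1)
  obtain ⟨l₀, rfl⟩ := hc
  have hface : ∀ l ∈ connectedComponentIn {m | K.facesMet m = K.facesMet l₀} l₀,
      K.facesMet l = K.facesMet l₀ := fun l hl => by
    have : l ∈ {m | K.facesMet m = K.facesMet l₀} := connectedComponentIn_subset _ _ hl
    exact this
  have hsF : s ∈ K.facesMet l₀ := hface l₁ hl₁ ▸ ⟨hs, p₁, hp₁⟩
  have htF : t ∈ K.facesMet l₀ := hface l₁ hl₁ ▸ ⟨ht, q₁, hq₁⟩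
  have hmain := isPreconnected_connectedComponentIn.induction₂ (fun l l' : LineSpace =>
    ∀ p ∈ openCell s ∩ l.points, ∀ q ∈ openCell t ∩ l.points, ∀ p' ∈ openCell s ∩ l'.points,
    ∀ q' ∈ openCell t ∩ l'.points, (Visible O p q ↔ Visible O p' q')) ?_ ?_ ?_ hl₁ hl₂
  · exact hmain p₁ hp₁ q₁ hq₁ p₂ hp₂ q₂ hq₂
  · intro l hl
    obtain ⟨r₀, rfl⟩ : ∃ r, toLine r = l := Quotient.exists_rep l
    have hF₀ := hface _ hl
    obtain ⟨a₀, ha₀⟩ := (Scene.mem_facesMet_iff hs).mp (hF₀ ▸ hsF)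
    obtain ⟨b₀, hb₀⟩ := (Scene.mem_facesMet_iff ht).mp (hF₀ ▸ htF)
    have hne : ∀ {r : PointedLine} {a b : ℝ}, pt r a ∈ openCell s → pt r b ∈ openCell t →
        a ≠ b := by
      rintro r a b ha hb rfl
      exact (K.disjoint_cells s hs t ht hst).le_bot ⟨ha, hb⟩
    -- In the parallel case no pair on these two faces is ever visible, so only transversal
    -- intersections need the continuity argument.
    have hnv : IsParallelTo r₀ s ∨ IsParallelTo r₀ t → ∀ r : PointedLine,
        K.facesMet (toLine r) = K.facesMet (toLine r₀) → ∀ a b, pt r a ∈ openCell s →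
        pt r b ∈ openCell t → ¬ Visible O (pt r a) (pt r b) := by
      rintro (h | h) r hF a b ha hb
      · exact ((Scene.isParallelTo_congr hF hs ha).mpr h).not_visible (K.nondegenerate s hs) hsO
          (hne ha hb) ha
      · rw [visible_comm]
        exact ((Scene.isParallelTo_congr hF ht hb).mpr h).not_visible (K.nondegenerate t ht) htO
          (hne ha hb).symm hb
    have hev : ∀ᶠ r in 𝓝 r₀, K.facesMet (toLine r) = K.facesMet (toLine r₀) →
        ∀ a' b', pt r₀ a' ∈ openCell s → pt r₀ b' ∈ openCell t →
        ∀ a b, pt r a ∈ openCell s → pt r b ∈ openCell t →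
        (Visible O (pt r₀ a') (pt r₀ b') ↔ Visible O (pt r a) (pt r b)) := by
      by_cases hpar : IsParallelTo r₀ s ∨ IsParallelTo r₀ t
      · exact Eventually.of_forall fun r hF a' b' ha' hb' a b ha hb =>
          iff_of_false (hnv hpar r₀ rfl a' b' ha' hb') (hnv hpar r hF a b ha hb)
      · rw [not_or] at hpar
        have huniq : ∀ a' b', pt r₀ a' ∈ openCell s → pt r₀ b' ∈ openCell t →
            a' = a₀ ∧ b' = b₀ := by
          intro a' b' ha' hb'
          constructor
          · by_contra h
            exact hpar.1 (isParallelTo_of_mem h (mem_homSpan_of_mem_openCell ha')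
              (mem_homSpan_of_mem_openCell ha₀))
          · by_contra h
            exact hpar.2 (isParallelTo_of_mem h (mem_homSpan_of_mem_openCell hb')
              (mem_homSpan_of_mem_openCell hb₀))
        rcases lt_or_gt_of_ne (hne ha₀ hb₀) with hab | hab
        · filter_upwards [Scene.eventually_visible_iff hO hfr hs ht hpar.1 hpar.2 hab ha₀ hb₀]
            with r hr hF a' b' ha' hb' a b ha hb
          obtain ⟨rfl, rfl⟩ := huniq a' b' ha' hb'
          exact hr hF a b ha hb
        · filter_upwards [Scene.eventually_visible_iff hO hfr ht hs hpar.2 hpar.1 hab hb₀ ha₀]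
            with r hr hF a' b' ha' hb' a b ha hb
          obtain ⟨rfl, rfl⟩ := huniq a' b' ha' hb'
          rw [visible_comm, hr hF b a hb ha, visible_comm]
    rw [eventually_nhdsWithin_iff]
    have himg := isOpenMap_toLine.image_mem_nhds hev
    filter_upwards [himg]
    rintro _ ⟨r, hr, rfl⟩ hrc _ ⟨hp, a', rfl⟩ _ ⟨hq, b', rfl⟩ _ ⟨hp', a, rfl⟩ _ ⟨hq', b, rfl⟩
    exact hr ((hface _ hrc).trans hF₀.symm) a' b' hp hq a b hp' hq'
  · intro x y z _ hy _ h1 h2 p hp q hq p' hp' q' hq'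
    obtain ⟨_, u, hu⟩ := (hface y hy).symm ▸ hsF
    obtain ⟨_, v, hv⟩ := (hface y hy).symm ▸ htF
    exact (h1 p hp q hq u hu v hv).trans (h2 u hu v hv p' hp' q' hq')
  · intro x y _ _ h p hp q hq p' hp' q' hq'
    exact (h p' hp' q' hq' p hp q hq).symm

end Encoding

end VisMap

end

/-! ### The saddle-shaped terrain as a triangulated scene. -/

noncomputable section

namespace VisMap

open Topology Filter

/-! ### Complexes given by their maximal cells -/

/-- All faces of a simplex. -/
def faces (m : Finset E3 × Finset E3) : Finset (Finset E3 × Finset E3) :=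
  (m.1.powerset.filter Finset.Nonempty) ×ˢ m.2.powerset

theorem mem_faces_iff {m s : Finset E3 × Finset E3} :
    s ∈ faces m ↔ s.1.Nonempty ∧ s.1 ⊆ m.1 ∧ s.2 ⊆ m.2 := by
  simp only [faces, Finset.mem_product, Finset.mem_filter, Finset.mem_powerset]
  tauto

theorem card_faces_le (m : Finset E3 × Finset E3) : (faces m).card ≤ 2 ^ (m.1.card + m.2.card) := by
  rw [faces, Finset.card_product, pow_add, ← Finset.card_powerset, ← Finset.card_powerset]
  exact Nat.mul_le_mul_right _ (Finset.card_filter_le _ _)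

theorem Nondegenerate.mono {m s : Finset E3 × Finset E3} (hm : Nondegenerate m) (h1 : s.1 ⊆ m.1)
    (h2 : s.2 ⊆ m.2) : Nondegenerate s := by
  have := hm.comp (Sum.map (fun v : s.1 => (⟨v, h1 v.2⟩ : m.1))
    (fun v : s.2 => (⟨v, h2 v.2⟩ : m.2))) (by
      refine Function.Injective.sumMap ?_ ?_
      · intro a b h
        exact Subtype.ext (congrArg (fun v : m.1 => (v : E3)) h)
      · intro a b h
        exact Subtype.ext (congrArg (fun v : m.2 => (v : E3)) h))
  change LinearIndependent ℝ (hom s)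
  convert this using 1
  ext1 i
  rcases i with i | i <;> rfl

theorem nondegenerate_of_forall {s : Finset E3 × Finset E3}
    (h : ∀ a b : E3 → ℝ, ∑ v ∈ s.1, a v • v + ∑ d ∈ s.2, b d • d = 0 → ∑ v ∈ s.1, a v = 0 →
      (∀ v ∈ s.1, a v = 0) ∧ ∀ d ∈ s.2, b d = 0) : Nondegenerate s := by
  classical
  change LinearIndependent ℝ (hom s)
  rw [Fintype.linearIndependent_iff]
  intro κ hκ
  rw [Fintype.sum_sum_type] at hκ
  have h1 := congrArg Prod.fst hκ
  have h2 := congrArg Prod.snd hκ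
  simp only [hom, Sum.elim_inl, Sum.elim_inr, Prod.fst_add, Prod.fst_sum, Prod.smul_fst,
    Prod.snd_add, Prod.snd_sum, Prod.smul_snd, smul_eq_mul, mul_one, mul_zero,
    Finset.sum_const_zero, add_zero, Prod.fst_zero, Prod.snd_zero] at h1 h2
  obtain ⟨ha, hb⟩ := h (fun v => if h : v ∈ s.1 then κ (Sum.inl ⟨v, h⟩) else 0)
    (fun v => if h : v ∈ s.2 then κ (Sum.inr ⟨v, h⟩) else 0)
    (by
      rw [← h1, ← Finset.sum_coe_sort s.1, ← Finset.sum_coe_sort s.2]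
      simp)
    (by
      rw [← h2, ← Finset.sum_coe_sort s.1]
      simp)
  rintro (i | i)
  · simpa using ha i i.2
  · simpa using hb i i.2

/-- The faces of a simplex are given by the supports of the nonnegative coordinates. -/
theorem exists_coordinates_of_mem_faces {m s : Finset E3 × Finset E3} (hs : s ∈ faces m) {p : E3}
    (hp : p ∈ openCell s) : ∃ a b : E3 → ℝ, (∀ v, 0 ≤ a v ∧ (v ∈ s.1 ↔ 0 < a v)) ∧
      (∀ v, 0 ≤ b v ∧ (v ∈ s.2 ↔ 0 < b v)) ∧ ∑ v ∈ m.1, a v = 1 ∧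
      p = ∑ v ∈ m.1, a v • v + ∑ d ∈ m.2, b d • d := by
  classical
  obtain ⟨-, h1, h2⟩ := mem_faces_iff.mp hs
  obtain ⟨a, b, ha, hsum, hb, rfl⟩ := hp
  refine ⟨fun v => if v ∈ s.1 then a v else 0, fun v => if v ∈ s.2 then b v else 0,
    fun v => ?_, fun v => ?_, ?_, ?_⟩
  · by_cases h : v ∈ s.1
    · simp [h, ha v h, (ha v h).le]
    · simp [h]
  · by_cases h : v ∈ s.2
    · simp [h, hb v h, (hb v h).le]
    · simp [h]
  · rw [← hsum, ← Finset.sum_filter, Finset.filter_mem_eq_inter, Finset.inter_eq_right.mpr h1]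
  · simp only [ite_smul, zero_smul]
    rw [← Finset.sum_filter, Finset.filter_mem_eq_inter, Finset.inter_eq_right.mpr h1,
      ← Finset.sum_filter, Finset.filter_mem_eq_inter, Finset.inter_eq_right.mpr h2]

theorem exists_mem_faces_of_coordinates {m : Finset E3 × Finset E3} {a b : E3 → ℝ}
    (ha : ∀ v ∈ m.1, 0 ≤ a v) (hb : ∀ v ∈ m.2, 0 ≤ b v) (hsum : ∑ v ∈ m.1, a v = 1) :
    ∃ s ∈ faces m, ∑ v ∈ m.1, a v • v + ∑ d ∈ m.2, b d • d ∈ openCell s := by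
  classical
  have hsum' : ∑ v ∈ m.1 with 0 < a v, a v = 1 := by
    rwa [Finset.sum_filter_of_ne fun v hv h => (ha v hv).lt_of_ne' h]
  refine ⟨(m.1.filter fun v => 0 < a v, m.2.filter fun v => 0 < b v),
    mem_faces_iff.mpr ⟨?_, Finset.filter_subset _ _, Finset.filter_subset _ _⟩,
    a, b, fun v hv => (Finset.mem_filter.mp hv).2, hsum', fun v hv => (Finset.mem_filter.mp hv).2,
    ?_⟩
  · rw [Finset.nonempty_iff_ne_empty]
    intro h0
    change m.1.filter (fun v => 0 < a v) = ∅ at h0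
    rw [h0] at hsum'
    simp at hsum'
  · rw [Finset.sum_filter_of_ne fun v hv h => (ha v hv).lt_of_ne' fun h0 => h (by simp [h0]),
      Finset.sum_filter_of_ne fun v hv h => (hb v hv).lt_of_ne' fun h0 => h (by simp [h0])]

/-! ### The saddle-shaped terrain -/

/-- The profile of the terrain over the first coordinate axis. -/
def profile (N : ℕ) (x : ℝ) : ℝ := min 0 (N - |x|)

/-- The height of the terrain. -/
def height (N : ℕ) (x y : ℝ) : ℝ := profile N x + |y|

/-- The vertices of the terrain. -/
def vert (N : ℕ) (k : ℤ) : E3 := !₂[(k : ℝ), 0, profile N k]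

/-- The directions of the terrain transversal to the axis. -/
def dirY (σ : ℤ) : E3 := !₂[0, (σ : ℝ), 1]

/-- The directions of the terrain along the axis. -/
def dirX (τ : ℤ) : E3 := !₂[(τ : ℝ), 0, -1]

/-- The half-strips of the terrain. -/
def strip (N : ℕ) (k σ : ℤ) : Finset E3 × Finset E3 :=
  open Classical in ({vert N k, vert N (k + 1)}, {dirY σ})

/-- The wedges of the terrain. -/
def wedge (N : ℕ) (τ σ : ℤ) : Finset E3 × Finset E3 :=
  open Classical in ({vert N (τ * (2 * N))}, {dirX τ, dirY σ})

@[simp] theorem vert_zero (N : ℕ) (k : ℤ) : vert N k 0 = k := rfl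
@[simp] theorem vert_one (N : ℕ) (k : ℤ) : vert N k 1 = 0 := rfl
@[simp] theorem vert_two (N : ℕ) (k : ℤ) : vert N k 2 = profile N k := rfl
@[simp] theorem dirY_zero (σ : ℤ) : dirY σ 0 = 0 := rfl
@[simp] theorem dirY_one (σ : ℤ) : dirY σ 1 = σ := rfl
@[simp] theorem dirY_two (σ : ℤ) : dirY σ 2 = 1 := rfl
@[simp] theorem dirX_zero (τ : ℤ) : dirX τ 0 = τ := rfl
@[simp] theorem dirX_one (τ : ℤ) : dirX τ 1 = 0 := rfl
@[simp] theorem dirX_two (τ : ℤ) : dirX τ 2 = -1 := rfl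

theorem vert_injective (N : ℕ) : Function.Injective (vert N) := by
  intro j k h
  have := congrArg (fun v : E3 => v 0) h
  simpa using this

theorem dirX_ne_dirY (τ σ : ℤ) : dirX τ ≠ dirY σ := by
  intro h
  have := congrArg (fun v : E3 => v 2) h
  norm_num at this

theorem E3.ext {p q : E3} (h0 : p 0 = q 0) (h1 : p 1 = q 1) (h2 : p 2 = q 2) : p = q := by
  ext i
  fin_cases i <;> assumption

theorem vert_ne_succ (N : ℕ) (k : ℤ) : vert N k ≠ vert N (k + 1) :=
  fun h => by simpa using vert_injective N h

/-- The kinks of the profile are at the integers ±N, so it is affine between consecutive integers.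
-/
theorem profile_affine {N : ℕ} (hN : 1 ≤ N) (k : ℤ) {β : ℝ} (h0 : 0 ≤ β) (h1 : β ≤ 1) :
    (1 - β) * profile N k + β * profile N (k + 1) = profile N (k + β) := by
  have hN' : (1 : ℝ) ≤ N := by exact_mod_cast hN
  simp only [profile]
  rcases le_or_gt (N : ℤ) k with h | h
  · have h' : (N : ℝ) ≤ k := by exact_mod_cast h
    rw [abs_of_nonneg (by linarith), abs_of_nonneg (by linarith), abs_of_nonneg (by linarith),
      min_eq_right (by linarith), min_eq_right (by linarith), min_eq_right (by linarith)]
    ring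
  · rcases le_or_gt (k + 1) (-(N : ℤ)) with h2 | h2
    · have h2' : (k : ℝ) + 1 ≤ -N := by exact_mod_cast h2
      rw [abs_of_nonpos (by linarith), abs_of_nonpos (by linarith), abs_of_nonpos (by linarith),
        min_eq_right (by linarith), min_eq_right (by linarith), min_eq_right (by linarith)]
      ring
    · have h' : (k : ℝ) + 1 ≤ N := by exact_mod_cast h
      have h2' : -(N : ℝ) ≤ k := by exact_mod_cast (by omega : -(N : ℤ) ≤ k)
      rw [min_eq_left (sub_nonneg.mpr (abs_le.mpr ⟨by linarith, by linarith⟩)),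
        min_eq_left (sub_nonneg.mpr (abs_le.mpr ⟨by linarith, by linarith⟩)),
        min_eq_left (sub_nonneg.mpr (abs_le.mpr ⟨by linarith, by linarith⟩))]
      ring

theorem nondegenerate_strip (N : ℕ) (k : ℤ) {σ : ℤ} (hσ : σ ≠ 0) :
    Nondegenerate (strip N k σ) := by
  classical
  apply nondegenerate_of_forall
  intro a b h1 h2
  simp only [strip, Finset.sum_pair (vert_ne_succ N k), Finset.sum_singleton] at h1 h2
  have c0 := congrArg (fun v : E3 => v 0) h1
  have c1 := congrArg (fun v : E3 => v 1) h1
  simp at c0 c1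
  have hb : b (dirY σ) = 0 := c1.resolve_right (by exact_mod_cast hσ)
  have ha' : a (vert N (k + 1)) = 0 := by linear_combination c0 - (k : ℝ) * h2
  have ha : a (vert N k) = 0 := by linarith
  simp [strip, ha, ha', hb]

theorem nondegenerate_wedge (N : ℕ) {τ σ : ℤ} (hτ : τ ≠ 0) (hσ : σ ≠ 0) :
    Nondegenerate (wedge N τ σ) := by
  classical
  apply nondegenerate_of_forall
  intro a b h1 h2
  simp only [wedge, Finset.sum_pair (dirX_ne_dirY τ σ), Finset.sum_singleton] at h1 h2
  have c0 := congrArg (fun v : E3 => v 0) h1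
  have c1 := congrArg (fun v : E3 => v 1) h1
  simp [h2] at c0 c1
  have hb : b (dirY σ) = 0 := c1.resolve_right (by exact_mod_cast hσ)
  have hb' : b (dirX τ) = 0 := c0.resolve_right (by exact_mod_cast hτ)
  simp [wedge, h2, hb, hb']

/-- The faces of the terrain. -/
def saddleCells (N : ℕ) : Finset (Finset E3 × Finset E3) :=
  open Classical in
  ((Finset.Ico (-(2 * N : ℤ)) (2 * N) ×ˢ ({1, -1} : Finset ℤ)).biUnion
    fun i => faces (strip N i.1 i.2)) ∪
  ((({1, -1} : Finset ℤ) ×ˢ ({1, -1} : Finset ℤ)).biUnion fun i => faces (wedge N i.1 i.2))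

theorem mem_saddleCells_iff {N : ℕ} {s : Finset E3 × Finset E3} : s ∈ saddleCells N ↔
    (∃ k σ : ℤ, -(2 * N : ℤ) ≤ k ∧ k < 2 * N ∧ (σ = 1 ∨ σ = -1) ∧ s ∈ faces (strip N k σ)) ∨
    ∃ τ σ : ℤ, (τ = 1 ∨ τ = -1) ∧ (σ = 1 ∨ σ = -1) ∧ s ∈ faces (wedge N τ σ) := by
  classical
  simp only [saddleCells, Finset.mem_union, Finset.mem_biUnion, Finset.mem_product,
    Finset.mem_Ico, Finset.mem_insert, Finset.mem_singleton, Prod.exists, and_assoc]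

theorem card_saddleCells_le (N : ℕ) : (saddleCells N).card ≤ 64 * N + 32 := by
  classical
  have hs : ∀ k σ, (faces (strip N k σ)).card ≤ 8 := fun k σ => by
    refine (card_faces_le _).trans ?_
    rw [strip, Finset.card_pair (vert_ne_succ N k), Finset.card_singleton]
    norm_num
  have hw : ∀ k σ, (faces (wedge N k σ)).card ≤ 8 := fun k σ => by
    refine (card_faces_le _).trans ?_
    rw [wedge, Finset.card_pair (dirX_ne_dirY k σ), Finset.card_singleton]
    norm_num
  refine (Finset.card_union_le _ _).trans ?_
  have h1 := Finset.card_biUnion_le_card_mul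
    (Finset.Ico (-(2 * N : ℤ)) (2 * N) ×ˢ ({1, -1} : Finset ℤ))
    (fun i => faces (strip N i.1 i.2)) 8 fun i _ => hs _ _
  have h2 := Finset.card_biUnion_le_card_mul
    (({1, -1} : Finset ℤ) ×ˢ ({1, -1} : Finset ℤ))
    (fun i => faces (wedge N i.1 i.2)) 8 fun i _ => hw _ _
  have h3 : ({1, -1} : Finset ℤ).card = 2 := by decide
  rw [Finset.card_product, h3] at h1 h2
  rw [Int.card_Ico] at h1
  have h4 : ((2 * N : ℤ) - -(2 * N : ℤ)).toNat = 4 * N := by omega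
  rw [h4] at h1
  omega

/-- The vertices of the face below a point. -/
def IsVertAt (N : ℕ) (p e : E3) : Prop :=
  ∃ j : ℤ, -(2 * N : ℤ) ≤ j ∧ j ≤ 2 * N ∧ e = vert N j ∧
    |max (-(2 * N : ℝ)) (min (p 0) (2 * N)) - j| < 1

/-- The directions of the face below a point. -/
def IsDirAt (N : ℕ) (p d : E3) : Prop :=
  (∃ σ : ℤ, (σ = 1 ∨ σ = -1) ∧ d = dirY σ ∧ 0 < σ * p 1) ∨
  ∃ τ : ℤ, (τ = 1 ∨ τ = -1) ∧ d = dirX τ ∧ 2 * N < τ * p 0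

theorem sign_cases {σ ρ : ℤ} (hσ : σ = 1 ∨ σ = -1) (hρ : ρ = 1 ∨ ρ = -1) {x : ℝ}
    (h1 : 0 ≤ σ * x) (h2 : 0 < ρ * x) : ρ = σ := by
  rcases hσ with rfl | rfl <;> rcases hρ with rfl | rfl <;> simp at * <;> linarith

/-- A point of a face determines the face, and lies on the graph of the height function. -/
theorem saddle_spec {N : ℕ} (hN : 1 ≤ N) {s : Finset E3 × Finset E3} (hs : s ∈ saddleCells N)
    {p : E3} (hp : p ∈ openCell s) :
    (∀ e, e ∈ s.1 ↔ IsVertAt N p e) ∧ (∀ d, d ∈ s.2 ↔ IsDirAt N p d) ∧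
      p 2 = height N (p 0) (p 1) := by
  classical
  rcases mem_saddleCells_iff.mp hs with ⟨k, σ, hk1, hk2, hσ, hf⟩ | ⟨τ, σ, hτ, hσ, hf⟩
  · obtain ⟨a, b, ha, hb, hsum, hpe⟩ := exists_coordinates_of_mem_faces hf hp
    obtain ⟨-, hs1, hs2⟩ := mem_faces_iff.mp hf
    simp only [strip, Finset.sum_pair (vert_ne_succ N k), Finset.sum_singleton] at hsum hpe
    set α := a (vert N k)
    set β := a (vert N (k + 1))
    set γ := b (dirY σ)
    have hα0 : 0 ≤ α := (ha _).1
    have hβ0 : 0 ≤ β := (ha _).1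
    have hγ0 : 0 ≤ γ := (hb _).1
    have hαβ : α = 1 - β := by linarith
    have p0 : p 0 = k + β := by
      rw [hpe]
      simp
      linear_combination (k : ℝ) * hsum
    have p1 : p 1 = σ * γ := by
      rw [hpe]
      simp
      ring
    have p2 : p 2 = α * profile N k + β * profile N (k + 1) + γ := by
      rw [hpe]
      simp
    have hσσ : (σ : ℝ) * σ = 1 := by rcases hσ with rfl | rfl <;> norm_num
    have hk1' : -(2 * N : ℝ) ≤ k := by exact_mod_cast hk1
    have hk2' : (k : ℝ) + 1 ≤ 2 * N := by exact_mod_cast hk2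
    -- Clamping the first coordinate to [-2N, 2N] forgets the wedge directions and leaves a convex
    -- combination of vertices on the axis. A vertex has positive weight iff it is at distance less
    -- than one.
    have hclamp : max (-(2 * N : ℝ)) (min (p 0) (2 * N)) = k + β := by
      rw [p0, min_eq_left (by linarith), max_eq_right (by linarith)]
    refine ⟨fun e => ?_, fun d => ?_, ?_⟩
    · rw [IsVertAt, hclamp]
      constructor
      · intro he
        have hpos := (ha e).2.mp he
        have := hs1 he
        simp only [strip, Finset.mem_insert, Finset.mem_singleton] at this
        rcases this with rfl | rfl
        · refine ⟨k, hk1, hk2.le, rfl, ?_⟩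
          have : 0 < α := hpos
          rw [abs_lt]
          constructor <;> linarith
        · refine ⟨k + 1, by omega, hk2, rfl, ?_⟩
          have : 0 < β := hpos
          push_cast
          rw [abs_lt]
          constructor <;> linarith
      · rintro ⟨j, -, -, rfl, hj⟩
        rw [abs_lt] at hj
        rw [(ha _).2]
        have hj1 : (k : ℝ) < j + 1 := by linarith
        have hj2 : (j : ℝ) < k + 2 := by linarith
        have hj1' : k < j + 1 := by exact_mod_cast hj1
        have hj2' : j < k + 2 := by exact_mod_cast hj2
        obtain rfl | rfl : j = k ∨ j = k + 1 := by omega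
        · change 0 < α
          linarith
        · change 0 < β
          push_cast at hj
          linarith
    · rw [IsDirAt]
      constructor
      · intro hd
        have hpos := (hb d).2.mp hd
        have := hs2 hd
        simp only [strip, Finset.mem_singleton] at this
        subst this
        refine Or.inl ⟨σ, hσ, rfl, ?_⟩
        rw [p1, ← mul_assoc, hσσ, one_mul]
        exact hpos
      · rintro (⟨ρ, hρ, rfl, hpos⟩ | ⟨ρ, hρ, rfl, hpos⟩)
        · obtain rfl := sign_cases hσ hρ (by rw [p1, ← mul_assoc, hσσ, one_mul]; exact hγ0) hpos
          rw [p1, ← mul_assoc, hσσ, one_mul] at hpos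
          exact (hb _).2.mpr hpos
        · exfalso
          rw [p0] at hpos
          rcases hρ with rfl | rfl <;> push_cast at hpos <;> linarith
    · rw [height, p0, p1, p2, hαβ, profile_affine hN k hβ0 (by linarith), abs_mul,
        abs_of_nonneg hγ0]
      rcases hσ with rfl | rfl <;> simp
  · obtain ⟨a, b, ha, hb, hsum, hpe⟩ := exists_coordinates_of_mem_faces hf hp
    obtain ⟨hne, hs1, hs2⟩ := mem_faces_iff.mp hf
    simp only [wedge, Finset.sum_pair (dirX_ne_dirY τ σ), Finset.sum_singleton] at hsum hpe
    set β := b (dirX τ)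
    set γ := b (dirY σ)
    have hβ0 : 0 ≤ β := (hb _).1
    have hγ0 : 0 ≤ γ := (hb _).1
    have p0 : p 0 = τ * (2 * N + β) := by
      rw [hpe]
      simp [hsum]
      ring
    have p1 : p 1 = σ * γ := by
      rw [hpe]
      simp
      ring
    have p2 : p 2 = profile N (τ * (2 * N)) - β + γ := by
      rw [hpe]
      simp [hsum]
      ring
    have hσσ : (σ : ℝ) * σ = 1 := by rcases hσ with rfl | rfl <;> norm_num
    have hττ : (τ : ℝ) * τ = 1 := by rcases hτ with rfl | rfl <;> norm_num
    have hN' : (1 : ℝ) ≤ N := by exact_mod_cast hN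
    have hclamp : max (-(2 * N : ℝ)) (min (p 0) (2 * N)) = ((τ * (2 * N) : ℤ) : ℝ) := by
      rw [p0]
      rcases hτ with rfl | rfl
      · rw [min_eq_right (by push_cast; linarith), max_eq_right (by linarith)]
        push_cast
        ring
      · rw [min_eq_left (by push_cast; linarith), max_eq_left (by push_cast; linarith)]
        push_cast
        ring
    have hs1' : s.1 = {vert N (τ * (2 * N))} :=
      (Finset.subset_singleton_iff.mp hs1).resolve_left hne.ne_empty
    refine ⟨fun e => ?_, fun d => ?_, ?_⟩
    · rw [IsVertAt, hclamp, hs1', Finset.mem_singleton]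
      constructor
      · rintro rfl
        refine ⟨τ * (2 * N), ?_, ?_, rfl, by simp⟩ <;> rcases hτ with rfl | rfl <;> omega
      · rintro ⟨j, -, -, rfl, hj⟩
        congr 1
        rw [← Int.cast_sub, ← Int.cast_abs] at hj
        have hj' : |τ * (2 * N) - j| < 1 := by exact_mod_cast hj
        rw [Int.abs_lt_one_iff] at hj'
        omega
    · rw [IsDirAt]
      constructor
      · intro hd
        have hpos := (hb d).2.mp hd
        have := hs2 hd
        simp only [wedge, Finset.mem_insert, Finset.mem_singleton] at this
        rcases this with rfl | rfl
        · refine Or.inr ⟨τ, hτ, rfl, ?_⟩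
          rw [p0, ← mul_assoc, hττ, one_mul]
          have : 0 < β := hpos
          linarith
        · refine Or.inl ⟨σ, hσ, rfl, ?_⟩
          rw [p1, ← mul_assoc, hσσ, one_mul]
          exact hpos
      · rintro (⟨ρ, hρ, rfl, hpos⟩ | ⟨ρ, hρ, rfl, hpos⟩)
        · obtain rfl := sign_cases hσ hρ (by rw [p1, ← mul_assoc, hσσ, one_mul]; exact hγ0) hpos
          rw [p1, ← mul_assoc, hσσ, one_mul] at hpos
          exact (hb _).2.mpr hpos
        · obtain rfl := sign_cases hτ hρ (by
            rw [p0, ← mul_assoc, hττ, one_mul]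
            linarith) (lt_trans (by linarith : (0 : ℝ) < 2 * N) hpos)
          rw [p0, ← mul_assoc, hττ, one_mul] at hpos
          refine (hb _).2.mpr ?_
          change 0 < β
          linarith
    · have hτa : |(τ : ℝ)| = 1 := by rcases hτ with rfl | rfl <;> simp
      have hσa : |(σ : ℝ)| = 1 := by rcases hσ with rfl | rfl <;> simp
      have e1 : |(τ : ℝ) * (2 * N)| = 2 * N := by
        rw [abs_mul, hτa, one_mul, abs_of_nonneg (by linarith)]
      have e2 : |(τ : ℝ) * (2 * N + β)| = 2 * N + β := by
        rw [abs_mul, hτa, one_mul, abs_of_nonneg (by linarith)]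
      have e3 : |(σ : ℝ) * γ| = γ := by
        rw [abs_mul, hσa, one_mul, abs_of_nonneg hγ0]
      rw [height, p0, p1, p2, profile, profile, e1, e2, e3, min_eq_right (by linarith),
        min_eq_right (by linarith)]
      ring

/-- The triangulated saddle-shaped terrain. -/
def saddle (N : ℕ) (hN : 1 ≤ N) : Scene where
  cells := saddleCells N
  vertex_nonempty := by
    intro s hs
    rcases mem_saddleCells_iff.mp hs with ⟨_, _, _, _, _, hf⟩ | ⟨_, _, _, _, hf⟩ <;>
      exact (mem_faces_iff.mp hf).1
  card_le_three := by
    classical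
    intro s hs
    rcases mem_saddleCells_iff.mp hs with ⟨k, σ, _, _, _, hf⟩ | ⟨τ, σ, _, _, hf⟩
    · obtain ⟨-, h1, h2⟩ := mem_faces_iff.mp hf
      have h3 := Finset.card_le_card h1
      have h4 := Finset.card_le_card h2
      rw [strip, Finset.card_pair (vert_ne_succ N k)] at h3
      rw [strip, Finset.card_singleton] at h4
      omega
    · obtain ⟨-, h1, h2⟩ := mem_faces_iff.mp hf
      have h3 := Finset.card_le_card h1
      have h4 := Finset.card_le_card h2
      rw [wedge, Finset.card_singleton] at h3
      rw [wedge, Finset.card_pair (dirX_ne_dirY τ σ)] at h4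
      omega
  nondegenerate := by
    intro s hs
    rcases mem_saddleCells_iff.mp hs with ⟨k, σ, _, _, hσ, hf⟩ | ⟨τ, σ, hτ, hσ, hf⟩
    · obtain ⟨-, h1, h2⟩ := mem_faces_iff.mp hf
      exact (nondegenerate_strip N k (by omega)).mono h1 h2
    · obtain ⟨-, h1, h2⟩ := mem_faces_iff.mp hf
      exact (nondegenerate_wedge N (by omega) (by omega)).mono h1 h2
  face_mem := by
    intro s hs V D hV hD hne
    have hsub : ∀ m, s ∈ faces m → (V, D) ∈ faces m := by
      intro m hm
      obtain ⟨-, h1, h2⟩ := mem_faces_iff.mp hm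
      exact mem_faces_iff.mpr ⟨hne, hV.trans h1, hD.trans h2⟩
    rw [mem_saddleCells_iff] at hs ⊢
    rcases hs with ⟨k, σ, h1, h2, hσ, hf⟩ | ⟨τ, σ, hτ, hσ, hf⟩
    · exact Or.inl ⟨k, σ, h1, h2, hσ, hsub _ hf⟩
    · exact Or.inr ⟨τ, σ, hτ, hσ, hsub _ hf⟩
  -- By `saddle_spec`, the vertices and directions of a face can be recovered from any of its
  -- points.
  disjoint_cells := by
    intro s hs t ht hst
    rw [disjoint_left]
    intro p hps hpt
    obtain ⟨h1, h2, -⟩ := saddle_spec hN hs hps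
    obtain ⟨h3, h4, -⟩ := saddle_spec hN ht hpt
    apply hst
    ext e
    · rw [h1, h3]
    · rw [h2, h4]

theorem saddle_support {N : ℕ} (hN : 1 ≤ N) :
    (saddle N hN).support = {p | p 2 = height N (p 0) (p 1)} := by
  classical
  ext p
  simp only [Scene.support, mem_iUnion]
  constructor
  · rintro ⟨s, hs, hp⟩
    exact (saddle_spec hN hs hp).2.2
  · intro hp
    have hp : p 2 = height N (p 0) (p 1) := hp
    suffices ∃ s ∈ saddleCells N, p ∈ openCell s by
      obtain ⟨s, h1, h2⟩ := this
      exact ⟨s, h1, h2⟩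
    have hN' : (1 : ℝ) ≤ N := by exact_mod_cast hN
    obtain ⟨σ, hσ, hσp⟩ : ∃ σ : ℤ, (σ = 1 ∨ σ = -1) ∧ (σ : ℝ) * |p 1| = p 1 := by
      rcases le_total 0 (p 1) with h | h
      · exact ⟨1, Or.inl rfl, by rw [abs_of_nonneg h]; simp⟩
      · exact ⟨-1, Or.inr rfl, by rw [abs_of_nonpos h]; simp⟩
    by_cases hx : |p 0| ≤ 2 * N
    · rw [abs_le] at hx
      obtain ⟨k, hk1, hk2, hk3, hk4⟩ : ∃ k : ℤ, -(2 * N : ℤ) ≤ k ∧ k < 2 * N ∧ (k : ℝ) ≤ p 0 ∧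
          p 0 ≤ k + 1 := by
        refine ⟨min ⌊p 0⌋ (2 * N - 1), ?_, ?_, ?_, ?_⟩
        · refine le_min (Int.le_floor.mpr ?_) (by omega)
          push_cast
          exact hx.1
        · exact (min_le_right _ _).trans_lt (by omega)
        · exact (Int.cast_le.mpr (min_le_left _ _)).trans (Int.floor_le _)
        · rcases min_choice ⌊p 0⌋ (2 * N - 1 : ℤ) with h | h
          · rw [h]
            exact (Int.lt_floor_add_one _).le
          · rw [h]
            push_cast
            linarith [hx.2]
      obtain ⟨s, hs, hps⟩ := exists_mem_faces_of_coordinates (m := strip N k σ)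
        (a := fun v => if v = vert N k then 1 - (p 0 - k) else p 0 - k) (b := fun _ => |p 1|)
        (by
          intro v _
          dsimp only
          split_ifs <;> linarith)
        (fun _ _ => abs_nonneg _)
        (by
          rw [strip, Finset.sum_pair (vert_ne_succ N k), if_pos rfl,
            if_neg (vert_ne_succ N k).symm]
          ring)
      refine ⟨s, mem_saddleCells_iff.mpr (Or.inl ⟨k, σ, hk1, hk2, hσ, hs⟩), ?_⟩
      convert hps using 1
      rw [strip, Finset.sum_pair (vert_ne_succ N k), if_pos rfl, if_neg (vert_ne_succ N k).symm,
        Finset.sum_singleton]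
      apply E3.ext
      · simp
        ring
      · simp
        linarith
      · have := profile_affine hN k (β := p 0 - k) (by linarith) (by linarith)
        simp only [add_sub_cancel] at this
        simp
        rw [hp, height, ← this]
    · obtain ⟨τ, hτ, hτp⟩ : ∃ τ : ℤ, (τ = 1 ∨ τ = -1) ∧ (τ : ℝ) * |p 0| = p 0 := by
        rcases le_total 0 (p 0) with h | h
        · exact ⟨1, Or.inl rfl, by rw [abs_of_nonneg h]; simp⟩
        · exact ⟨-1, Or.inr rfl, by rw [abs_of_nonpos h]; simp⟩
      push Not at hx
      obtain ⟨s, hs, hps⟩ := exists_mem_faces_of_coordinates (m := wedge N τ σ)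
        (a := fun _ => 1) (b := fun v => if v = dirX τ then |p 0| - 2 * N else |p 1|)
        (fun _ _ => zero_le_one)
        (by
          intro v _
          dsimp only
          split_ifs
          · linarith
          · exact abs_nonneg _)
        (by rw [wedge, Finset.sum_singleton])
      refine ⟨s, mem_saddleCells_iff.mpr (Or.inr ⟨τ, σ, hτ, hσ, hs⟩), ?_⟩
      convert hps using 1
      rw [wedge, Finset.sum_pair (dirX_ne_dirY τ σ), if_pos rfl, if_neg (dirX_ne_dirY τ σ).symm,
        Finset.sum_singleton]
      have hτa : |(τ : ℝ)| = 1 := by rcases hτ with rfl | rfl <;> simp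
      apply E3.ext
      · simp
        linear_combination -hτp
      · simp
        linarith
      · simp
        rw [hp, height, profile, profile, abs_mul, hτa, one_mul,
          abs_of_nonneg (by linarith : (0 : ℝ) ≤ 2 * N), min_eq_right (by linarith),
          min_eq_right (by linarith)]
        ring

theorem saddle_isTerrainOver {N : ℕ} (hN : 1 ≤ N) : (saddle N hN).IsTerrainOver univ := by
  rw [Scene.IsTerrainOver, saddle_support]
  refine ⟨fun _ _ => mem_univ _, ?_, ?_⟩
  · intro p hp q hq h
    have h0 : p 0 = q 0 := congrArg Prod.fst h
    have h1 : p 1 = q 1 := congrArg Prod.snd h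
    have hp : p 2 = height N (p 0) (p 1) := hp
    have hq : q 2 = height N (q 0) (q 1) := hq
    exact E3.ext h0 h1 (by rw [hp, hq, h0, h1])
  · rintro ⟨x, y⟩ _
    exact ⟨!₂[x, y, height N x y], rfl, rfl⟩

/-- The obstacle is the closed region below the graph; vertical displacements show that it is
regular closed with the graph as frontier. -/
theorem saddle_isObstacleBoundary {N : ℕ} (hN : 1 ≤ N) :
    (saddle N hN).IsObstacleBoundary {p | p 2 ≤ height N (p 0) (p 1)} := by
  set O : Set E3 := {p | p 2 ≤ height N (p 0) (p 1)}
  have hc : Continuous fun p : E3 => height N (p 0) (p 1) := by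
    unfold height profile
    fun_prop
  have hc2 : Continuous fun p : E3 => p 2 := by fun_prop
  have hO : IsClosed O := isClosed_le hc2 hc
  have hlt : {p : E3 | p 2 < height N (p 0) (p 1)} ⊆ interior O :=
    interior_maximal (fun p (hp : p 2 < height N (p 0) (p 1)) => hp.le) (isOpen_lt hc2 hc)
  have htend : ∀ (p : E3) (c : ℝ),
      Tendsto (fun t : ℝ => p + t • (!₂[0, 0, c] : E3)) (𝓝[>] 0) (𝓝 p) := by
    intro p c
    have h : Continuous fun t : ℝ => p + t • (!₂[0, 0, c] : E3) := by fun_prop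
    have := h.tendsto 0
    simp only [zero_smul, add_zero] at this
    exact this.mono_left nhdsWithin_le_nhds
  constructor
  · refine Subset.antisymm (closure_minimal interior_subset hO) fun p hp => ?_
    have hp : p 2 ≤ height N (p 0) (p 1) := hp
    refine mem_closure_of_tendsto (htend p (-1)) ?_
    filter_upwards [self_mem_nhdsWithin] with t ht
    apply hlt
    have ht : 0 < t := ht
    simp
    linarith
  · rw [saddle_support, hO.frontier_eq]
    ext p
    constructor
    · rintro ⟨h1, h2⟩
      exact le_antisymm h1 (not_lt.mp fun h => h2 (hlt h))
    · intro hp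
      have hp : p 2 = height N (p 0) (p 1) := hp
      refine ⟨hp.le, fun hint => ?_⟩
      obtain ⟨t, h1, h2⟩ := (((htend p 1).eventually (isOpen_interior.mem_nhds hint)).and
        self_mem_nhdsWithin).exists
      have h3 : (p + t • (!₂[0, 0, 1] : E3)) ∈ O := interior_subset h1
      have h2 : 0 < t := h2
      simp [O] at h3
      linarith

end VisMap

end

/-! ### The N^4 grid lines and the lower bound. -/

noncomputable section

namespace VisMap

/-! ### Many cells for the saddle-shaped terrain -/

/-- The position of the half-strip at distance `m` from the origin on the side `σ`. -/
def stripIndex (σ m : ℤ) : ℤ := if σ = 1 then m else -m - 1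

theorem mem_openCell_strip_iff {N : ℕ} (hN : 1 ≤ N) {k σ : ℤ} (hσ : σ = 1 ∨ σ = -1) {p : E3} :
    p ∈ openCell (strip N k σ) ↔
      (k < p 0 ∧ p 0 < k + 1) ∧ 0 < σ * p 1 ∧ p 2 = profile N (p 0) + σ * p 1 := by
  classical
  have hσσ : (σ : ℝ) * σ = 1 := by rcases hσ with rfl | rfl <;> norm_num
  constructor
  · rintro ⟨a, b, ha, hsum, hb, hpe⟩
    have h1 := ha (vert N k) (by simp [strip])
    have h2 := ha (vert N (k + 1)) (by simp [strip])
    have h3 := hb (dirY σ) (by simp [strip])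
    simp only [strip, Finset.sum_pair (vert_ne_succ N k), Finset.sum_singleton] at hsum hpe
    have hα : a (vert N k) = 1 - a (vert N (k + 1)) := by linarith
    have p0 : p 0 = k + a (vert N (k + 1)) := by
      rw [hpe]
      simp
      linear_combination (k : ℝ) * hsum
    have p1 : σ * p 1 = b (dirY σ) := by
      rw [hpe]
      simp
      linear_combination b (dirY σ) * hσσ
    have p2 : p 2 = a (vert N k) * profile N k + a (vert N (k + 1)) * profile N (k + 1) +
        b (dirY σ) := by
      rw [hpe]
      simp
    refine ⟨⟨by linarith, by linarith⟩, by rwa [p1], ?_⟩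
    rw [p1, p2, p0, hα, profile_affine hN k h2.le (by linarith)]
  · rintro ⟨⟨h1, h2⟩, h3, h4⟩
    refine ⟨fun v => if v = vert N k then 1 - (p 0 - k) else p 0 - k, fun _ => σ * p 1,
      fun v _ => ?_, ?_, fun _ _ => h3, ?_⟩
    · dsimp only
      split_ifs <;> linarith
    · rw [strip, Finset.sum_pair (vert_ne_succ N k), if_pos rfl, if_neg (vert_ne_succ N k).symm]
      ring
    · simp only [strip, Finset.sum_pair (vert_ne_succ N k), Finset.sum_singleton]
      rw [if_pos trivial, if_neg (vert_ne_succ N k).symm]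
      have := profile_affine hN k (β := p 0 - k) (by linarith) (by linarith)
      simp only [add_sub_cancel] at this
      apply E3.ext
      · simp
        ring
      · simp
        linear_combination -(p 1) * hσσ
      · simp
        rw [h4, ← this]

theorem mem_openCell_strip_stripIndex_iff {N : ℕ} (hN : 1 ≤ N) {m σ : ℤ} (hσ : σ = 1 ∨ σ = -1)
    {p : E3} : p ∈ openCell (strip N (stripIndex σ m) σ) ↔
      (m < σ * p 0 ∧ σ * p 0 < m + 1) ∧ 0 < σ * p 1 ∧ p 2 = profile N (σ * p 0) + σ * p 1 := by
  rw [mem_openCell_strip_iff hN hσ]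
  rcases hσ with rfl | rfl
  · simp [stripIndex]
  · have : profile N (((-1 : ℤ) : ℝ) * p 0) = profile N (p 0) := by simp [profile]
    rw [this]
    refine and_congr_left fun _ => ?_
    simp only [stripIndex]
    push_cast
    constructor <;> rintro ⟨h1, h2⟩ <;> constructor <;> linarith

/-- Which half-strips on the side `σ` are met by a line given by its two equations. -/
theorem strip_inter_nonempty_iff {N : ℕ} (hN : 1 ≤ N) {σ : ℤ} (hσ : σ = 1 ∨ σ = -1)
    {s t C' s' : ℝ} (hs0 : 0 < s) (hsN : s < N) (ht : 0 < t) (hC' : 0 < C') (hs' : 0 < s')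
    {L : Set E3} (hL : ∀ p : E3, p ∈ L ↔ p 2 - σ * p 1 = -(t / (N + t - s)) * (σ * p 0 - s) ∧
      p 2 + σ * p 1 = C' * (σ * p 0 + s')) {m : ℤ} (hm : 0 ≤ m) :
    (m < N → ((openCell (strip N (stripIndex σ m) σ) ∩ L).Nonempty ↔ m < s ∧ s < m + 1)) ∧
    (N ≤ m → ((openCell (strip N (stripIndex σ m) σ) ∩ L).Nonempty ↔
      m < N + t ∧ N + t < m + 1)) := by
  have hσσ : (σ : ℝ) * σ = 1 := by rcases hσ with rfl | rfl <;> norm_num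
  have hD : 0 < N + t - s := by linarith
  have hmul : ∀ x : ℝ, (σ : ℝ) * (σ * x) = x := fun x => by rw [← mul_assoc, hσσ, one_mul]
  have hm' : (0 : ℝ) ≤ m := by exact_mod_cast hm
  constructor
  · intro hmN
    have hmN' : (m : ℝ) + 1 ≤ N := by exact_mod_cast hmN
    constructor
    · rintro ⟨p, hp, hpL⟩
      obtain ⟨⟨h1, h2⟩, -, h4⟩ := (mem_openCell_strip_stripIndex_iff hN hσ).mp hp
      have h5 := ((hL p).mp hpL).1
      rw [h4, profile, abs_of_nonneg (by linarith), min_eq_left (by linarith)] at h5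
      -- On this strip the profile is zero and the terrain satisfies z - σy = 0, so the first
      -- equation alone fixes the crossing at σx = s.
      have h6 : t / (N + t - s) * (σ * p 0 - s) = 0 := by linarith
      have h7 := (mul_eq_zero.mp h6).resolve_left (div_pos ht hD).ne'
      have h8 : s = σ * p 0 := by linarith
      rw [h8]
      exact ⟨h1, h2⟩
    · rintro ⟨h1, h2⟩
      -- Solving both equations at σx = s. Positivity of σy, the only use of the second equation,
      -- puts the point on the correct side of the axis.
      have hy : 0 < C' * (s + s') / 2 := by positivity
      refine ⟨!₂[σ * s, σ * (C' * (s + s') / 2), C' * (s + s') / 2],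
        (mem_openCell_strip_stripIndex_iff hN hσ).mpr ?_, (hL _).mpr ?_⟩
      · simp only [Matrix.cons_val, hmul]
        refine ⟨⟨h1, h2⟩, hy, ?_⟩
        rw [profile, abs_of_nonneg hs0.le, min_eq_left (by linarith), zero_add]
      · simp only [Matrix.cons_val, hmul]
        constructor <;> ring
  · intro hmN
    have hmN' : (N : ℝ) ≤ m := by exact_mod_cast hmN
    constructor
    · rintro ⟨p, hp, hpL⟩
      obtain ⟨⟨h1, h2⟩, -, h4⟩ := (mem_openCell_strip_stripIndex_iff hN hσ).mp hp
      have h5 := ((hL p).mp hpL).1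
      rw [h4, profile, abs_of_nonneg (by linarith), min_eq_right (by linarith)] at h5
      -- On the descending part the profile is N - σx; the slope is that of the chord from (s, 0) to
      -- (N + t, -t), so the crossing is at σx = N + t.
      have h6 : (N - s) * (N + t - σ * p 0) = 0 := by
        field_simp at h5
        linear_combination h5
      have h7 := (mul_eq_zero.mp h6).resolve_left (by linarith)
      have h8 : N + t = σ * p 0 := by linarith
      rw [h8]
      exact ⟨h1, h2⟩
    · rintro ⟨h1, h2⟩
      have hy : 0 < (C' * (N + t + s') + t) / 2 := by positivity
      refine ⟨!₂[σ * (N + t), σ * ((C' * (N + t + s') + t) / 2),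
        (C' * (N + t + s') + t) / 2 - t],
        (mem_openCell_strip_stripIndex_iff hN hσ).mpr ?_, (hL _).mpr ?_⟩
      · simp only [Matrix.cons_val, hmul]
        refine ⟨⟨h1, h2⟩, hy, ?_⟩
        rw [profile, abs_of_nonneg (by linarith), min_eq_right (by linarith)]
        ring
      · simp only [Matrix.cons_val, hmul]
        constructor
        · field_simp
          ring
        · ring

/-- The line with the equations `z - y = -C₁ (x - s₁)` and `z + y = C₂ (x + s₂)`. -/
def crossLine (C₁ s₁ C₂ s₂ : ℝ) : PointedLine :=
  ⟨(!₂[0, (C₂ * s₂ - C₁ * s₁) / 2, (C₁ * s₁ + C₂ * s₂) / 2], !₂[1, (C₂ + C₁) / 2, (C₂ - C₁) / 2]),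
    fun h => by simpa using congrArg (fun v : E3 => v 0) h⟩

theorem mem_lineSet_crossLine_iff {C₁ s₁ C₂ s₂ : ℝ} {p : E3} :
    p ∈ lineSet (crossLine C₁ s₁ C₂ s₂) ↔
      p 2 - p 1 = -C₁ * (p 0 - s₁) ∧ p 2 + p 1 = C₂ * (p 0 + s₂) := by
  constructor
  · rintro ⟨x, rfl⟩
    simp [crossLine]
    constructor <;> ring
  · rintro ⟨h1, h2⟩
    refine ⟨p 0, E3.ext ?_ ?_ ?_⟩
    · simp [crossLine]
    · simp [crossLine]
      linarith
    · simp [crossLine]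
      linarith

/-- The slope of the line through the points `(i + 1/2, 0)` and `(N + j + 1/2, -(j + 1/2))` of the
graph of the profile, up to sign. -/
def slope (N : ℕ) (i j : Fin N) : ℝ := (j + 1 / 2) / (N + (j + 1 / 2) - (i + 1 / 2))

theorem fin_add_half_lt {N : ℕ} (i : Fin N) : (i : ℝ) + 1 / 2 < N := by
  have : ((i : ℕ) : ℝ) + 1 ≤ N := by exact_mod_cast i.2
  linarith

theorem slope_pos {N : ℕ} (i j : Fin N) : 0 < slope N i j := by
  have := fin_add_half_lt i
  exact div_pos (by positivity) (by linarith [Nat.cast_nonneg (α := ℝ) (j : ℕ)])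

/-- The line crossing the profile in the given intervals on both sides. -/
def gridLine (N : ℕ) (x : (Fin N × Fin N) × (Fin N × Fin N)) : PointedLine :=
  crossLine (slope N x.1.1 x.1.2) (x.1.1 + 1 / 2) (slope N x.2.1 x.2.2) (x.2.1 + 1 / 2)

/-- The half-turn about the vertical axis exchanges the two equations, so both sides can be treated
at once with the sign `σ`. -/
theorem gridLine_equations (N : ℕ) (x : (Fin N × Fin N) × (Fin N × Fin N)) {σ : ℤ} {y y' : Fin N × Fin N}
    (h : σ = 1 ∧ y = x.1 ∧ y' = x.2 ∨ σ = -1 ∧ y = x.2 ∧ y' = x.1) (p : E3) :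
    p ∈ lineSet (gridLine N x) ↔
      p 2 - σ * p 1 = -((y.2 + 1 / 2) / (N + (y.2 + 1 / 2) - (y.1 + 1 / 2))) *
        (σ * p 0 - (y.1 + 1 / 2)) ∧
      p 2 + σ * p 1 = slope N y'.1 y'.2 * (σ * p 0 + (y'.1 + 1 / 2)) := by
  rw [gridLine, mem_lineSet_crossLine_iff]
  rcases h with ⟨rfl, rfl, rfl⟩ | ⟨rfl, rfl, rfl⟩
  · simp only [slope, Int.cast_one, one_mul]
  · change _ ↔ _ = -slope N x.2.1 x.2.2 * _ ∧ _
    push_cast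
    constructor
    · rintro ⟨h1, h2⟩
      exact ⟨by linear_combination h2, by linear_combination h1⟩
    · rintro ⟨h1, h2⟩
      exact ⟨by linear_combination h2, by linear_combination h1⟩

theorem eq_of_lt_add_half {i j : ℤ} (h : (i : ℝ) < j + 1 / 2 ∧ (j : ℝ) + 1 / 2 < i + 1) :
    i = j := by
  have h1 : (i : ℝ) < j + 1 := by linarith
  have h2 : (j : ℝ) < i + 1 := by linarith
  have h1' : i < j + 1 := by exact_mod_cast h1
  have h2' : j < i + 1 := by exact_mod_cast h2
  omega

/-- On side `σ` the line crosses exactly one half-strip over the flat part 0 ≤ σx < N and one over N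
≤ σx < 2N; their positions return the two indices. The shift by 1/2 keeps crossings off the strip
boundaries. -/
theorem gridLine_side_eq {N : ℕ} (hN : 1 ≤ N) {x z : (Fin N × Fin N) × (Fin N × Fin N)}
    (hxz : (saddle N hN).facesMet (toLine (gridLine N x)) =
      (saddle N hN).facesMet (toLine (gridLine N z))) {σ : ℤ} {y y' w w' : Fin N × Fin N}
    (hx : σ = 1 ∧ y = x.1 ∧ y' = x.2 ∨ σ = -1 ∧ y = x.2 ∧ y' = x.1)
    (hz : σ = 1 ∧ w = z.1 ∧ w' = z.2 ∨ σ = -1 ∧ w = z.2 ∧ w' = z.1) : y = w := by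
  have hσ : σ = 1 ∨ σ = -1 := hx.imp And.left And.left
  have hhalf : ∀ i : Fin N, (0 : ℝ) < i + 1 / 2 := fun i => by positivity
  have keyx := fun m : ℤ => strip_inter_nonempty_iff hN hσ (hhalf y.1) (fin_add_half_lt y.1)
    (hhalf y.2) (slope_pos y'.1 y'.2) (hhalf y'.1) (gridLine_equations N x hx) (m := m)
  have keyz := fun m : ℤ => strip_inter_nonempty_iff hN hσ (hhalf w.1) (fin_add_half_lt w.1)
    (hhalf w.2) (slope_pos w'.1 w'.2) (hhalf w'.1) (gridLine_equations N z hz) (m := m)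
  have hmet : ∀ m : ℤ, 0 ≤ m → m < 2 * N →
      ((openCell (strip N (stripIndex σ m) σ) ∩ lineSet (gridLine N x)).Nonempty ↔
        (openCell (strip N (stripIndex σ m) σ) ∩ lineSet (gridLine N z)).Nonempty) := by
    classical
    intro m h0 h1
    have hcell : strip N (stripIndex σ m) σ ∈ saddleCells N := by
      refine mem_saddleCells_iff.mpr (Or.inl ⟨stripIndex σ m, σ, ?_, ?_, hσ, ?_⟩)
      · rcases hσ with rfl | rfl <;> simp [stripIndex] <;> omega
      · rcases hσ with rfl | rfl <;> simp [stripIndex] <;> omega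
      · exact mem_faces_iff.mpr ⟨⟨_, Finset.mem_insert_self _ _⟩, subset_rfl, subset_rfl⟩
    have h2 : strip N (stripIndex σ m) σ ∈ (saddle N hN).facesMet (toLine (gridLine N x)) ↔
        strip N (stripIndex σ m) σ ∈ (saddle N hN).facesMet (toLine (gridLine N z)) := by
      rw [hxz]
    constructor
    · exact fun h => (h2.mp ⟨hcell, h⟩).2
    · exact fun h => (h2.mpr ⟨hcell, h⟩).2
  have h1 := y.1.2
  have h2 := y.2.2
  apply Prod.ext
  · have hm := hmet (y.1 : ℕ) (by omega) (by omega)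
    rw [(keyx _ (by omega)).1 (by omega), (keyz _ (by omega)).1 (by omega)] at hm
    have := eq_of_lt_add_half (i := ((y.1 : ℕ) : ℤ)) (j := ((w.1 : ℕ) : ℤ))
      (by simpa using hm.mp (by push_cast; constructor <;> linarith))
    exact Fin.ext (by omega)
  · have hm := hmet (N + (y.2 : ℕ)) (by omega) (by omega)
    rw [(keyx _ (by omega)).2 (by omega), (keyz _ (by omega)).2 (by omega)] at hm
    have h3 := hm.mp (by push_cast; constructor <;> linarith)
    push_cast at h3
    have := eq_of_lt_add_half (i := ((y.2 : ℕ) : ℤ)) (j := ((w.2 : ℕ) : ℤ))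
      (by push_cast; constructor <;> linarith [h3.1, h3.2])
    exact Fin.ext (by omega)

theorem le_ncard_saddle {N : ℕ} (hN : 1 ≤ N) : N ^ 4 ≤ (saddle N hN).visibilityMap.ncard := by
  let c : (Fin N × Fin N) × (Fin N × Fin N) → Set LineSpace := fun x =>
    connectedComponentIn {m | (saddle N hN).facesMet m =
      (saddle N hN).facesMet (toLine (gridLine N x))} (toLine (gridLine N x))
  have hc : Function.Injective c := by
    intro x z h
    have hmem : toLine (gridLine N x) ∈ c z := by
      rw [← h]
      exact mem_connectedComponentIn rfl
    have hmet : toLine (gridLine N x) ∈ {m | (saddle N hN).facesMet m =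
      (saddle N hN).facesMet (toLine (gridLine N z))} := connectedComponentIn_subset _ _ hmem
    exact Prod.ext
      (gridLine_side_eq hN hmet (Or.inl ⟨rfl, rfl, rfl⟩) (Or.inl ⟨rfl, rfl, rfl⟩))
      (gridLine_side_eq hN hmet (Or.inr ⟨rfl, rfl, rfl⟩) (Or.inr ⟨rfl, rfl, rfl⟩))
  have hsub : range c ⊆ (saddle N hN).visibilityMap := by
    rintro _ ⟨x, rfl⟩
    exact ⟨_, rfl⟩
  refine le_trans (le_of_eq ?_) (Set.ncard_le_ncard hsub (saddle N hN).finite_and_ncard_le.1)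
  rw [← Set.image_univ, Set.ncard_image_of_injective _ hc, Set.ncard_univ]
  simp
  ring

theorem exists_saddle {n : ℕ} (hn : 256 ≤ n) : ∃ (N : ℕ) (hN : 1 ≤ N),
    (saddle N hN).complexity ≤ n ∧
      (1 / 128 : ℝ) ^ 4 * (n : ℝ) ^ 4 ≤ ((saddle N hN).visibilityMap.ncard : ℝ) := by
  -- The terrain has at most 64N + 32 faces, which is at most n for this N. From n ≥ 256 on, also n
  -- ≤ 128N.
  refine ⟨n / 64 - 1, by omega, ?_, ?_⟩
  · exact (card_saddleCells_le _).trans (by omega)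
  · have h1 : (((n / 64 - 1) ^ 4 : ℕ) : ℝ) ≤ _ :=
      Nat.cast_le.mpr (le_ncard_saddle (N := n / 64 - 1) (by omega))
    refine le_trans ?_ h1
    have h2 : n ≤ 128 * (n / 64 - 1) := by omega
    have h3 : (n : ℝ) ≤ 128 * ((n / 64 - 1 : ℕ) : ℝ) := by exact_mod_cast h2
    rw [Nat.cast_pow, ← mul_pow]
    exact pow_le_pow_left₀ (by positivity) (by linarith) 4

end VisMap

end


theorem mainTheorem11 :
    -- the map encodes visibility: whether two points of the scene see each other depends only on
    -- the faces containing them and on the cell of the map containing the line through them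
    (∀ (K : VisMap.Scene) (O : Set VisMap.E3), IsClosed O → frontier O = K.support →
      ∀ c ∈ K.visibilityMap, ∀ l₁ ∈ c, ∀ l₂ ∈ c, ∀ s ∈ K.cells, ∀ t ∈ K.cells,
      ∀ p₁ ∈ VisMap.openCell s ∩ l₁.points, ∀ q₁ ∈ VisMap.openCell t ∩ l₁.points,
      ∀ p₂ ∈ VisMap.openCell s ∩ l₂.points, ∀ q₂ ∈ VisMap.openCell t ∩ l₂.points,
        (VisMap.Visible O p₁ q₁ ↔ VisMap.Visible O p₂ q₂)) ∧
    -- upper bound, for every scene (terrain or boundary of obstacles)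
    (∃ C : ℝ, 0 < C ∧ ∀ K : VisMap.Scene, K.cells.Nonempty →
      K.visibilityMap.Finite ∧ (K.visibilityMap.ncard : ℝ) ≤ C * (K.complexity : ℝ) ^ 4) ∧
    -- lower bound for terrains
    (∃ c : ℝ, 0 < c ∧ ∃ n₀ : ℕ, ∀ n : ℕ, n₀ ≤ n → ∃ (K : VisMap.Scene) (R : Set (ℝ × ℝ)),
      Convex ℝ R ∧ (interior R).Nonempty ∧ K.IsTerrainOver R ∧
      K.complexity ≤ n ∧ c * (n : ℝ) ^ 4 ≤ (K.visibilityMap.ncard : ℝ)) ∧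
    -- lower bound for obstacles in space
    (∃ c : ℝ, 0 < c ∧ ∃ n₀ : ℕ, ∀ n : ℕ, n₀ ≤ n → ∃ (K : VisMap.Scene) (O : Set VisMap.E3),
      K.IsObstacleBoundary O ∧
      K.complexity ≤ n ∧ c * (n : ℝ) ^ 4 ≤ (K.visibilityMap.ncard : ℝ)) := by
  refine ⟨fun K O hO hfr c hc l₁ hl₁ l₂ hl₂ s hs t ht p₁ hp₁ q₁ hq₁ p₂ hp₂ q₂ hq₂ =>
    VisMap.Scene.visible_iff_of_mem_cell hO hfr hc hl₁ hl₂ hs ht hp₁ hq₁ hp₂ hq₂,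
    -- A nonempty scene has complexity n ≥ 1, so 36n + 9 ≤ 45n.
    ⟨6 * 45 ^ 4, by norm_num, fun K hK => ?_⟩,
    ⟨(1 / 128) ^ 4, by positivity, 256, fun n hn => ?_⟩,
    ⟨(1 / 128) ^ 4, by positivity, 256, fun n hn => ?_⟩⟩
  · obtain ⟨hfin, hle⟩ := K.finite_and_ncard_le
    refine ⟨hfin, ?_⟩
    have h1 : 1 ≤ K.complexity := hK.card_pos
    have h2 : K.visibilityMap.ncard ≤ 6 * (45 * K.complexity) ^ 4 :=
      hle.trans (by gcongr; omega)
    rw [mul_assoc, ← mul_pow]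
    exact_mod_cast h2
  · obtain ⟨N, hN, h1, h2⟩ := VisMap.exists_saddle hn
    exact ⟨VisMap.saddle N hN, univ, convex_univ, by simp, VisMap.saddle_isTerrainOver hN, h1, h2⟩
  · obtain ⟨N, hN, h1, h2⟩ := VisMap.exists_saddle hn
    exact ⟨VisMap.saddle N hN, _, VisMap.saddle_isObstacleBoundary hN, h1, h2⟩
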